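/- **Setting.** A Netsor$\top$ program has finitely many input matrices (input A-vars) and finitely many input vectors (input G-vars), and depends on a width $n$: the matrices are $n\times n$ and the vectors are in $\mathbb R^n$. An A-var is an input matrix $W$ or its transpose $W^\top$. An H-var is a G-var, or a vector $\varphi(x^1,\dots,x^k)$ obtained by applying a nonlinearity $\varphi:\mathbb R^k\to\mathbb R$ coordinatewise to previously introduced G-vars $x^1,\dots,x^k$. The program successively introduces new G-vars $g := A h$, where $A$ is an A-var and $h$ is an H-var. Let $g^1,\dots,g^M$ be all its G-vars, including the input G-vars. Every H-var can be written as $h=\varphi(g^1,\dots,g^M)$, where $\varphi$ depends only on the G-vars introduced before $h$. A (Borel measurable) function $f:\mathbb R^k\to\mathbb R$ is polynomially bounded if $|f(x)|\le C\|x\|^p+c$ for all $x$, for some constants $C,p,c>0$. **Sampling.** For every $n$, independently, the entries of each input matrix $W$ are i.i.d. $\mathcal N(0,\sigma_W^2/n)$ with a constant $\sigma_W\ge 0$ depending only on $W$, and, for each $\alpha\in\{1,\dots,n\}$, the tuple of the $\alpha$-th coordinates of the input G-vars is drawn from $\mathcal N(\mu^{\mathrm{in}},\Sigma^{\mathrm{in}})$,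 where $\Sigma^{\mathrm{in}}$ is positive semidefinite and possibly singular. All matrices and all these tuples are independent. "Almost surely" refers to the product over all $n$ of these probability spaces. **BP-like.** The program is BP-like if there is a set $V$ of input G-vars such that, regarding all variables as functions of the inputs (the input vectors and the input matrices) at every width $n$: 1. whenever $W^\top z$ is used in the program, with $W$ an input matrix and $z$ an H-var, $z$ is an odd function of the vectors in $V$: if all of them are negated simultaneously and all other inputs are fixed, then $z$ is negated; 2. whenever $W y$ is used in the program, with $W$ an input matrix and $y$ an H-var, $y$ does not depend on the vectors in $V$; 3. the input vectors in $V$ have zero mean and are independent from all other input vectors: $\mu^{\mathrm{in}}(v)=0$ and $\Sigma^{\mathrm{in}}(v,x)=0$ for all $v\in V$ and all input G-vars $x\notin V$. **Limiting mean and covariance.** Put $\mu(g)=\mu^{\mathrm{in}}(g)$ if $g$ is an input G-var and $\mu(g)=0$ otherwise. Define $\Sigma$ recursively along the program by $$\Sigma(g,\bar g)=\begin{cases}\Sigma^{\mathrm{in}}(g,\bar g) & \text{if } g,\bar g \text{ are input G-vars},\\ \sigma_W^2\,\mathbb E\,\varphi(Z)\bar\varphi(Z) & \text{if } g=Ah,\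 \bar g=A\bar h \text{ for the same A-var } A\in\{W,W^\top\},\\ 0&\text{otherwise,}\end{cases}$$ where $h=\varphi(g^1,\dots,g^M)$, $\bar h=\bar\varphi(g^1,\dots,g^M)$, and $Z\sim\mathcal N(\mu,\Sigma)$. (The expectation only involves the components of $Z$ belonging to G-vars that precede the later one of $g,\bar g$.) **Theorem (BP-like Netsor$\top$ Master Theorem).** Let a BP-like Netsor$\top$ program be given all of whose nonlinearities are polynomially bounded, with inputs sampled as above, and let $g^1,\dots,g^M$ be all its G-vars, including the input G-vars. Then $\Sigma$ is positive semidefinite, and for every polynomially bounded $\psi:\mathbb R^M\to\mathbb R$, $\psi$ is integrable with respect to $\mathcal N(\mu,\Sigma)$ and, as $n\to\infty$, $$\frac1n\sum_{\alpha=1}^n\psi(g^1_\alpha,\dots,g^M_\alpha)\ \xrightarrow{\ \mathrm{a.s.}\ }\ \mathbb E_{Z\sim\mathcal N(\mu,\Sigma)}\,\psi(Z).$$ -/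

import Mathlib

open MeasureTheory ProbabilityTheory Filter Topology
open scoped NNReal Matrix

noncomputable section

namespace NetsorT

/-- A function on a normed space is polynomially bounded if `|f x| ≤ C ‖x‖ ^ p + c` for all `x`,
for some constants `C, p, c > 0`. (On `ℝ^k` this does not depend on the choice of norm.) -/
def PolyBounded {E : Type*} [Norm E] (f : E → ℝ) : Prop :=
  ∃ C p c : ℝ, 0 < C ∧ 0 < p ∧ 0 < c ∧ ∀ x, |f x| ≤ C * ‖x‖ ^ p + c

/-! ### The language

`ι` indexes the input G-vars, `κ` indexes the input A-vars. A program in which `m` G-vars have been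
produced by matrix multiplication has the G-vars `ι ⊕ Fin m`. -/

/-- A-vars: an input matrix, or the transpose of an input matrix. (The rule forming transposes may
be iterated, but the transpose of the transpose of `W` is `W`.) -/
inductive AVar (κ : Type*) where
  | input (W : κ) : AVar κ
  | transpose (W : κ) : AVar κ

/-- The input matrix underlying an A-var. -/
def AVar.base {κ : Type*} : AVar κ → κ
  | input W => W
  | transpose W => W

/-- The matrix denoted by an A-var, given the values of the input matrices. -/
def AVar.eval {κ : Type*} {n : ℕ} (W : κ → Matrix (Fin n) (Fin n) ℝ) :
    AVar κ → Matrix (Fin n) (Fin n) ℝ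
  | input w => W w
  | transpose w => (W w)ᵀ

/-- H-vars over the set `γ` of the G-vars available: a G-var, or `φ(x¹, …, xᵏ)` for a nonlinearity
`φ : ℝᵏ → ℝ`, applied coordinatewise, and G-vars `x¹, …, xᵏ`. -/
inductive HVar (γ : Type*) where
  | ofG (g : γ) : HVar γ
  | nonlin (k : ℕ) (φ : (Fin k → ℝ) → ℝ) (x : Fin k → γ) : HVar γ

/-- One coordinate of an H-var, as a function of the same coordinate of all available G-vars. -/
def HVar.fn {γ : Type*} : HVar γ → (γ → ℝ) → ℝ
  | ofG g => fun z => z g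
  | nonlin _ φ x => fun z => φ fun j => z (x j)

/-- The nonlinearity of an H-var (if any) is (Borel measurable and) polynomially bounded. -/
def HVar.PolyBounded {γ : Type*} : HVar γ → Prop
  | ofG _ => True
  | nonlin _ φ _ => Measurable φ ∧ NetsorT.PolyBounded φ

/-- Straightline programs that introduce `m` G-vars besides the input G-vars. Each instruction
`matmul P A h` appends the G-var `A h` to the program `P`; here `A` is an A-var and `h` is an
H-var introduced from the G-vars of `P`. -/
inductive Program (ι κ : Type*) : ℕ → Type _ where
  | inputs : Program ι κ 0
  | matmul {m : ℕ} (P : Program ι κ m) (A : AVar κ) (h : HVar (ι ⊕ Fin m)) : Program ι κ (m + 1)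

variable {ι κ : Type*}

/-- Sorts the G-vars `ι ⊕ Fin (m + 1)` into the newest one (`none`) and the previous ones. -/
def previous? {m : ℕ} : ι ⊕ Fin (m + 1) → Option (ι ⊕ Fin m)
  | Sum.inl i => some (Sum.inl i)
  | Sum.inr l => Fin.lastCases none (fun l' => some (Sum.inr l')) l

/-- Forgets the newest G-var. -/
def restrict {m : ℕ} (z : ι ⊕ Fin (m + 1) → ℝ) : ι ⊕ Fin m → ℝ :=
  Sum.elim (fun i => z (Sum.inl i)) (fun l => z (Sum.inr l.castSucc))

namespace Program

/-- All nonlinearities used in the program are polynomially bounded. -/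
def PolyBounded : {m : ℕ} → Program ι κ m → Prop
  | _, inputs => True
  | _, matmul P _ h => P.PolyBounded ∧ h.PolyBounded

/-- The values of the G-vars of a program of width `n` as a function of the input matrices `W` and
of the input vectors: `x α i` is the coordinate `α` of the input vector `i`, and `P.eval W x α g`
is the coordinate `α` of the G-var `g`. -/
def eval {n : ℕ} (W : κ → Matrix (Fin n) (Fin n) ℝ) (x : Fin n → ι → ℝ) :
    {m : ℕ} → Program ι κ m → Fin n → ι ⊕ Fin m → ℝ
  | _, inputs => fun α => Sum.elim (x α) Fin.elim0
  | _, matmul P A h => fun α g =>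
      match previous? g with
      | some g' => P.eval W x α g'
      | none => ((A.eval W) *ᵥ fun β => h.fn (P.eval W x β)) α

/-- The value, as a vector of width `n`, of an H-var introduced at the end of the program `P`. -/
def evalH {m : ℕ} (P : Program ι κ m) (h : HVar (ι ⊕ Fin m)) {n : ℕ}
    (W : κ → Matrix (Fin n) (Fin n) ℝ) (x : Fin n → ι → ℝ) : Fin n → ℝ :=
  fun α => h.fn (P.eval W x α)

/-! ### The limiting mean and covariance -/

/-- The A-var `A` in the instruction `g := A h` that introduced the `l`-th non-input G-var. -/
def mat : {m : ℕ} → Program ι κ m → Fin m → AVar κ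
  | _, inputs => Fin.elim0
  | _, matmul P A _ => Fin.lastCases A P.mat

/-- The function `φ` (of all G-vars of the program) such that the `l`-th non-input G-var was
introduced by `g := A h` with `h := φ(g¹, …, g^M)`. It ignores its superfluous arguments. -/
def hfn : {m : ℕ} → Program ι κ m → Fin m → (ι ⊕ Fin m → ℝ) → ℝ
  | _, inputs => Fin.elim0
  | _, matmul P _ h =>
      Fin.lastCases (fun z => h.fn (restrict z)) (fun l z => P.hfn l (restrict z))

end Program

/-- The Gaussian distribution `N(μ, S)` on `ℝ^γ` (`S` may be singular). -/
def gaussianVec {γ : Type*} [Fintype γ] [DecidableEq γ] (μ : γ → ℝ) (S : Matrix γ γ ℝ) :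
    Measure (γ → ℝ) :=
  (multivariateGaussian (WithLp.toLp 2 μ) S).map WithLp.ofLp

instance {γ : Type*} [Fintype γ] [DecidableEq γ] (μ : γ → ℝ) (S : Matrix γ γ ℝ) :
    IsProbabilityMeasure (gaussianVec μ S) :=
  Measure.isProbabilityMeasure_map (by fun_prop)

/-- The limiting mean: `μ(g) = μⁱⁿ(g)` for input G-vars, and `μ(g) = 0` for all others. -/
def limitMean (μ : ι → ℝ) (m : ℕ) : ι ⊕ Fin m → ℝ :=
  Sum.elim μ (fun _ => 0)

/-- The limiting covariance, computed along the program: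
* `Σ(g, g') = Σⁱⁿ(g, g')` if `g, g'` are input G-vars;
* `Σ(g, g') = σ_W² E φ(Z) φ'(Z)` if `g = A h` and `g' = A h'` for the same A-var `A` (which is the
  input matrix `W` or its transpose), where `h = φ(g¹, …, g^M)` and `h' = φ'(g¹, …, g^M)`; as `φ`
  and `φ'` only depend on the G-vars preceding the later of `g, g'`, only the mean and
  the covariance of these are needed for the expectation;
* `Σ(g, g') = 0` otherwise. -/
def Program.limitCov [Fintype ι] [DecidableEq ι] (σ : κ → ℝ≥0) (μ : ι → ℝ) (S : Matrix ι ι ℝ) :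
    {m : ℕ} → Program ι κ m → Matrix (ι ⊕ Fin m) (ι ⊕ Fin m) ℝ
  | _, inputs => Matrix.of fun g g' =>
      match g, g' with
      | Sum.inl i, Sum.inl j => S i j
      | _, _ => 0
  | _, matmul (m := m) P A h =>
      let ν := gaussianVec (limitMean μ m) (P.limitCov σ μ S)
      let new : ℝ := (σ A.base : ℝ) ^ 2 * ∫ z, h.fn z * h.fn z ∂ν
      let cross : ι ⊕ Fin m → ℝ := Sum.elim (fun _ => 0) fun l =>
        open Classical in
        if P.mat l = A then (σ A.base : ℝ) ^ 2 * ∫ z, h.fn z * P.hfn l z ∂ν else 0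
      Matrix.of fun g g' =>
        match previous? g, previous? g' with
        | some i, some j => P.limitCov σ μ S i j
        | some i, none => cross i
        | none, some j => cross j
        | none, none => new

/-! ### BP-like programs -/

/-- Negates the input vectors in `V`. -/
def negateOn (V : Set ι) {n : ℕ} (x : Fin n → ι → ℝ) : Fin n → ι → ℝ :=
  open Classical in fun α i => if i ∈ V then -x α i else x α i

/-- The conditions on the matrix multiplications of a BP-like program with special input vectors
`V`. All variables are regarded as functions of the inputs of the program.
* If `Wᵀ z` is used, `W` an input matrix, then `z` is an odd function of the vectors in `V`: when
  they are negated simultaneously, with all other inputs fixed, `z` is negated.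
* If `W y` is used, `W` an input matrix, then `y` does not depend on the vectors in `V`. -/
def Program.MatmulsBPLike (V : Set ι) : {m : ℕ} → Program ι κ m → Prop
  | _, inputs => True
  | _, matmul P (AVar.transpose _) h => P.MatmulsBPLike V ∧
      ∀ (n : ℕ) (W : κ → Matrix (Fin n) (Fin n) ℝ) (x : Fin n → ι → ℝ),
        P.evalH h W (negateOn V x) = -P.evalH h W x
  | _, matmul P (AVar.input _) h => P.MatmulsBPLike V ∧
      ∀ (n : ℕ) (W : κ → Matrix (Fin n) (Fin n) ℝ) (x x' : Fin n → ι → ℝ),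
        (∀ α, ∀ i ∉ V, x α i = x' α i) → P.evalH h W x = P.evalH h W x'

/-- A program whose input vectors are sampled with mean `μ` and covariance `S` is BP-like if, for
some set `V` of input vectors, its matrix multiplications are as described above, and the vectors
in `V` have zero mean and are independent from the other input vectors. -/
def Program.BPLike (μ : ι → ℝ) (S : Matrix ι ι ℝ) {m : ℕ} (P : Program ι κ m) : Prop :=
  ∃ V : Set ι, P.MatmulsBPLike V ∧ (∀ i ∈ V, μ i = 0) ∧
    ∀ i ∈ V, ∀ j ∉ V, S i j = 0 ∧ S j i = 0

/-! ### Sampling -/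

/-- The inputs of a program of width `n`: the entries of the matrices, and the coordinates
`α ↦ (i ↦ x α i)` of the vectors. -/
abbrev Inputs (ι κ : Type*) (n : ℕ) : Type _ :=
  (κ → Fin n → Fin n → ℝ) × (Fin n → ι → ℝ)

/-- The law of the inputs at width `n`: all entries of all matrices and all the tuples
`(x α i)_i`, for `α : Fin n`, are independent; the entries of the matrix `W` have the
distribution `N(0, σ_W² / n)`, and `(x α i)_i` has the distribution `N(μ, S)`. -/
def inputLaw [Fintype ι] [DecidableEq ι] [Fintype κ] (σ : κ → ℝ≥0) (μ : ι → ℝ)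
    (S : Matrix ι ι ℝ) (n : ℕ) : Measure (Inputs ι κ n) :=
  (Measure.pi fun W => Measure.pi fun _ : Fin n => Measure.pi fun _ : Fin n =>
    gaussianReal 0 (σ W ^ 2 / n)).prod (Measure.pi fun _ : Fin n => gaussianVec μ S)

instance [Fintype ι] [DecidableEq ι] [Fintype κ] (σ : κ → ℝ≥0) (μ : ι → ℝ)
    (S : Matrix ι ι ℝ) (n : ℕ) : IsProbabilityMeasure (inputLaw σ μ S n) := by
  unfold inputLaw; infer_instance

/-- The joint law of the inputs at all widths, which are sampled independently. -/
def jointLaw [Fintype ι] [DecidableEq ι] [Fintype κ] (σ : κ → ℝ≥0) (μ : ι → ℝ)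
    (S : Matrix ι ι ℝ) : Measure (∀ n, Inputs ι κ n) :=
  Measure.infinitePi fun n => inputLaw σ μ S n

/-- The coordinate `α` of all the G-vars of the program of width `n`, run on sampled inputs. -/
def Program.gvars {m : ℕ} (P : Program ι κ m) {n : ℕ} (s : Inputs ι κ n) (α : Fin n) :
    ι ⊕ Fin m → ℝ :=
  P.eval (fun W => Matrix.of (s.1 W)) s.2 α

end NetsorT

end

noncomputable section

namespace NetsorT

/-! ### Characteristic functions on `ℝ^γ` -/

lemma measurable_mulVec {γ γ' : Type*} [Fintype γ'] (M : Matrix γ γ' ℝ) :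
    Measurable fun z : γ' → ℝ => M *ᵥ z := by
  unfold Matrix.mulVec dotProduct; fun_prop

section CharFun

variable {γ : Type*} [Fintype γ]

/-- The characteristic function of a measure on `ℝ^γ`, written with the dot product. -/
def dotCharFun (ρ : Measure (γ → ℝ)) (a : γ → ℝ) : ℂ :=
  ∫ z, Complex.exp (((a ⬝ᵥ z : ℝ) : ℂ) * Complex.I) ∂ρ

lemma dotCharFun_eq_charFun (ρ : Measure (γ → ℝ)) (a : γ → ℝ) :
    dotCharFun ρ a = charFun (ρ.map (WithLp.toLp 2)) (WithLp.toLp 2 a) := by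
  rw [charFun_apply, ← MeasurableEquiv.coe_toLp, integral_map_equiv]
  simp [dotCharFun, PiLp.inner_apply, dotProduct]

lemma ext_of_dotCharFun {ρ ρ' : Measure (γ → ℝ)} [IsFiniteMeasure ρ] [IsFiniteMeasure ρ']
    (h : ∀ a, dotCharFun ρ a = dotCharFun ρ' a) : ρ = ρ' := by
  refine (MeasurableEquiv.toLp 2 (γ → ℝ)).map_measurableEquiv_injective
      <| Measure.ext_of_charFun (E := EuclideanSpace ℝ γ) <| funext fun t ↦ ?_
  have := h (WithLp.ofLp t)
  rw [dotCharFun_eq_charFun, dotCharFun_eq_charFun] at this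
  simpa [MeasurableEquiv.coe_toLp] using this

lemma dotCharFun_map {Ω : Type*} [MeasurableSpace Ω] {P : Measure Ω} {X : Ω → γ → ℝ}
    (hX : Measurable X) (a : γ → ℝ) :
    dotCharFun (P.map X) a = ∫ ω, Complex.exp (((a ⬝ᵥ X ω : ℝ) : ℂ) * Complex.I) ∂P := by
  rw [dotCharFun, integral_map hX.aemeasurable]
  refine Measurable.aestronglyMeasurable ?_
  unfold dotProduct
  fun_prop

lemma dotCharFun_map_mulVec {γ' : Type*} [Fintype γ'] (ρ : Measure (γ' → ℝ))
    (M : Matrix γ γ' ℝ) (a : γ → ℝ) :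
    dotCharFun (ρ.map (fun z => M *ᵥ z)) a = dotCharFun ρ (Mᵀ *ᵥ a) := by
  rw [dotCharFun_map (by unfold Matrix.mulVec dotProduct; fun_prop), dotCharFun]
  simp_rw [Matrix.dotProduct_mulVec, Matrix.mulVec_transpose]

/-- The characteristic function of a sum of independent vectors. -/
lemma dotCharFun_map_add {Ω Ω' : Type*} [MeasurableSpace Ω] [MeasurableSpace Ω']
    {P : Measure Ω} {P' : Measure Ω'} [SFinite P] [SFinite P'] {X : Ω → γ → ℝ} {Y : Ω' → γ → ℝ}
    (hX : Measurable X) (hY : Measurable Y) (a : γ → ℝ) :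
    dotCharFun ((P.prod P').map fun p => X p.1 + Y p.2) a
      = dotCharFun (P.map X) a * dotCharFun (P'.map Y) a := by
  rw [dotCharFun_map (by fun_prop), dotCharFun_map hX, dotCharFun_map hY, ← integral_prod_mul]
  simp [dotProduct_add, add_mul, Complex.exp_add]

lemma dotCharFun_pi_gaussianReal (v : ℝ≥0) (a : γ → ℝ) :
    dotCharFun (Measure.pi fun _ => gaussianReal 0 v) a
      = Complex.exp (-((v * (a ⬝ᵥ a) / 2 : ℝ) : ℂ)) := by
  rw [dotCharFun_eq_charFun, charFun_pi]
  simp_rw [charFun_gaussianReal, ← Complex.exp_sum]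
  congr 1
  simp only [dotProduct, Complex.ofReal_zero, mul_zero, zero_mul, zero_sub, Finset.sum_neg_distrib]
  push_cast
  rw [Finset.mul_sum, Finset.sum_div]
  simp [pow_two]

variable [DecidableEq γ]

lemma dotCharFun_gaussianVec (μ : γ → ℝ) {S : Matrix γ γ ℝ} (hS : S.PosSemidef) (a : γ → ℝ) :
    dotCharFun (gaussianVec μ S) a
      = Complex.exp (((a ⬝ᵥ μ : ℝ) : ℂ) * Complex.I - ((a ⬝ᵥ S *ᵥ a / 2 : ℝ) : ℂ)) := by
  rw [dotCharFun_eq_charFun, gaussianVec, Measure.map_map (by fun_prop) (by fun_prop)]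
  have : (WithLp.toLp 2 : (γ → ℝ) → EuclideanSpace ℝ γ) ∘ WithLp.ofLp = id := by ext; simp
  rw [this, Measure.map_id, charFun_multivariateGaussian hS]
  simp [PiLp.inner_apply, dotProduct, mul_comm]

lemma eq_gaussianVec_of_dotCharFun {ρ : Measure (γ → ℝ)} [IsFiniteMeasure ρ] {μ : γ → ℝ}
    {S : Matrix γ γ ℝ} (hS : S.PosSemidef)
    (h : ∀ a, dotCharFun ρ a
      = Complex.exp (((a ⬝ᵥ μ : ℝ) : ℂ) * Complex.I - ((a ⬝ᵥ S *ᵥ a / 2 : ℝ) : ℂ))) :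
    ρ = gaussianVec μ S :=
  ext_of_dotCharFun fun a => by rw [h, dotCharFun_gaussianVec μ hS]

lemma pi_gaussianReal_eq_gaussianVec :
    (Measure.pi fun _ : γ => gaussianReal 0 1) = gaussianVec 0 1 := by
  refine eq_gaussianVec_of_dotCharFun Matrix.PosSemidef.one fun a => ?_
  rw [dotCharFun_pi_gaussianReal]
  simp

lemma gaussianVec_map_mulVec {γ' : Type*} [Fintype γ'] [DecidableEq γ'] (μ : γ' → ℝ)
    {S : Matrix γ' γ' ℝ} (hS : S.PosSemidef) (M : Matrix γ γ' ℝ) :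
    (gaussianVec μ S).map (fun z => M *ᵥ z) = gaussianVec (M *ᵥ μ) (M * S * Mᵀ) := by
  have := Measure.isProbabilityMeasure_map (μ := gaussianVec μ S)
    (measurable_mulVec M).aemeasurable
  refine eq_gaussianVec_of_dotCharFun (by simpa using hS.mul_mul_conjTranspose_same M) fun a => ?_
  rw [dotCharFun_map_mulVec, dotCharFun_gaussianVec _ hS]
  congr 3
  · simp [Matrix.mulVec_transpose, Matrix.dotProduct_mulVec]
  · rw [← Matrix.mulVec_mulVec, ← Matrix.mulVec_mulVec, Matrix.dotProduct_mulVec a M,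
      Matrix.mulVec_transpose]

/-- The sum of independent Gaussian vectors. -/
lemma gaussianVec_prod_map_add {μ μ' : γ → ℝ} {S S' : Matrix γ γ ℝ} (hS : S.PosSemidef)
    (hS' : S'.PosSemidef) :
    ((gaussianVec μ S).prod (gaussianVec μ' S')).map (fun p => p.1 + p.2)
      = gaussianVec (μ + μ') (S + S') := by
  have : IsProbabilityMeasure (((gaussianVec μ S).prod (gaussianVec μ' S')).map
    (fun p => p.1 + p.2)) := Measure.isProbabilityMeasure_map (by fun_prop)
  refine eq_gaussianVec_of_dotCharFun (hS.add hS') fun a => ?_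
  have := dotCharFun_map_add (P := gaussianVec μ S) (P' := gaussianVec μ' S') measurable_id
    measurable_id a
  simp only [id_eq, Measure.map_id] at this
  rw [this, dotCharFun_gaussianVec _ hS, dotCharFun_gaussianVec _ hS', ← Complex.exp_add]
  congr 1
  simp [dotProduct_add, Matrix.add_mulVec]
  ring

lemma gaussianReal_map_smul_vec (v : ℝ≥0) (w : γ → ℝ) :
    (gaussianReal 0 v).map (fun t => t • w)
      = gaussianVec 0 ((v : ℝ) • Matrix.vecMulVec w w) := by
  have : IsProbabilityMeasure ((gaussianReal 0 v).map (fun t => t • w)) :=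
    Measure.isProbabilityMeasure_map (by fun_prop)
  refine eq_gaussianVec_of_dotCharFun ?_ fun a => ?_
  · exact (by simpa using Matrix.posSemidef_vecMulVec_self_star w :
      (Matrix.vecMulVec w w).PosSemidef).smul v.2
  · rw [dotCharFun_map (by fun_prop)]
    have h := charFun_gaussianReal (μ := 0) (v := v) (a ⬝ᵥ w)
    rw [charFun_apply_real] at h
    simp only [dotProduct_smul, smul_eq_mul]
    rw [show (fun t : ℝ => Complex.exp (((t * (a ⬝ᵥ w) : ℝ) : ℂ) * Complex.I))
      = fun t : ℝ => Complex.exp ((a ⬝ᵥ w : ℝ) * (t : ℂ) * Complex.I) by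
        ext t; push_cast; ring_nf, h]
    congr 1
    simp only [Complex.ofReal_zero, mul_zero, zero_mul, zero_sub, dotProduct_zero,
      Matrix.smul_mulVec, Matrix.vecMulVec_mulVec, dotProduct_smul]
    simp only [dotProduct_comm w a, smul_eq_mul, MulOpposite.smul_eq_mul_unop, MulOpposite.unop_op]
    push_cast
    ring

end CharFun

/-! ### Bounded densities between Gaussian laws -/

lemma gaussianReal_half_le :
    gaussianReal 0 (1 / 2) ≤ (2 : ℝ≥0) • gaussianReal 0 (3 / 2) := by
  rw [gaussianReal_of_var_ne_zero _ (by norm_num), gaussianReal_of_var_ne_zero _ (by norm_num),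
    show (2 : ℝ≥0) • volume.withDensity (gaussianPDF 0 (3 / 2))
      = (2 : ENNReal) • volume.withDensity (gaussianPDF 0 (3 / 2)) from rfl,
    ← withDensity_smul' _ _ (by simp)]
  refine withDensity_mono (ae_of_all _ fun x => ?_)
  simp only [Pi.smul_apply, smul_eq_mul, gaussianPDF]
  rw [show (2 : ENNReal) = ENNReal.ofReal 2 by simp, ← ENNReal.ofReal_mul (by norm_num)]
  refine ENNReal.ofReal_le_ofReal ?_
  simp only [gaussianPDFReal, sub_zero]
  rw [← mul_assoc]
  refine mul_le_mul ?_ ?_ (Real.exp_pos _).le (by positivity)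
  · have h : √(2 * Real.pi * ((3 / 2 : ℝ≥0) : ℝ)) ≤ 2 * √(2 * Real.pi * ((1 / 2 : ℝ≥0) : ℝ)) := by
      rw [Real.sqrt_le_left (by positivity), mul_pow, Real.sq_sqrt (by positivity)]
      push_cast
      nlinarith [Real.pi_pos]
    rw [← div_eq_mul_inv, inv_eq_one_div, div_le_div_iff₀ (by simp; positivity) (by simp; positivity)]
    linarith
  · refine Real.exp_le_exp.2 ?_
    push_cast
    nlinarith [sq_nonneg x]

section

variable {γ : Type*} [Fintype γ] [DecidableEq γ]

lemma gaussianVec_add_vecMulVec (μ : γ → ℝ) (r : ℝ≥0) {S : Matrix γ γ ℝ} (hS : S.PosSemidef)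
    (w : γ → ℝ) :
    gaussianVec μ (S + (r : ℝ) • Matrix.vecMulVec w w)
      = ((gaussianVec μ S).prod (gaussianReal 0 r)).map (fun p => p.1 + p.2 • w) := by
  have hw : ((r : ℝ) • Matrix.vecMulVec w w).PosSemidef :=
    (by simpa using Matrix.posSemidef_vecMulVec_self_star w :
      (Matrix.vecMulVec w w).PosSemidef).smul r.2
  have h := gaussianVec_prod_map_add (μ := μ) (μ' := 0) hS hw
  rw [add_zero] at h
  have hp : (gaussianVec μ S).prod ((gaussianReal 0 r).map (fun t => t • w))
      = ((gaussianVec μ S).prod (gaussianReal 0 r)).map (Prod.map id fun t => t • w) := by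
    rw [← Measure.map_prod_map _ _ measurable_id (by fun_prop), Measure.map_id]
  rw [← h, ← gaussianReal_map_smul_vec, hp, Measure.map_map (by fun_prop) (by fun_prop)]
  rfl

lemma gaussianVec_add_half_vecMulVec_le {S : Matrix γ γ ℝ} (hS : S.PosSemidef) (w : γ → ℝ) :
    gaussianVec 0 (S + (1 / 2 : ℝ) • Matrix.vecMulVec w w)
      ≤ (2 : ℝ≥0) • gaussianVec 0 (S + (3 / 2 : ℝ) • Matrix.vecMulVec w w) := by
  have h1 := gaussianVec_add_vecMulVec 0 (1 / 2) hS w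
  have h2 := gaussianVec_add_vecMulVec 0 (3 / 2) hS w
  push_cast at h1 h2
  rw [h1, h2]
  refine Measure.le_iff.2 fun s hs => ?_
  have hm : Measurable fun p : (γ → ℝ) × ℝ => p.1 + p.2 • w := by fun_prop
  rw [Measure.smul_apply, Measure.map_apply hm hs, Measure.map_apply hm hs,
    Measure.prod_apply (hm hs), Measure.prod_apply (hm hs), ENNReal.smul_def, smul_eq_mul,
    ← lintegral_const_mul' _ _ (by simp)]
  refine lintegral_mono fun z => ?_
  have := gaussianReal_half_le (Prod.mk z ⁻¹' ((fun p : (γ → ℝ) × ℝ => p.1 + p.2 • w) ⁻¹' s))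
  simpa [ENNReal.smul_def] using this

lemma gaussianVec_add_half_sum_le {S : Matrix γ γ ℝ} (hS : S.PosSemidef) {δ : Type*}
    (w : δ → γ → ℝ) (t : Finset δ) :
    gaussianVec 0 (S + (1 / 2 : ℝ) • ∑ i ∈ t, Matrix.vecMulVec (w i) (w i))
      ≤ (2 ^ t.card : ℝ≥0) •
        gaussianVec 0 (S + (3 / 2 : ℝ) • ∑ i ∈ t, Matrix.vecMulVec (w i) (w i)) := by
  classical
  have hw (i : δ) : (Matrix.vecMulVec (w i) (w i)).PosSemidef := by
    simpa using Matrix.posSemidef_vecMulVec_self_star (w i)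
  induction t using Finset.induction_on generalizing S with
  | empty => simp
  | insert i t hi ih =>
    rw [Finset.sum_insert hi, Finset.card_insert_of_notMem hi, smul_add, smul_add, ← add_assoc]
    refine (ih (hS.add ((hw i).smul (by norm_num)))).trans ?_
    rw [add_right_comm, pow_succ, mul_smul]
    have hT : (S + (3 / 2 : ℝ) • ∑ i ∈ t, Matrix.vecMulVec (w i) (w i)).PosSemidef :=
      hS.add ((Matrix.posSemidef_sum t fun i _ => hw i).smul (by norm_num))
    have h := gaussianVec_add_half_vecMulVec_le hT (w i)
    rw [← add_assoc, add_right_comm S ((3 / 2 : ℝ) • Matrix.vecMulVec (w i) (w i))]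
    refine Measure.le_iff.2 fun s _ => ?_
    have := h s
    simp only [Measure.smul_apply, ENNReal.smul_def, smul_eq_mul] at this ⊢
    gcongr

/-- The law of the projection of a standard Gaussian vector along a subspace has a bounded density,
on a set `I` of coordinates, with respect to the standard Gaussian law, if the vectors in this
subspace are not concentrated on `I`. -/
lemma pi_gaussianReal_preimage_projection_le (I : γ → Prop) [DecidablePred I] {r : ℕ}
    (e : Fin r → γ → ℝ) {L : Matrix γ γ ℝ}
    (hL : 1 - L = ∑ i, Matrix.vecMulVec (e i) (e i)) (hL2 : L * L = L)
    (hI : ∀ x, (∑ α with I α, ((1 - L) *ᵥ x) α ^ 2)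
      ≤ 2 / 3 * ((1 - L) *ᵥ x ⬝ᵥ (1 - L) *ᵥ x))
    {B : Set (γ → ℝ)} (hB : MeasurableSet B)
    (hBI : ∀ x y : γ → ℝ, (∀ α, I α → x α = y α) → x ∈ B → y ∈ B) :
    (Measure.pi fun _ : γ => gaussianReal 0 1) {ζ | L *ᵥ ζ ∈ B}
      ≤ 2 ^ r * (Measure.pi fun _ : γ => gaussianReal 0 1) B := by
  set D : Matrix γ γ ℝ := Matrix.diagonal fun α => if I α then 1 else 0 with hD
  have hDT : Dᵀ = D := by simp [hD]
  have hDD : D * D = D := by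
    rw [hD, Matrix.diagonal_mul_diagonal]; congr 1; ext; simp
  have hLT : Lᵀ = L := by
    have : L = 1 - ∑ i, Matrix.vecMulVec (e i) (e i) := by rw [← hL]; abel
    rw [this, Matrix.transpose_sub, Matrix.transpose_sum]
    simp [Matrix.transpose_vecMulVec]
  have hDx (x : γ → ℝ) (α : γ) : (D *ᵥ x) α = if I α then x α else 0 := by
    simp [hD, Matrix.mulVec_diagonal]
  have hBD (x : γ → ℝ) : D *ᵥ x ∈ B ↔ x ∈ B :=
    ⟨fun h => hBI _ _ (fun α hα => by simp [hDx, hα]) h,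
      fun h => hBI _ _ (fun α hα => by simp [hDx, hα]) h⟩
  have e1 : (Measure.pi fun _ : γ => gaussianReal 0 1) {ζ | L *ᵥ ζ ∈ B}
      = gaussianVec 0 (D * L * D) B := by
    have h := gaussianVec_map_mulVec (0 : γ → ℝ) (Matrix.PosSemidef.one (R := ℝ)) (D * L)
    rw [Matrix.mulVec_zero, Matrix.mul_one, Matrix.transpose_mul, hDT, hLT,
      Matrix.mul_assoc D L, ← Matrix.mul_assoc L L D, hL2, ← Matrix.mul_assoc] at h
    rw [← h, Measure.map_apply (measurable_mulVec _) hB, pi_gaussianReal_eq_gaussianVec]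
    congr 1
    ext ζ
    simp [← Matrix.mulVec_mulVec, hBD]
  have e2 : (Measure.pi fun _ : γ => gaussianReal 0 1) B = gaussianVec 0 D B := by
    have h := gaussianVec_map_mulVec (0 : γ → ℝ) (Matrix.PosSemidef.one (R := ℝ)) D
    rw [Matrix.mulVec_zero, Matrix.mul_one, hDT, hDD] at h
    rw [← h, Measure.map_apply (measurable_mulVec _) hB, pi_gaussianReal_eq_gaussianVec]
    congr 1
    ext ζ
    simp [hBD]
  set Q := ∑ i, Matrix.vecMulVec (D *ᵥ e i) (D *ᵥ e i) with hQ
  have hQ' : Q = D * (1 - L) * D := by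
    rw [hL, hQ, Matrix.mul_sum, Matrix.sum_mul]
    refine Finset.sum_congr rfl fun i _ => ?_
    rw [Matrix.mul_vecMulVec, Matrix.vecMulVec_mul, ← Matrix.mulVec_transpose, hDT]
  have hT : (D - (3 / 2 : ℝ) • Q).PosSemidef := by
    have hQT : Qᵀ = Q := by
      rw [hQ', Matrix.transpose_mul, Matrix.transpose_mul, hDT, Matrix.transpose_sub, hLT,
        Matrix.transpose_one, Matrix.mul_assoc]
    refine Matrix.PosSemidef.of_dotProduct_mulVec_nonneg ?_ fun x => ?_
    · rw [Matrix.IsHermitian, Matrix.conjTranspose_eq_transpose_of_trivial, Matrix.transpose_sub,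
        Matrix.transpose_smul, hQT, hDT]
    simp only [star_trivial]
    set y := D *ᵥ x with hy
    set v := (1 - L) *ᵥ y with hv
    have h1 : x ⬝ᵥ D *ᵥ x = y ⬝ᵥ y := by
      rw [hy, Matrix.dotProduct_mulVec (D *ᵥ x), ← Matrix.mulVec_transpose, hDT,
        Matrix.mulVec_mulVec, hDD, dotProduct_comm]
    have hPP : (1 - L) * (1 - L) = 1 - L := by
      simp [Matrix.mul_sub, Matrix.sub_mul, hL2]
    have hvy : v ⬝ᵥ v = v ⬝ᵥ y := by
      rw [hv, Matrix.dotProduct_mulVec, ← Matrix.mulVec_transpose, Matrix.transpose_sub, hLT,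
        Matrix.transpose_one, Matrix.mulVec_mulVec, hPP]
    have h2 : x ⬝ᵥ Q *ᵥ x = v ⬝ᵥ v := by
      rw [hQ', ← Matrix.mulVec_mulVec, ← Matrix.mulVec_mulVec, Matrix.dotProduct_mulVec,
        ← Matrix.mulVec_transpose, hDT, ← hy, ← hv, dotProduct_comm, hvy]
    rw [Matrix.sub_mulVec, Matrix.smul_mulVec, dotProduct_sub, dotProduct_smul, h1, h2, smul_eq_mul]
    have h3 := hI y
    rw [← hv] at h3
    have h4 : (v ⬝ᵥ y) ^ 2 ≤ (∑ α with I α, v α ^ 2) * (y ⬝ᵥ y) := by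
      have hvy' : v ⬝ᵥ y = ∑ α with I α, v α * y α := by
        rw [Finset.sum_filter]
        refine Finset.sum_congr rfl fun α _ => ?_
        by_cases h : I α <;> simp [hy, hDx, h]
      rw [hvy']
      refine (Finset.sum_mul_sq_le_sq_mul_sq _ _ _).trans ?_
      refine mul_le_mul_of_nonneg_left ?_ (Finset.sum_nonneg fun _ _ => sq_nonneg _)
      simp only [dotProduct, ← pow_two]
      exact Finset.sum_le_sum_of_subset_of_nonneg (Finset.subset_univ _) fun _ _ _ => sq_nonneg _
    rw [← hvy] at h4
    have hv0 : 0 ≤ v ⬝ᵥ v := by simpa using dotProduct_star_self_nonneg v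
    have hy0 : 0 ≤ y ⬝ᵥ y := by simpa using dotProduct_star_self_nonneg y
    have h5 : (v ⬝ᵥ v) ^ 2 ≤ 2 / 3 * (v ⬝ᵥ v) * (y ⬝ᵥ y) :=
      h4.trans (mul_le_mul_of_nonneg_right h3 hy0)
    rcases hv0.eq_or_lt with h | h
    · rw [← h]; linarith
    · nlinarith
  have key := gaussianVec_add_half_sum_le hT (fun i => D *ᵥ e i) Finset.univ B
  rw [← hQ] at key
  have e3 : D - (3 / 2 : ℝ) • Q + (1 / 2 : ℝ) • Q = D * L * D := by
    have h : D - Q = D * L * D := by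
      rw [hQ', Matrix.mul_sub, Matrix.sub_mul, Matrix.mul_one, hDD]; abel
    rw [← h, sub_add, ← sub_smul]; norm_num
  rw [e3, sub_add_cancel] at key
  rw [e1, e2]
  simpa [ENNReal.smul_def] using key

end

/-! ### Gaussian matrices -/

/-- The law of an `n × n` matrix with independent `N(0, v)` entries. -/
def gaussianMatrix (n : ℕ) (v : ℝ≥0) : Measure (Fin n → Fin n → ℝ) :=
  Measure.pi fun _ => Measure.pi fun _ => gaussianReal 0 v

instance (n : ℕ) (v : ℝ≥0) : IsProbabilityMeasure (gaussianMatrix n v) := by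
  unfold gaussianMatrix; infer_instance

/-- The matrix `V e eᵀ + V' (1 - e eᵀ)`. -/
def mixRows {n : ℕ} (e : Fin n → ℝ) (V V' : Fin n → Fin n → ℝ) : Fin n → Fin n → ℝ :=
  fun i => Matrix.vecMulVec e e *ᵥ V i + (1 - Matrix.vecMulVec e e) *ᵥ V' i

/-- The matrix `e eᵀ V + (1 - e eᵀ) V'`. -/
def mixCols {n : ℕ} (e : Fin n → ℝ) (V V' : Fin n → Fin n → ℝ) : Fin n → Fin n → ℝ :=
  fun i j => mixRows e (fun i j => V j i) (fun i j => V' j i) j i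

lemma map_mix_pi_gaussianReal {n : ℕ} (v : ℝ≥0) {e : Fin n → ℝ} (he : e ⬝ᵥ e = 1 ∨ e = 0) :
    MeasurePreserving (fun p : (Fin n → ℝ) × (Fin n → ℝ) =>
      Matrix.vecMulVec e e *ᵥ p.1 + (1 - Matrix.vecMulVec e e) *ᵥ p.2)
      ((Measure.pi fun _ => gaussianReal 0 v).prod (Measure.pi fun _ => gaussianReal 0 v))
      (Measure.pi fun _ => gaussianReal 0 v) := by
  have hm : Measurable (fun p : (Fin n → ℝ) × (Fin n → ℝ) =>
      Matrix.vecMulVec e e *ᵥ p.1 + (1 - Matrix.vecMulVec e e) *ᵥ p.2) :=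
    ((measurable_mulVec _).comp measurable_fst).add ((measurable_mulVec _).comp measurable_snd)
  refine ⟨hm, ?_⟩
  have := Measure.isProbabilityMeasure_map (μ := (Measure.pi fun _ : Fin n => gaussianReal 0 v).prod
    (Measure.pi fun _ : Fin n => gaussianReal 0 v)) hm.aemeasurable
  refine ext_of_dotCharFun fun a => ?_
  rw [dotCharFun_map_add (measurable_mulVec _) (measurable_mulVec _), dotCharFun_map_mulVec,
    dotCharFun_map_mulVec, dotCharFun_pi_gaussianReal, dotCharFun_pi_gaussianReal,
    dotCharFun_pi_gaussianReal, ← Complex.exp_add]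
  congr 1
  norm_cast
  rw [← neg_add, ← add_div, ← mul_add]
  congr 4
  simp only [Matrix.transpose_sub, Matrix.transpose_one, Matrix.transpose_vecMulVec,
    Matrix.sub_mulVec, Matrix.one_mulVec, Matrix.vecMulVec_mulVec, dotProduct_sub, sub_dotProduct]
  rcases he with he | he
  · simp [he]
    simp [dotProduct_comm a e]
  · simp [he]

lemma measurePreserving_mixRows {n : ℕ} (v : ℝ≥0) {e : Fin n → ℝ} (he : e ⬝ᵥ e = 1 ∨ e = 0) :
    MeasurePreserving (fun p : (Fin n → Fin n → ℝ) × (Fin n → Fin n → ℝ) => mixRows e p.1 p.2)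
      ((gaussianMatrix n v).prod (gaussianMatrix n v)) (gaussianMatrix n v) := by
  have h1 := measurePreserving_pi (fun _ : Fin n => (Measure.pi fun _ : Fin n =>
    gaussianReal 0 v).prod (Measure.pi fun _ : Fin n => gaussianReal 0 v))
    (fun _ : Fin n => Measure.pi fun _ : Fin n => gaussianReal 0 v)
    (fun _ => map_mix_pi_gaussianReal v he)
  have h2 := (measurePreserving_arrowProdEquivProdArrow (Fin n → ℝ) (Fin n → ℝ) (Fin n)
    (fun _ => Measure.pi fun _ : Fin n => gaussianReal 0 v)
    (fun _ => Measure.pi fun _ : Fin n => gaussianReal 0 v)).symm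
  exact h1.comp h2

lemma measurePreserving_swap_gaussianMatrix (n : ℕ) (v : ℝ≥0) :
    MeasurePreserving (fun (V : Fin n → Fin n → ℝ) i j => V j i)
      (gaussianMatrix n v) (gaussianMatrix n v) := by
  have hc : MeasurePreserving (MeasurableEquiv.curry (Fin n) (Fin n) ℝ)
      (Measure.pi fun _ => gaussianReal 0 v) (gaussianMatrix n v) := by
    refine ⟨by fun_prop, ?_⟩
    have := Measure.infinitePi_map_curry (fun _ _ : Fin n => gaussianReal 0 v)
    simp only [Measure.infinitePi_eq_pi] at this
    exact this
  have hs := measurePreserving_piCongrLeft (fun _ : Fin n × Fin n => gaussianReal 0 v)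
    (Equiv.prodComm (Fin n) (Fin n))
  have := hc.comp (hs.comp hc.symm)
  convert this using 1
  ext V i j
  simp [MeasurableEquiv.piCongrLeft, Equiv.piCongrLeft, MeasurableEquiv.curry, Function.curry,
    Function.uncurry]

lemma measurePreserving_mixCols {n : ℕ} (v : ℝ≥0) {e : Fin n → ℝ} (he : e ⬝ᵥ e = 1 ∨ e = 0) :
    MeasurePreserving (fun p : (Fin n → Fin n → ℝ) × (Fin n → Fin n → ℝ) => mixCols e p.1 p.2)
      ((gaussianMatrix n v).prod (gaussianMatrix n v)) (gaussianMatrix n v) :=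
  (measurePreserving_swap_gaussianMatrix n v).comp ((measurePreserving_mixRows v he).comp
    ((measurePreserving_swap_gaussianMatrix n v).prod (measurePreserving_swap_gaussianMatrix n v)))

lemma pi_gaussianReal_map_dotProduct {n : ℕ} (v : ℝ≥0) (a : Fin n → ℝ) :
    (Measure.pi fun _ : Fin n => gaussianReal 0 v).map (fun r => r ⬝ᵥ a)
      = gaussianReal 0 (v * (a ⬝ᵥ a).toNNReal) := by
  have hm : Measurable fun r : Fin n → ℝ => r ⬝ᵥ a := by unfold dotProduct; fun_prop
  have := Measure.isProbabilityMeasure_map (μ := Measure.pi fun _ : Fin n => gaussianReal 0 v)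
    hm.aemeasurable
  refine Measure.ext_of_charFun (funext fun t => ?_)
  rw [charFun_apply_real, integral_map hm.aemeasurable (by fun_prop), charFun_gaussianReal]
  have h := dotCharFun_pi_gaussianReal v (t • a)
  rw [dotCharFun] at h
  have ha : 0 ≤ a ⬝ᵥ a := by simpa using dotProduct_star_self_nonneg a
  convert h using 2
  · ext r; simp [dotProduct_comm a]
  · simp [Real.coe_toNNReal _ ha]; ring

/-- The image of a fixed vector under a Gaussian matrix. -/
lemma gaussianMatrix_map_mulVec {n : ℕ} (v : ℝ≥0) (a : Fin n → ℝ) :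
    (gaussianMatrix n v).map (fun V => Matrix.of V *ᵥ a)
      = (Measure.pi fun _ : Fin n => gaussianReal 0 1).map
          fun ζ => √(v * (a ⬝ᵥ a)) • ζ := by
  have hm : Measurable fun r : Fin n → ℝ => r ⬝ᵥ a := by unfold dotProduct; fun_prop
  have h1 := Measure.pi_map_pi (μ := fun _ : Fin n => Measure.pi fun _ : Fin n => gaussianReal 0 v)
    (f := fun _ r => r ⬝ᵥ a) (fun _ => hm.aemeasurable)
  have h2 := Measure.pi_map_pi (μ := fun _ : Fin n => gaussianReal 0 1)
    (f := fun _ t => √(v * (a ⬝ᵥ a)) * t) (fun _ => by fun_prop)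
  have ha : 0 ≤ a ⬝ᵥ a := by simpa using dotProduct_star_self_nonneg a
  refine h1.trans (Eq.trans ?_ h2.symm)
  simp_rw [pi_gaussianReal_map_dotProduct, gaussianReal_map_const_mul]
  congr 1
  ext i : 1
  congr 1
  · simp
  · ext
    simp only [NNReal.coe_mul, Real.coe_toNNReal _ ha, NNReal.coe_mk, mul_one]
    exact (Real.sq_sqrt (mul_nonneg v.2 ha)).symm

lemma gaussianMatrix_map_transpose_mulVec {n : ℕ} (v : ℝ≥0) (a : Fin n → ℝ) :
    (gaussianMatrix n v).map (fun V => (Matrix.of V)ᵀ *ᵥ a)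
      = (Measure.pi fun _ : Fin n => gaussianReal 0 1).map
          fun ζ => √(v * (a ⬝ᵥ a)) • ζ := by
  have h := measurePreserving_swap_gaussianMatrix n v
  have hm : Measurable fun V : Fin n → Fin n → ℝ => Matrix.of V *ᵥ a := by
    unfold Matrix.mulVec dotProduct; fun_prop
  rw [← gaussianMatrix_map_mulVec]
  conv_rhs => rw [← h.map_eq, Measure.map_map hm h.measurable]
  rfl

/-! ### Polynomially bounded functions -/

/-- A version of `PolyBounded` with a natural exponent. -/
def PolyBd {E : Type*} [Norm E] (f : E → ℝ) : Prop :=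
  ∃ C : ℝ, ∃ q : ℕ, 0 ≤ C ∧ ∀ x, |f x| ≤ C * (1 + ‖x‖) ^ q

section PolyBd

variable {E F : Type*} [SeminormedAddCommGroup E] [SeminormedAddCommGroup F]

lemma PolyBounded.polyBd {f : E → ℝ} (h : PolyBounded f) : PolyBd f := by
  obtain ⟨C, p, c, hC, hp, hc, h⟩ := h
  refine ⟨C + c, ⌈p⌉₊, by positivity, fun x => (h x).trans ?_⟩
  have h1 : (1 : ℝ) ≤ 1 + ‖x‖ := by simp
  have h2 : ‖x‖ ^ p ≤ (1 + ‖x‖) ^ ⌈p⌉₊ := by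
    rw [← Real.rpow_natCast]
    exact (Real.rpow_le_rpow (norm_nonneg _) (by linarith) hp.le).trans
      (Real.rpow_le_rpow_of_exponent_le h1 (Nat.le_ceil p))
  have h3 : 1 ≤ (1 + ‖x‖) ^ ⌈p⌉₊ := one_le_pow₀ h1
  nlinarith

lemma PolyBd.const (c : ℝ) : PolyBd fun _ : E => c :=
  ⟨|c|, 0, abs_nonneg _, by simp⟩

lemma PolyBd.mono {f : E → ℝ} {g : E → ℝ} (hg : PolyBd g) (h : ∀ x, |f x| ≤ |g x|) : PolyBd f := by
  obtain ⟨C, q, hC, hg⟩ := hg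
  exact ⟨C, q, hC, fun x => (h x).trans (hg x)⟩

lemma PolyBd.mul {f g : E → ℝ} (hf : PolyBd f) (hg : PolyBd g) : PolyBd fun x => f x * g x := by
  obtain ⟨C, q, hC, hf⟩ := hf
  obtain ⟨C', q', hC', hg⟩ := hg
  refine ⟨C * C', q + q', by positivity, fun x => ?_⟩
  rw [abs_mul, pow_add, mul_mul_mul_comm]
  exact mul_le_mul (hf x) (hg x) (abs_nonneg _) (by positivity)

lemma PolyBd.add {f g : E → ℝ} (hf : PolyBd f) (hg : PolyBd g) : PolyBd fun x => f x + g x := by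
  obtain ⟨C, q, hC, hf⟩ := hf
  obtain ⟨C', q', hC', hg⟩ := hg
  refine ⟨C + C', max q q', by positivity, fun x => ?_⟩
  have h1 : (1 : ℝ) ≤ 1 + ‖x‖ := by simp
  have h2 := pow_le_pow_right₀ h1 (le_max_left q q')
  have h3 := pow_le_pow_right₀ h1 (le_max_right q q')
  calc |f x + g x| ≤ |f x| + |g x| := abs_add_le _ _
    _ ≤ C * (1 + ‖x‖) ^ q + C' * (1 + ‖x‖) ^ q' := add_le_add (hf x) (hg x)
    _ ≤ C * (1 + ‖x‖) ^ max q q' + C' * (1 + ‖x‖) ^ max q q' := by gcongr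
    _ = _ := by ring

lemma PolyBd.const_mul {f : E → ℝ} (hf : PolyBd f) (c : ℝ) : PolyBd fun x => c * f x :=
  (PolyBd.const c).mul hf

lemma PolyBd.sub {f g : E → ℝ} (hf : PolyBd f) (hg : PolyBd g) : PolyBd fun x => f x - g x := by
  simpa [sub_eq_add_neg] using hf.add (hg.const_mul (-1))

lemma PolyBd.sum {δ : Type*} {f : δ → E → ℝ} (s : Finset δ) (hf : ∀ i ∈ s, PolyBd (f i)) :
    PolyBd fun x => ∑ i ∈ s, f i x := by
  classical
  induction s using Finset.induction_on with
  | empty => simpa using PolyBd.const 0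
  | insert i s hi ih =>
    simp only [Finset.sum_insert hi]
    exact (hf i (by simp)).add (ih fun j hj => hf j (by simp [hj]))

lemma PolyBd.pow {f : E → ℝ} (hf : PolyBd f) (k : ℕ) : PolyBd fun x => f x ^ k := by
  induction k with
  | zero => simpa using PolyBd.const 1
  | succ k ih => simpa [pow_succ] using ih.mul hf

lemma PolyBd.abs {f : E → ℝ} (hf : PolyBd f) : PolyBd fun x => |f x| :=
  hf.mono fun x => by simp

lemma PolyBd.norm : PolyBd fun x : E => ‖x‖ :=
  ⟨1, 1, zero_le_one, fun x => by simp⟩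

lemma PolyBd.comp {f : F → ℝ} (hf : PolyBd f) {g : E → F} (hg : PolyBd fun x => ‖g x‖) :
    PolyBd fun x => f (g x) := by
  obtain ⟨C, q, hC, hf⟩ := hf
  refine ((((PolyBd.const 1).add hg).pow q).const_mul C).mono fun x => (hf (g x)).trans ?_
  exact le_abs_self _

variable {γ : Type*} [Fintype γ]

lemma PolyBd.eval (g : γ) : PolyBd fun z : γ → ℝ => z g :=
  PolyBd.norm.mono fun z => by simpa using norm_le_pi_norm z g

lemma PolyBd.norm_pi {g : E → γ → ℝ} (hg : ∀ i, PolyBd fun x => g x i) :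
    PolyBd fun x => ‖g x‖ := by
  refine (PolyBd.sum Finset.univ fun i _ => (hg i).abs).mono fun x => ?_
  rw [abs_norm, abs_of_nonneg (Finset.sum_nonneg fun _ _ => abs_nonneg _)]
  refine (pi_norm_le_iff_of_nonneg (Finset.sum_nonneg fun _ _ => abs_nonneg _)).2 fun i => ?_
  exact Finset.single_le_sum (f := fun i => |g x i|) (fun _ _ => abs_nonneg _) (Finset.mem_univ i)

end PolyBd

section Integrable

variable {E : Type*} [NormedAddCommGroup E] [NormedSpace ℝ E] [CompleteSpace E]
  [SecondCountableTopology E] [MeasurableSpace E] [BorelSpace E]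

lemma integrable_one_add_norm_pow (ν : Measure E) [IsGaussian ν] (q : ℕ) :
    Integrable (fun x => (1 + ‖x‖) ^ q) ν := by
  have h0 : MemLp (fun x : E => ‖x‖) (q : ENNReal) ν :=
    (IsGaussian.memLp_id ν (q : ENNReal) (ENNReal.natCast_ne_top q)).norm
  have h1 : MemLp (fun x : E => 1 + ‖x‖) (q : ENNReal) ν :=
    MemLp.add (memLp_const (1 : ℝ)) h0
  have h2 := h1.integrable_norm_pow'
  refine h2.congr (ae_of_all _ fun x => ?_)
  simp only [Real.norm_eq_abs]
  rw [abs_of_nonneg (by positivity)]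

lemma PolyBd.integrable {f : E → ℝ} (hf : PolyBd f) (hm : Measurable f) (ν : Measure E)
    [IsGaussian ν] : Integrable f ν := by
  obtain ⟨C, q, hC, hf⟩ := hf
  exact ((integrable_one_add_norm_pow ν q).const_mul C).mono' hm.aestronglyMeasurable
    (ae_of_all _ hf)

end Integrable

instance {γ : Type*} [Fintype γ] [DecidableEq γ] (μ : γ → ℝ) (S : Matrix γ γ ℝ) :
    IsGaussian (gaussianVec μ S) := by
  unfold gaussianVec
  exact isGaussian_map (EuclideanSpace.equiv γ ℝ).toContinuousLinearMap

/-! ### A fourth moment bound -/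

section FourthMoment

variable {Ω : Type*} [MeasurableSpace Ω] {P : Measure Ω} [IsProbabilityMeasure P]

lemma MemLp.integrable_pow_of_four {X : Ω → ℝ} (hX : MemLp X 4 P) {k : ℕ} (hk : k ≤ 4) :
    Integrable (fun ω => X ω ^ k) P := by
  have h : MemLp X k P := hX.mono_exponent (by exact_mod_cast hk)
  have := h.integrable_norm_pow'
  refine this.mono' (hX.1.pow k) (ae_of_all _ fun ω => ?_)
  simp

lemma integral_add_pow_two_of_indepFun {X Y : Ω → ℝ} (hX : MemLp X 4 P) (hY : MemLp Y 4 P)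
    (h : IndepFun X Y P) (hY0 : ∫ ω, Y ω ∂P = 0) :
    ∫ ω, (X ω + Y ω) ^ 2 ∂P = ∫ ω, X ω ^ 2 ∂P + ∫ ω, Y ω ^ 2 ∂P := by
  have iX := fun k (hk : k ≤ 4) => MemLp.integrable_pow_of_four hX hk
  have iY := fun k (hk : k ≤ 4) => MemLp.integrable_pow_of_four hY hk
  have i11 : Integrable (fun ω => X ω * Y ω) P :=
    h.integrable_mul (by simpa using iX 1 (by norm_num)) (by simpa using iY 1 (by norm_num))
  have e11 : ∫ ω, X ω * Y ω ∂P = 0 := by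
    have := h.integral_mul_eq_mul_integral hX.1 hY.1
    simp only [Pi.mul_apply] at this
    rw [this, hY0, mul_zero]
  have : ∀ ω, (X ω + Y ω) ^ 2 = X ω ^ 2 + Y ω ^ 2 + 2 * (X ω * Y ω) := fun ω => by ring
  simp_rw [this]
  have j : Integrable (fun ω => X ω ^ 2 + Y ω ^ 2) P := (iX 2 (by norm_num)).add (iY 2 (by norm_num))
  rw [integral_add j (i11.const_mul 2),
    integral_add (iX 2 (by norm_num)) (iY 2 (by norm_num)), integral_const_mul, e11]
  ring

lemma integral_add_pow_four_of_indepFun {X Y : Ω → ℝ} (hX : MemLp X 4 P) (hY : MemLp Y 4 P)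
    (h : IndepFun X Y P) (hX0 : ∫ ω, X ω ∂P = 0) (hY0 : ∫ ω, Y ω ∂P = 0) :
    ∫ ω, (X ω + Y ω) ^ 4 ∂P = ∫ ω, X ω ^ 4 ∂P
      + 6 * ((∫ ω, X ω ^ 2 ∂P) * ∫ ω, Y ω ^ 2 ∂P) + ∫ ω, Y ω ^ 4 ∂P := by
  have iX := fun k (hk : k ≤ 4) => MemLp.integrable_pow_of_four hX hk
  have iY := fun k (hk : k ≤ 4) => MemLp.integrable_pow_of_four hY hk
  have hind (j k : ℕ) : IndepFun (fun ω => X ω ^ j) (fun ω => Y ω ^ k) P :=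
    h.comp (φ := fun x => x ^ j) (ψ := fun x => x ^ k) (by fun_prop) (by fun_prop)
  have i (j k : ℕ) (hj : j ≤ 4) (hk : k ≤ 4) : Integrable (fun ω => X ω ^ j * Y ω ^ k) P :=
    (hind j k).integrable_mul (iX j hj) (iY k hk)
  have e (j k : ℕ) : ∫ ω, X ω ^ j * Y ω ^ k ∂P = (∫ ω, X ω ^ j ∂P) * ∫ ω, Y ω ^ k ∂P := by
    simpa using (hind j k).integral_mul_eq_mul_integral (hX.1.pow j) (hY.1.pow k)
  have : ∀ ω, (X ω + Y ω) ^ 4 = X ω ^ 4 + 4 * (X ω ^ 3 * Y ω ^ 1) + 6 * (X ω ^ 2 * Y ω ^ 2)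
      + 4 * (X ω ^ 1 * Y ω ^ 3) + Y ω ^ 4 := fun ω => by ring
  simp_rw [this]
  have j1 := iX 4 le_rfl
  have j2 : Integrable (fun ω => X ω ^ 4 + 4 * (X ω ^ 3 * Y ω ^ 1)) P :=
    j1.add ((i 3 1 (by norm_num) (by norm_num)).const_mul 4)
  have j3 : Integrable (fun ω => X ω ^ 4 + 4 * (X ω ^ 3 * Y ω ^ 1)
      + 6 * (X ω ^ 2 * Y ω ^ 2)) P :=
    j2.add ((i 2 2 (by norm_num) (by norm_num)).const_mul 6)
  have j4 : Integrable (fun ω => X ω ^ 4 + 4 * (X ω ^ 3 * Y ω ^ 1) + 6 * (X ω ^ 2 * Y ω ^ 2)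
      + 4 * (X ω ^ 1 * Y ω ^ 3)) P :=
    j3.add ((i 1 3 (by norm_num) (by norm_num)).const_mul 4)
  rw [integral_add j4 (iY 4 le_rfl),
    integral_add j3 ((i 1 3 (by norm_num) (by norm_num)).const_mul 4),
    integral_add j2 ((i 2 2 (by norm_num) (by norm_num)).const_mul 6),
    integral_add j1 ((i 3 1 (by norm_num) (by norm_num)).const_mul 4)]
  simp_rw [integral_const_mul, e]
  simp [hX0, hY0]

lemma integral_sum_pow_four_le {δ : Type*} {X : δ → Ω → ℝ} (hX : ∀ i, MemLp (X i) 4 P)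
    (hXm : ∀ i, Measurable (X i))
    (hind : iIndepFun X P) (h0 : ∀ i, ∫ ω, X i ω ∂P = 0) (s : Finset δ) :
    ∫ ω, (∑ i ∈ s, X i ω) ^ 4 ∂P ≤ 4 * s.card * ∑ i ∈ s, ∫ ω, X i ω ^ 4 ∂P := by
  classical
  have key : ∫ ω, (∑ i ∈ s, X i ω) ^ 2 ∂P = ∑ i ∈ s, ∫ ω, X i ω ^ 2 ∂P ∧
      ∫ ω, (∑ i ∈ s, X i ω) ^ 4 ∂P
        ≤ 3 * (∑ i ∈ s, ∫ ω, X i ω ^ 2 ∂P) ^ 2 + ∑ i ∈ s, ∫ ω, X i ω ^ 4 ∂P := by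
    induction s using Finset.induction_on with
    | empty => simp
    | insert i s hi ih =>
      have hS : MemLp (fun ω => ∑ j ∈ s, X j ω) 4 P := memLp_finsetSum s fun j _ => hX j
      have hSi : IndepFun (fun ω => ∑ j ∈ s, X j ω) (X i) P := by
        have := hind.indepFun_finsetSum_of_notMem hXm hi
        convert this using 1
        ext ω; simp
      have hS0 : ∫ ω, ∑ j ∈ s, X j ω ∂P = 0 := by
        rw [integral_finsetSum _ fun j _ => (hX j).integrable (by norm_num)]
        simp [h0]
      have e2 := integral_add_pow_two_of_indepFun hS (hX i) hSi (h0 i)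
      have e4 := integral_add_pow_four_of_indepFun hS (hX i) hSi hS0 (h0 i)
      simp_rw [Finset.sum_insert hi, add_comm (X i _)]
      rw [e2, e4, ih.1]
      refine ⟨add_comm _ _, ?_⟩
      nlinarith [ih.2, sq_nonneg (∫ ω, X i ω ^ 2 ∂P)]
  have h1 (i : δ) : (∫ ω, X i ω ^ 2 ∂P) ^ 2 ≤ ∫ ω, X i ω ^ 4 ∂P := by
    have h := variance_nonneg (fun ω => X i ω ^ 2) P
    have hm : MemLp (fun ω => X i ω ^ 2) 2 P := by
      refine (memLp_two_iff_integrable_sq ((hX i).1.pow 2)).2 ?_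
      simp_rw [Pi.pow_apply, ← pow_mul]
      exact MemLp.integrable_pow_of_four (hX i) le_rfl
    rw [variance_eq_sub hm] at h
    simp only [Pi.pow_apply, ← pow_mul] at h
    norm_num at h
    linarith
  have h2 : (∑ i ∈ s, ∫ ω, X i ω ^ 2 ∂P) ^ 2 ≤ s.card * ∑ i ∈ s, ∫ ω, X i ω ^ 4 ∂P :=
    sq_sum_le_card_mul_sum_sq.trans
      (mul_le_mul_of_nonneg_left (Finset.sum_le_sum fun i _ => h1 i) (by positivity))
  rcases s.eq_empty_or_nonempty with rfl | hs
  · simp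
  · have hc : (1 : ℝ) ≤ s.card := by exact_mod_cast hs.card_pos
    have h3 : 0 ≤ ∑ i ∈ s, ∫ ω, X i ω ^ 4 ∂P :=
      Finset.sum_nonneg fun i _ => integral_nonneg fun ω => by positivity
    nlinarith [key.2]

lemma integral_sub_integral_pow_four_le {X : Ω → ℝ} (hX : MemLp X 4 P) :
    ∫ ω, (X ω - ∫ ω', X ω' ∂P) ^ 4 ∂P ≤ 16 * ∫ ω, X ω ^ 4 ∂P := by
  set c := ∫ ω', X ω' ∂P
  have h1 : c ^ 2 ≤ ∫ ω, X ω ^ 2 ∂P := by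
    have h := variance_nonneg X P
    rw [variance_eq_sub (hX.mono_exponent (by norm_num))] at h
    simp only [Pi.pow_apply] at h
    linarith
  have h2 : (∫ ω, X ω ^ 2 ∂P) ^ 2 ≤ ∫ ω, X ω ^ 4 ∂P := by
    have h := variance_nonneg (fun ω => X ω ^ 2) P
    have hm : MemLp (fun ω => X ω ^ 2) 2 P := by
      refine (memLp_two_iff_integrable_sq (hX.1.pow 2)).2 ?_
      simp_rw [Pi.pow_apply, ← pow_mul]
      exact MemLp.integrable_pow_of_four hX le_rfl
    rw [variance_eq_sub hm] at h
    simp only [Pi.pow_apply, ← pow_mul] at h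
    norm_num at h
    linarith
  have h3 : c ^ 4 ≤ ∫ ω, X ω ^ 4 ∂P := by
    refine le_trans ?_ h2
    rw [show c ^ 4 = (c ^ 2) ^ 2 by ring]
    exact pow_le_pow_left₀ (sq_nonneg c) h1 2
  have h4 (ω : Ω) : (X ω - c) ^ 4 ≤ 8 * X ω ^ 4 + 8 * c ^ 4 := by
    nlinarith [sq_nonneg (X ω + c), sq_nonneg (X ω - c), sq_nonneg (X ω ^ 2 - c ^ 2),
      sq_nonneg ((X ω + c) ^ 2 - (X ω - c) ^ 2), sq_nonneg ((X ω + c) ^ 2)]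
  have i4 := MemLp.integrable_pow_of_four hX le_rfl
  have h5 : Integrable (fun ω => (X ω - c) ^ 4) P :=
    MemLp.integrable_pow_of_four (X := fun ω => X ω - c) (hX.sub (memLp_const c)) le_rfl
  calc _ ≤ ∫ ω, (8 * X ω ^ 4 + 8 * c ^ 4) ∂P :=
        integral_mono h5 ((i4.const_mul 8).add (integrable_const _)) h4
    _ = 8 * ∫ ω, X ω ^ 4 ∂P + 8 * c ^ 4 := by
        rw [integral_add (i4.const_mul 8) (integrable_const _), integral_const_mul]; simp
    _ ≤ _ := by linarith

lemma pi_sum_deviation_le {n : ℕ} {Ω : Fin n → Type*} [∀ i, MeasurableSpace (Ω i)]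
    {P : ∀ i, Measure (Ω i)} [∀ i, IsProbabilityMeasure (P i)] {f : ∀ i, Ω i → ℝ}
    (hfm : ∀ i, Measurable (f i)) (hf : ∀ i, MemLp (f i) 4 (P i)) (s : Finset (Fin n))
    {t : ℝ} (ht : 0 < t) :
    (Measure.pi P) {x | t ≤ |∑ i ∈ s, f i (x i) - ∑ i ∈ s, ∫ y, f i y ∂(P i)|}
      ≤ ENNReal.ofReal (64 * n * (∑ i ∈ s, ∫ y, f i y ^ 4 ∂(P i)) / t ^ 4) := by
  set X : ∀ i, (∀ i, Ω i) → ℝ := fun i x => f i (x i) - ∫ y, f i y ∂(P i) with hX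
  have hmp (i : Fin n) := measurePreserving_eval P i
  have hg4 (i : Fin n) : MemLp (fun y => f i y - ∫ y, f i y ∂(P i)) 4 (P i) :=
    (hf i).sub (memLp_const _)
  have hXL (i : Fin n) : MemLp (X i) 4 (Measure.pi P) := (hg4 i).comp_measurePreserving (hmp i)
  have hXm (i : Fin n) : Measurable (X i) := by
    have := hfm i
    fun_prop
  have hind : iIndepFun X (Measure.pi P) :=
    iIndepFun_pi (X := fun i y => f i y - ∫ y, f i y ∂(P i))
      fun i => ((hfm i).sub_const _).aemeasurable
  have hint (i : Fin n) (g : Ω i → ℝ) (hg : Measurable g) :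
      ∫ x, g (x i) ∂(Measure.pi P) = ∫ y, g y ∂(P i) := by
    rw [← (hmp i).map_eq, integral_map (hmp i).measurable.aemeasurable hg.aestronglyMeasurable]
  have h0 (i : Fin n) : ∫ x, X i x ∂(Measure.pi P) = 0 := by
    rw [hX, hint i (fun y => f i y - ∫ y, f i y ∂(P i)) ((hfm i).sub_const _),
      integral_sub ((hf i).integrable (by norm_num)) (integrable_const _)]
    simp
  have h4 (i : Fin n) : ∫ x, X i x ^ 4 ∂(Measure.pi P) ≤ 16 * ∫ y, f i y ^ 4 ∂(P i) := by
    rw [hX, hint i (fun y => (f i y - ∫ y, f i y ∂(P i)) ^ 4) (((hfm i).sub_const _).pow_const 4)]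
    exact integral_sub_integral_pow_four_le (hf i)
  have hS : Integrable (fun x => (∑ i ∈ s, X i x) ^ 4) (Measure.pi P) :=
    MemLp.integrable_pow_of_four (memLp_finsetSum s fun i _ => hXL i) le_rfl
  have hmk := mul_meas_ge_le_integral_of_nonneg
    (ae_of_all (Measure.pi P) fun x => by positivity) hS (t ^ 4)
  have hsub : {x | t ≤ |∑ i ∈ s, f i (x i) - ∑ i ∈ s, ∫ y, f i y ∂(P i)|}
      ⊆ {x | t ^ 4 ≤ (∑ i ∈ s, X i x) ^ 4} := by
    intro x hx
    simp only [Set.mem_ofPred_eq, hX, Finset.sum_sub_distrib] at hx ⊢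
    have := pow_le_pow_left₀ ht.le hx 4
    rwa [Even.pow_abs (by decide)] at this
  have hsum := integral_sum_pow_four_le hXL hXm hind h0 s
  have hcard : (s.card : ℝ) ≤ n := by
    exact_mod_cast (Finset.card_le_univ s).trans_eq (Fintype.card_fin n)
  have hnn : 0 ≤ ∑ i ∈ s, ∫ y, f i y ^ 4 ∂(P i) :=
    Finset.sum_nonneg fun i _ => integral_nonneg fun ω => by positivity
  have hbd : ∫ x, (∑ i ∈ s, X i x) ^ 4 ∂(Measure.pi P)
      ≤ 64 * n * ∑ i ∈ s, ∫ y, f i y ^ 4 ∂(P i) := by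
    have h5 : ∑ i ∈ s, ∫ x, X i x ^ 4 ∂(Measure.pi P) ≤ 16 * ∑ i ∈ s, ∫ y, f i y ^ 4 ∂(P i) := by
      rw [Finset.mul_sum]; exact Finset.sum_le_sum fun i _ => h4 i
    calc _ ≤ 4 * s.card * ∑ i ∈ s, ∫ x, X i x ^ 4 ∂(Measure.pi P) := hsum
      _ ≤ 4 * n * (16 * ∑ i ∈ s, ∫ y, f i y ^ 4 ∂(P i)) := by gcongr
      _ = _ := by ring
  refine (measure_mono hsub).trans ?_
  rw [← ofReal_measureReal]
  refine ENNReal.ofReal_le_ofReal ?_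
  rw [le_div_iff₀ (by positivity), mul_comm]
  exact hmk.trans hbd

end FourthMoment

/-! ### A conditional Borel–Cantelli lemma -/

/-- Suppose that `Φ n` resamples a part of the random variable `s n`: it preserves the law of `s n`,
and resampling twice is the same as resampling once. If the conditional probability of `Bad n`
is eventually bounded by a summable sequence, then eventually `Bad n` does not happen. -/
lemma eventually_notMem_of_resampling {X V : ℕ → Type*} [∀ n, MeasurableSpace (X n)]
    [∀ n, MeasurableSpace (V n)] {P : ∀ n, Measure (X n)} [∀ n, IsProbabilityMeasure (P n)]
    {γ : ∀ n, Measure (V n)} [∀ n, IsProbabilityMeasure (γ n)] {Φ : ∀ n, X n → V n → X n}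
    (hΦ : ∀ n, MeasurePreserving (fun p : X n × V n => Φ n p.1 p.2) ((P n).prod (γ n)) (P n))
    (hΦΦ : ∀ n s v v', Φ n (Φ n s v) v' = Φ n s v') {Bad : ∀ n, Set (X n)}
    (hBad : ∀ n, MeasurableSet (Bad n)) {δ : ℕ → ENNReal} (hδ : ∑' n, δ n ≠ ⊤)
    (h : ∀ᵐ s ∂(Measure.infinitePi P), ∀ᶠ n in atTop, γ n {v | Φ n (s n) v ∈ Bad n} ≤ δ n) :
    ∀ᵐ s ∂(Measure.infinitePi P), ∀ᶠ n in atTop, s n ∉ Bad n := by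
  set T : ∀ n, Set (X n) := fun n => {s | γ n {v | Φ n s v ∈ Bad n} ≤ δ n} with hT
  have hpre (n : ℕ) : MeasurableSet ((fun p : X n × V n => Φ n p.1 p.2) ⁻¹' Bad n) :=
    (hΦ n).measurable (hBad n)
  have hTm (n : ℕ) : MeasurableSet (T n) :=
    measurableSet_le (measurable_measure_prodMk_left (hpre n)) measurable_const
  have hTΦ (n : ℕ) (s : X n) (v : V n) : Φ n s v ∈ T n ↔ s ∈ T n := by
    simp only [hT, Set.mem_ofPred_eq, hΦΦ]
  have hle (n : ℕ) : P n (Bad n ∩ T n) ≤ δ n := by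
    rw [← (hΦ n).measure_preimage ((hBad n).inter (hTm n)).nullMeasurableSet,
      Measure.prod_apply ((hΦ n).measurable ((hBad n).inter (hTm n)))]
    calc _ ≤ ∫⁻ _, δ n ∂(P n) := by
          refine lintegral_mono fun s => ?_
          by_cases hs : s ∈ T n
          · refine (measure_mono fun v hv => ?_).trans hs
            exact hv.1
          · have : Prod.mk s ⁻¹' ((fun p : X n × V n => Φ n p.1 p.2) ⁻¹' (Bad n ∩ T n)) = ∅ := by
              ext v
              simp [hTΦ, hs]
            rw [this]; simp
      _ = δ n := by simp
  have hBC : ∀ᵐ s ∂(Measure.infinitePi P), ∀ᶠ n in atTop,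
      s ∉ {s : ∀ n, X n | s n ∈ Bad n ∩ T n} := by
    refine ae_eventually_notMem (ne_top_of_le_ne_top hδ (ENNReal.tsum_le_tsum fun n => ?_))
    have := (measurePreserving_eval_infinitePi P n).measure_preimage
      ((hBad n).inter (hTm n)).nullMeasurableSet
    exact this.trans_le (hle n)
  filter_upwards [h, hBC] with s hs hs'
  filter_upwards [hs, hs'] with n hn hn' hb
  exact hn' ⟨hb, hn⟩

/-! ### Gaussian smoothing -/

/-- The Gaussian density with mean `p.1` and standard deviation `p.2`. -/
def gaussDensity (p : ℝ × ℝ) (y : ℝ) : ℝ :=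
  gaussianPDFReal p.1 (.mk (p.2 ^ 2) (sq_nonneg _)) y

lemma integral_comp_gaussian {f : ℝ → ℝ} (hf : Measurable f) (s : ℝ) {c : ℝ} (hc : c ≠ 0) :
    ∫ t, f (s + c * t) ∂(gaussianReal 0 1) = ∫ y, f y * gaussDensity (s, c) y := by
  have h1 : (gaussianReal 0 1).map (fun t => s + c * t) = gaussianReal s (.mk (c ^ 2) (sq_nonneg _)) := by
    have : (fun t : ℝ => s + c * t) = (fun x => s + x) ∘ (fun t => c * t) := rfl
    rw [this, ← Measure.map_map (by fun_prop) (by fun_prop), gaussianReal_map_const_mul,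
      gaussianReal_map_const_add]
    simp
  rw [← integral_map (φ := fun t => s + c * t) (by fun_prop) hf.aestronglyMeasurable, h1,
    integral_gaussianReal_eq_integral_smul]
  · simp [gaussDensity, mul_comm]
  · intro h
    exact hc (by simpa using congrArg NNReal.toReal h)

lemma integrable_mul_gaussDensity {f : ℝ → ℝ} (hf : Measurable f) (hfp : PolyBd f) (s : ℝ) {c : ℝ}
    (hc : c ≠ 0) : Integrable fun y => f y * gaussDensity (s, c) y := by
  have h1 : NNReal.mk (c ^ 2) (sq_nonneg _) ≠ 0 := fun h =>
    hc (by simpa using congrArg NNReal.toReal h)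
  have h2 := hfp.integrable hf (gaussianReal s (.mk (c ^ 2) (sq_nonneg _)))
  rw [gaussianReal_of_var_ne_zero _ h1, integrable_withDensity_iff (measurable_gaussianPDF _ _)
    (ae_of_all _ fun _ => gaussianPDF_lt_top)] at h2
  simpa [gaussDensity, toReal_gaussianPDF] using h2

lemma gaussDensity_nonneg (p : ℝ × ℝ) (y : ℝ) : 0 ≤ gaussDensity p y :=
  gaussianPDFReal_nonneg _ _ _

lemma measurable_gaussDensity (p : ℝ × ℝ) : Measurable (gaussDensity p) :=
  measurable_gaussianPDFReal _ _

lemma polyBd_one_add_abs_pow (q : ℕ) : PolyBd fun y : ℝ => (1 + |y|) ^ q :=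
  ⟨1, q, zero_le_one, fun y => by simp [abs_of_nonneg (by positivity : 0 ≤ 1 + |y|)]⟩

/-- The weighted `L¹`-distance of two Gaussian densities. -/
def gaussDist (q : ℕ) (p p' : ℝ × ℝ) : ℝ :=
  ∫ y, (1 + |y|) ^ q * |gaussDensity p y - gaussDensity p' y|

lemma gaussDensity_le {c₀ : ℝ} (hc₀ : 0 < c₀) {s c : ℝ} (hs : |s| ≤ 1) (hc : c₀ / 2 ≤ c)
    (hc' : c ≤ 2 * c₀) (y : ℝ) :
    gaussDensity (s, c) y ≤ 8 * Real.exp (1 / (8 * c₀ ^ 2)) * gaussDensity (0, 4 * c₀) y := by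
  have hcp : 0 < c := by linarith
  simp only [gaussDensity, gaussianPDFReal, NNReal.coe_mk, sub_zero]
  have h1 : (√(2 * Real.pi * c ^ 2))⁻¹ ≤ 8 * (√(2 * Real.pi * (4 * c₀) ^ 2))⁻¹ := by
    rw [Real.sqrt_mul (by positivity) (c ^ 2), Real.sqrt_mul (by positivity) ((4 * c₀) ^ 2),
      Real.sqrt_sq hcp.le, Real.sqrt_sq (by positivity), ← div_eq_mul_inv, inv_eq_one_div,
      div_le_div_iff₀ (by positivity) (by positivity)]
    nlinarith [Real.sqrt_pos.2 (show 0 < 2 * Real.pi by positivity)]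
  have h2 : -(y - s) ^ 2 / (2 * c ^ 2) ≤ 1 / (8 * c₀ ^ 2) + -y ^ 2 / (2 * (4 * c₀) ^ 2) := by
    have hs2 : s ^ 2 ≤ 1 := by rw [← sq_abs]; nlinarith [abs_nonneg s]
    have h3 : y ^ 2 ≤ 2 * (y - s) ^ 2 + 2 := by nlinarith [sq_nonneg (y - 2 * s)]
    have h4 : (y - s) ^ 2 / (2 * (2 * c₀) ^ 2) ≤ (y - s) ^ 2 / (2 * c ^ 2) := by
      gcongr
    have h5 : (y ^ 2 / 2 - 1) / (2 * (2 * c₀) ^ 2) ≤ (y - s) ^ 2 / (2 * (2 * c₀) ^ 2) := by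
      gcongr; linarith
    have h6 : (y ^ 2 / 2 - 1) / (2 * (2 * c₀) ^ 2) ≥ y ^ 2 / (2 * (4 * c₀) ^ 2) - 1 / (8 * c₀ ^ 2) := by
      have : (y ^ 2 / 2 - 1) / (2 * (2 * c₀) ^ 2) - (y ^ 2 / (2 * (4 * c₀) ^ 2) - 1 / (8 * c₀ ^ 2))
          = y ^ 2 / (32 * c₀ ^ 2) := by
        field_simp; ring
      have : 0 ≤ y ^ 2 / (32 * c₀ ^ 2) := by positivity
      linarith
    rw [neg_div, neg_div]
    linarith
  calc _ ≤ 8 * (√(2 * Real.pi * (4 * c₀) ^ 2))⁻¹ *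
        Real.exp (1 / (8 * c₀ ^ 2) + -y ^ 2 / (2 * (4 * c₀) ^ 2)) :=
        mul_le_mul h1 (Real.exp_le_exp.2 h2) (Real.exp_pos _).le (by positivity)
    _ = _ := by rw [Real.exp_add]; ring

lemma tendsto_gaussDist (q : ℕ) {c₀ : ℝ} (hc₀ : 0 < c₀) :
    Tendsto (fun p : ℝ × ℝ => gaussDist q p (0, c₀)) (𝓝 (0, c₀)) (𝓝 0) := by
  have h0 : ∫ y : ℝ, (1 + |y|) ^ q * |gaussDensity (0, c₀) y - gaussDensity (0, c₀) y| = 0 := by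
    simp
  suffices h : Tendsto (fun p : ℝ × ℝ => gaussDist q p (0, c₀)) (𝓝 (0, c₀))
      (𝓝 (∫ y : ℝ, (1 + |y|) ^ q * |gaussDensity (0, c₀) y - gaussDensity (0, c₀) y|)) by
    rwa [h0] at h
  have hnear : ∀ᶠ p : ℝ × ℝ in 𝓝 (0, c₀), |p.1| ≤ 1 ∧ c₀ / 2 ≤ p.2 ∧ p.2 ≤ 2 * c₀ := by
    have h1 : ∀ᶠ s : ℝ in 𝓝 0, |s| ≤ 1 := by
      filter_upwards [Metric.closedBall_mem_nhds (0 : ℝ) one_pos] with s hs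
      simpa using hs
    have h2 : ∀ᶠ c : ℝ in 𝓝 c₀, c₀ / 2 ≤ c ∧ c ≤ 2 * c₀ := by
      filter_upwards [Icc_mem_nhds (by linarith : c₀ / 2 < c₀) (by linarith : c₀ < 2 * c₀)]
        with c hc using hc
    rw [nhds_prod_eq]
    exact (h1.prod_mk h2).mono fun p hp => hp
  set K := 8 * Real.exp (1 / (8 * c₀ ^ 2)) with hK
  refine tendsto_integral_filter_of_dominated_convergence
    (fun y => 2 * K * ((1 + |y|) ^ q * gaussDensity (0, 4 * c₀) y)) ?_ ?_ ?_ ?_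
  · refine Eventually.of_forall fun p => Measurable.aestronglyMeasurable ?_
    have := measurable_gaussDensity p
    have := measurable_gaussDensity (0, c₀)
    fun_prop
  · filter_upwards [hnear] with p hp
    refine ae_of_all _ fun y => ?_
    have h1 := gaussDensity_le hc₀ (s := p.1) (c := p.2) hp.1 hp.2.1 hp.2.2 y
    have h2 := gaussDensity_le hc₀ (s := 0) (c := c₀) (by simp) (by linarith) (by linarith) y
    rw [← hK] at h1 h2
    have h3 := gaussDensity_nonneg p y
    have h4 := gaussDensity_nonneg (0, c₀) y
    have h5 : |gaussDensity p y - gaussDensity (0, c₀) y| ≤ 2 * K * gaussDensity (0, 4 * c₀) y := by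
      rw [abs_le]; constructor <;> linarith
    rw [Real.norm_eq_abs, abs_mul, abs_abs, abs_of_nonneg (by positivity : 0 ≤ (1 + |y|) ^ q)]
    calc _ ≤ (1 + |y|) ^ q * (2 * K * gaussDensity (0, 4 * c₀) y) := by gcongr
      _ = _ := by ring
  · exact (integrable_mul_gaussDensity (by fun_prop) (polyBd_one_add_abs_pow q) 0
      (by positivity)).const_mul _
  · refine ae_of_all _ fun y => ?_
    have hcont : ContinuousAt (fun p : ℝ × ℝ => gaussDensity p y) (0, c₀) := by
      unfold gaussDensity gaussianPDFReal
      simp only [NNReal.coe_mk]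
      have hne : √(2 * Real.pi * c₀ ^ 2) ≠ 0 := by positivity
      refine ContinuousAt.mul (ContinuousAt.inv₀ (by fun_prop) hne) ?_
      exact Real.continuous_exp.continuousAt.comp
        (ContinuousAt.div (by fun_prop) (by fun_prop) (by positivity))
    exact ((hcont.tendsto.sub_const _).abs.const_mul _)

lemma gaussDist_le (q : ℕ) {c₀ : ℝ} (hc₀ : 0 < c₀) {s c : ℝ} (hc : c₀ / 2 ≤ c)
    (hc' : c ≤ 2 * c₀) :
    gaussDist q (s, c) (0, c₀)
      ≤ 2 * (∫ t, (1 + 2 * c₀ * |t|) ^ q ∂(gaussianReal 0 1)) * (1 + |s|) ^ q := by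
  have hcp : 0 < c := by linarith
  have hi := fun (s : ℝ) {c : ℝ} (hc : c ≠ 0) => integrable_mul_gaussDensity
    (f := fun y => (1 + |y|) ^ q) (by fun_prop) (polyBd_one_add_abs_pow q) s hc
  have hM : Integrable (fun t => (1 + 2 * c₀ * |t|) ^ q) (gaussianReal 0 1) := by
    refine PolyBd.integrable ?_ (by fun_prop) _
    exact (((PolyBd.const 1).add (PolyBd.norm.const_mul (2 * c₀))).pow q)
  have hbd (s : ℝ) {c : ℝ} (hcp : 0 < c) (hc' : c ≤ 2 * c₀) :
      ∫ y, (1 + |y|) ^ q * gaussDensity (s, c) y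
        ≤ (∫ t, (1 + 2 * c₀ * |t|) ^ q ∂(gaussianReal 0 1)) * (1 + |s|) ^ q := by
    rw [← integral_comp_gaussian (f := fun y => (1 + |y|) ^ q) (by fun_prop) s hcp.ne',
      ← integral_mul_const]
    refine integral_mono_of_nonneg (ae_of_all _ fun t => by positivity) (hM.mul_const _)
      (ae_of_all _ fun t => ?_)
    simp only
    rw [← mul_pow]
    refine pow_le_pow_left₀ (by positivity) ?_ _
    have h1 : |s + c * t| ≤ |s| + 2 * c₀ * |t| := by
      refine (abs_add_le _ _).trans ?_
      rw [abs_mul, abs_of_pos hcp]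
      gcongr
    have h2 : 0 ≤ 2 * c₀ * |t| * |s| := by positivity
    nlinarith
  have hle : gaussDist q (s, c) (0, c₀) ≤ ∫ y, ((1 + |y|) ^ q * gaussDensity (s, c) y
      + (1 + |y|) ^ q * gaussDensity (0, c₀) y) := by
    refine integral_mono_of_nonneg (ae_of_all _ fun y => by positivity)
      ((hi s hcp.ne').add (hi 0 hc₀.ne')) (ae_of_all _ fun y => ?_)
    simp only
    rw [← mul_add]
    gcongr
    have h3 := gaussDensity_nonneg (s, c) y
    have h4 := gaussDensity_nonneg (0, c₀) y
    rw [abs_le]; constructor <;> linarith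
  rw [integral_add (hi s hcp.ne') (hi 0 hc₀.ne')] at hle
  have h5 := hbd s hcp hc'
  have h6 := hbd 0 hc₀ (by linarith)
  have hM0 : 0 ≤ ∫ t, (1 + 2 * c₀ * |t|) ^ q ∂(gaussianReal 0 1) :=
    integral_nonneg fun t => by positivity
  have h7 : (1 : ℝ) ≤ (1 + |s|) ^ q := one_le_pow₀ (by simp)
  simp only [abs_zero, add_zero, one_pow, mul_one] at h6
  nlinarith

/-- Gaussian averages of polynomially bounded functions depend continuously on the mean and on
the standard deviation. -/
lemma exists_gaussian_smoothing_bound (q : ℕ) {c₀ : ℝ} (hc₀ : 0 < c₀) {η : ℝ} (hη : 0 < η) :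
    ∃ δ > 0, ∃ K ≥ 0, ∀ (f : ℝ → ℝ), Measurable f → ∀ A, (∀ y, |f y| ≤ A * (1 + |y|) ^ q) →
      ∀ s c, |c - c₀| ≤ δ →
        |∫ t, f (s + c * t) ∂(gaussianReal 0 1) - ∫ t, f (c₀ * t) ∂(gaussianReal 0 1)|
          ≤ A * (η + K * |s| ^ (q + 1)) := by
  have h1 := (tendsto_gaussDist q hc₀).eventually (Iio_mem_nhds hη)
  obtain ⟨δ, hδ, hball⟩ := Metric.eventually_nhds_iff.1 h1
  set M := ∫ t, (1 + 2 * c₀ * |t|) ^ q ∂(gaussianReal 0 1) with hM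
  have hM0 : 0 ≤ M := integral_nonneg fun t => by positivity
  set δ' := min (δ / 2) (c₀ / 2) with hδ'
  have hδ'0 : 0 < δ' := by positivity
  refine ⟨δ', hδ'0, 2 * M * (1 / δ' + 1) ^ (q + 1), by positivity, fun f hf A hA s c hc => ?_⟩
  have hA0 : 0 ≤ A := by simpa using (abs_nonneg _).trans (hA 0)
  have hc1 : |c - c₀| ≤ c₀ / 2 := hc.trans (min_le_right _ _)
  rw [abs_le] at hc1
  have hcl : c₀ / 2 ≤ c := by linarith
  have hcu : c ≤ 2 * c₀ := by linarith
  have hcp : 0 < c := by linarith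
  have hω : gaussDist q (s, c) (0, c₀) ≤ η + 2 * M * (1 / δ' + 1) ^ (q + 1) * |s| ^ (q + 1) := by
    by_cases hs : |s| ≤ δ'
    · have : gaussDist q (s, c) (0, c₀) < η := by
        refine hball ?_
        rw [Prod.dist_eq, max_lt_iff, Real.dist_eq, Real.dist_eq, sub_zero]
        have : δ' < δ := (min_le_left _ _).trans_lt (by linarith)
        exact ⟨hs.trans_lt this, hc.trans_lt this⟩
      have : 0 ≤ 2 * M * (1 / δ' + 1) ^ (q + 1) * |s| ^ (q + 1) := by positivity
      linarith
    · push Not at hs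
      have h2 := gaussDist_le q hc₀ (s := s) hcl hcu
      rw [← hM] at h2
      have h3 : (1 + |s|) ^ q ≤ (1 + |s|) ^ (q + 1) :=
        pow_le_pow_right₀ (by simp) (Nat.le_succ q)
      have h4 : (1 + |s|) ^ (q + 1) ≤ ((1 / δ' + 1) * |s|) ^ (q + 1) := by
        refine pow_le_pow_left₀ (by positivity) ?_ _
        have : 1 ≤ 1 / δ' * |s| := by
          rw [one_div, inv_mul_eq_div, one_le_div hδ'0]; exact hs.le
        linarith
      rw [mul_pow] at h4
      have h5 := mul_le_mul_of_nonneg_left (h3.trans h4) (by positivity : 0 ≤ 2 * M)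
      nlinarith
  have hfp : PolyBd f := ⟨A, q, hA0, by simpa using hA⟩
  have e2 := integral_comp_gaussian hf 0 hc₀.ne'
  simp only [zero_add] at e2
  rw [integral_comp_gaussian hf s hcp.ne', e2,
    ← integral_sub (integrable_mul_gaussDensity hf hfp s hcp.ne')
      (integrable_mul_gaussDensity hf hfp 0 hc₀.ne')]
  have hi : Integrable fun y => (1 + |y|) ^ q *
      |gaussDensity (s, c) y - gaussDensity (0, c₀) y| := by
    have := ((integrable_mul_gaussDensity (f := fun y => (1 + |y|) ^ q) (by fun_prop)
      (polyBd_one_add_abs_pow q) s hcp.ne').sub (integrable_mul_gaussDensity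
        (f := fun y => (1 + |y|) ^ q) (by fun_prop) (polyBd_one_add_abs_pow q) 0 hc₀.ne')).abs
    refine this.congr (ae_of_all _ fun y => ?_)
    simp only [Pi.sub_apply]
    rw [← mul_sub, abs_mul, abs_of_nonneg (by positivity : 0 ≤ (1 + |y|) ^ q)]
  refine (abs_integral_le_integral_abs).trans ?_
  refine le_trans ?_ (mul_le_mul_of_nonneg_left hω hA0)
  rw [gaussDist, ← integral_const_mul]
  refine integral_mono_of_nonneg (ae_of_all _ fun y => abs_nonneg _) (hi.const_mul A)
    (ae_of_all _ fun y => ?_)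
  simp only
  rw [← mul_sub, abs_mul, ← mul_assoc]
  exact mul_le_mul_of_nonneg_right (hA y) (abs_nonneg _)

variable {ι κ : Type*}

/-! ### Evaluation of programs -/

/-- The A-var denoting the transpose. -/
def AVar.flip : AVar κ → AVar κ
  | input w => transpose w
  | transpose w => input w

lemma AVar.flip_ne (A : AVar κ) : A.flip ≠ A := by cases A <;> simp [AVar.flip]

lemma AVar.eval_flip {n : ℕ} (W : κ → Matrix (Fin n) (Fin n) ℝ) (A : AVar κ) :
    A.flip.eval W = (A.eval W)ᵀ := by cases A <;> simp [AVar.flip, AVar.eval]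

/-- Adds the newest coordinate. -/
def extend {m : ℕ} (z : ι ⊕ Fin m → ℝ) (t : ℝ) : ι ⊕ Fin (m + 1) → ℝ := fun g =>
  match previous? g with
  | some g' => z g'
  | none => t

@[simp] lemma extend_inl {m : ℕ} (z : ι ⊕ Fin m → ℝ) (t : ℝ) (i : ι) :
    extend z t (Sum.inl i) = z (Sum.inl i) := rfl

@[simp] lemma extend_castSucc {m : ℕ} (z : ι ⊕ Fin m → ℝ) (t : ℝ) (l : Fin m) :
    extend z t (Sum.inr l.castSucc) = z (Sum.inr l) := by
  simp [extend, previous?]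

@[simp] lemma extend_last {m : ℕ} (z : ι ⊕ Fin m → ℝ) (t : ℝ) :
    extend z t (Sum.inr (Fin.last m)) = t := by
  simp [extend, previous?]

@[simp] lemma restrict_extend {m : ℕ} (z : ι ⊕ Fin m → ℝ) (t : ℝ) : restrict (extend z t) = z := by
  ext g
  cases g <;> simp [restrict]

namespace Program

variable {m n : ℕ}

/-- The vector `h` in the instruction `g := A h` that introduced the `l`-th non-input G-var, as a
function of all G-vars. -/
def hvec (P : Program ι κ m) (l : Fin m) (p : Fin n → ι ⊕ Fin m → ℝ) : Fin n → ℝ :=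
  fun α => P.hfn l (p α)

lemma eval_matmul (P : Program ι κ m) (A : AVar κ) (h : HVar (ι ⊕ Fin m))
    (W : κ → Matrix (Fin n) (Fin n) ℝ) (x : Fin n → ι → ℝ) (α : Fin n) :
    (P.matmul A h).eval W x α = extend (P.eval W x α) ((A.eval W *ᵥ P.evalH h W x) α) := rfl

@[simp] lemma mat_matmul_castSucc (P : Program ι κ m) (A : AVar κ) (h : HVar (ι ⊕ Fin m))
    (l : Fin m) : (P.matmul A h).mat l.castSucc = P.mat l := by simp [mat]

@[simp] lemma mat_matmul_last (P : Program ι κ m) (A : AVar κ) (h : HVar (ι ⊕ Fin m)) :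
    (P.matmul A h).mat (Fin.last m) = A := by simp [mat]

@[simp] lemma hfn_matmul_castSucc (P : Program ι κ m) (A : AVar κ) (h : HVar (ι ⊕ Fin m))
    (l : Fin m) (z : ι ⊕ Fin (m + 1) → ℝ) :
    (P.matmul A h).hfn l.castSucc z = P.hfn l (restrict z) := by simp [hfn]

@[simp] lemma hfn_matmul_last (P : Program ι κ m) (A : AVar κ) (h : HVar (ι ⊕ Fin m))
    (z : ι ⊕ Fin (m + 1) → ℝ) :
    (P.matmul A h).hfn (Fin.last m) z = h.fn (restrict z) := by simp [hfn]

@[simp] lemma hvec_matmul_castSucc (P : Program ι κ m) (A : AVar κ) (h : HVar (ι ⊕ Fin m))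
    (l : Fin m) (p : Fin n → ι ⊕ Fin (m + 1) → ℝ) :
    (P.matmul A h).hvec l.castSucc p = P.hvec l fun α => restrict (p α) := by
  funext α; simp [hvec]

@[simp] lemma hvec_matmul_last (P : Program ι κ m) (A : AVar κ) (h : HVar (ι ⊕ Fin m))
    (p : Fin n → ι ⊕ Fin (m + 1) → ℝ) :
    (P.matmul A h).hvec (Fin.last m) p = fun α => h.fn (restrict (p α)) := by
  funext α; simp [hvec]

lemma restrict_eval_matmul (P : Program ι κ m) (A : AVar κ) (h : HVar (ι ⊕ Fin m))
    (W : κ → Matrix (Fin n) (Fin n) ℝ) (x : Fin n → ι → ℝ) :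
    (fun α => restrict ((P.matmul A h).eval W x α)) = P.eval W x := by
  funext α; simp [eval_matmul]

lemma eval_inr (P : Program ι κ m) (W : κ → Matrix (Fin n) (Fin n) ℝ) (x : Fin n → ι → ℝ)
    (α : Fin n) (l : Fin m) :
    P.eval W x α (Sum.inr l) = ((P.mat l).eval W *ᵥ P.hvec l (P.eval W x)) α := by
  induction P with
  | inputs => exact l.elim0
  | matmul P A h ih =>
    rw [eval_matmul]
    induction l using Fin.lastCases with
    | last =>
      rw [extend_last, mat_matmul_last, hvec_matmul_last]
      simp only [eval_matmul, restrict_extend]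
      rfl
    | cast l =>
      rw [extend_castSucc, ih, mat_matmul_castSucc, hvec_matmul_castSucc, restrict_eval_matmul]

lemma eval_congr (P : Program ι κ m) {W W' : κ → Matrix (Fin n) (Fin n) ℝ} {x : Fin n → ι → ℝ}
    (h : ∀ l, (P.mat l).eval W' *ᵥ P.hvec l (P.eval W x)
      = (P.mat l).eval W *ᵥ P.hvec l (P.eval W x)) :
    P.eval W' x = P.eval W x := by
  induction P with
  | inputs => rfl
  | matmul P A h' ih =>
    have h1 : P.eval W' x = P.eval W x := by
      refine ih fun l => ?_
      have := h l.castSucc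
      rwa [mat_matmul_castSucc, hvec_matmul_castSucc, restrict_eval_matmul] at this
    have h2 := h (Fin.last _)
    rw [mat_matmul_last, hvec_matmul_last] at h2
    simp only [eval_matmul, restrict_extend] at h2
    funext α
    rw [eval_matmul, eval_matmul, h1]
    congr 1
    have h3 : P.evalH h' W' x = P.evalH h' W x := by
      funext β; simp only [evalH, h1]
    rw [h3]
    exact congrFun h2 α

end Program

/-! ### Measurability -/

lemma HVar.PolyBounded.measurable {γ : Type*} {h : HVar γ} (hh : h.PolyBounded) :
    Measurable h.fn := by
  cases h with
  | ofG g => exact measurable_pi_apply g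
  | nonlin k φ x =>
    exact hh.1.comp (measurable_pi_lambda _ fun j => measurable_pi_apply (x j))

lemma HVar.PolyBounded.polyBd {γ : Type*} [Fintype γ] {h : HVar γ} (hh : h.PolyBounded) :
    PolyBd h.fn := by
  cases h with
  | ofG g => exact PolyBd.eval g
  | nonlin k φ x =>
    exact (NetsorT.PolyBounded.polyBd hh.2).comp (PolyBd.norm_pi fun j => PolyBd.eval (x j))

lemma measurable_extend {m : ℕ} :
    Measurable fun p : (ι ⊕ Fin m → ℝ) × ℝ => extend p.1 p.2 := by
  refine measurable_pi_lambda _ fun g => ?_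
  rcases g with i | l
  · simp only [extend_inl]; fun_prop
  · induction l using Fin.lastCases
    · simp only [extend_last]; fun_prop
    · simp only [extend_castSucc]; fun_prop

lemma measurable_restrict {m : ℕ} :
    Measurable (restrict : (ι ⊕ Fin (m + 1) → ℝ) → ι ⊕ Fin m → ℝ) := by
  refine measurable_pi_lambda _ fun g => ?_
  rcases g with i | l <;> simp only [restrict, Sum.elim_inl, Sum.elim_inr] <;> fun_prop

namespace Program

variable {m n : ℕ}

lemma measurable_hfn {P : Program ι κ m} (hP : P.PolyBounded) (l : Fin m) :
    Measurable (P.hfn l) := by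
  induction P with
  | inputs => exact l.elim0
  | matmul P A h ih =>
    induction l using Fin.lastCases with
    | last =>
      simp only [hfn, Fin.lastCases_last]
      exact hP.2.measurable.comp measurable_restrict
    | cast l =>
      simp only [hfn, Fin.lastCases_castSucc]
      exact (ih hP.1 l).comp measurable_restrict

lemma polyBd_hfn [Fintype ι] {P : Program ι κ m} (hP : P.PolyBounded) (l : Fin m) :
    PolyBd (P.hfn l) := by
  have hr {m : ℕ} : PolyBd fun z : ι ⊕ Fin (m + 1) → ℝ => ‖restrict z‖ :=
    PolyBd.norm_pi fun g => by
      rcases g with i | l <;> simp only [restrict, Sum.elim_inl, Sum.elim_inr] <;>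
        exact PolyBd.eval _
  induction P with
  | inputs => exact l.elim0
  | matmul P A h ih =>
    induction l using Fin.lastCases with
    | last =>
      simp only [hfn, Fin.lastCases_last]
      exact hP.2.polyBd.comp hr
    | cast l =>
      simp only [hfn, Fin.lastCases_castSucc]
      exact (ih hP.1 l).comp hr

lemma measurable_gvars {P : Program ι κ m} (hP : P.PolyBounded) (n : ℕ) :
    Measurable fun s : Inputs ι κ n => P.gvars s := by
  induction P with
  | inputs =>
    refine measurable_pi_lambda _ fun α => measurable_pi_lambda _ fun g => ?_
    rcases g with i | l
    · simp only [gvars, eval, Sum.elim_inl]; fun_prop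
    · exact l.elim0
  | matmul P A h ih =>
    refine measurable_pi_lambda _ fun α => ?_
    simp only [gvars, eval_matmul]
    have ih := ih hP.1
    have hα (α : Fin n) : Measurable fun s : Inputs ι κ n => P.gvars s α :=
      (measurable_pi_apply α).comp ih
    refine measurable_extend.comp ((hα α).prodMk ?_)
    have hA (β : Fin n) : Measurable fun s : Inputs ι κ n =>
        A.eval (fun W => Matrix.of (s.1 W)) α β := by
      cases A <;> simp only [AVar.eval, Matrix.transpose_apply, Matrix.of_apply] <;> fun_prop
    have : Measurable fun s : Inputs ι κ n => ∑ β, A.eval (fun W => Matrix.of (s.1 W)) α β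
        * h.fn (P.gvars s β) :=
      Finset.measurable_sum _ fun β _ => (hA β).mul (hP.2.measurable.comp (hα β))
    exact this

end Program

/-! ### Projections -/

section Deflate

variable {n : ℕ}

/-- The normalization of `R h` (zero if `R h = 0`). -/
def unitResidual (R : Matrix (Fin n) (Fin n) ℝ) (h : Fin n → ℝ) : Fin n → ℝ :=
  (√(R *ᵥ h ⬝ᵥ R *ᵥ h))⁻¹ • R *ᵥ h

/-- If `R` is an orthogonal projection, this is the orthogonal projection onto the subspace of its
range orthogonal to `h`. -/
def deflate (R : Matrix (Fin n) (Fin n) ℝ) (h : Fin n → ℝ) : Matrix (Fin n) (Fin n) ℝ :=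
  R - Matrix.vecMulVec (unitResidual R h) (unitResidual R h)

lemma vecMulVec_mulVec_eq_smul {γ : Type*} [Fintype γ] (e v : γ → ℝ) :
    Matrix.vecMulVec e e *ᵥ v = (e ⬝ᵥ v) • e := by
  rw [Matrix.vecMulVec_mulVec, op_smul_eq_smul]

lemma dotProduct_self_nonneg' {γ : Type*} [Fintype γ] (v : γ → ℝ) : 0 ≤ v ⬝ᵥ v := by
  simpa using dotProduct_star_self_nonneg v

lemma unitResidual_dotProduct_self (R : Matrix (Fin n) (Fin n) ℝ) (h : Fin n → ℝ) :
    unitResidual R h ⬝ᵥ unitResidual R h = 1 ∨ unitResidual R h = 0 := by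
  set f := R *ᵥ h with hf
  have h0 := dotProduct_self_nonneg' f
  rcases h0.eq_or_lt with h0 | h0
  · right
    have : f = 0 := dotProduct_self_eq_zero.1 h0.symm
    simp [unitResidual, ← hf, this]
  · left
    simp only [unitResidual, ← hf, smul_dotProduct, dotProduct_smul, smul_eq_mul]
    rw [← mul_assoc, ← mul_inv, Real.mul_self_sqrt h0.le, inv_mul_cancel₀ h0.ne']

variable {R : Matrix (Fin n) (Fin n) ℝ}

lemma mulVec_unitResidual (hR : R * R = R) (h : Fin n → ℝ) :
    R *ᵥ unitResidual R h = unitResidual R h := by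
  simp [unitResidual, Matrix.mulVec_smul, Matrix.mulVec_mulVec, hR]

lemma vecMulVec_unitResidual_mul (R : Matrix (Fin n) (Fin n) ℝ) (h : Fin n → ℝ) :
    Matrix.vecMulVec (unitResidual R h) (unitResidual R h)
        * Matrix.vecMulVec (unitResidual R h) (unitResidual R h)
      = Matrix.vecMulVec (unitResidual R h) (unitResidual R h) := by
  rw [Matrix.vecMulVec_mul_vecMulVec]
  rcases unitResidual_dotProduct_self R h with h1 | h1 <;> simp [h1]

lemma mul_vecMulVec_unitResidual (hR : R * R = R) (h : Fin n → ℝ) :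
    R * Matrix.vecMulVec (unitResidual R h) (unitResidual R h)
      = Matrix.vecMulVec (unitResidual R h) (unitResidual R h) := by
  rw [Matrix.mul_vecMulVec, mulVec_unitResidual hR]

lemma vecMulVec_unitResidual_mul_right (hR : R * R = R) (hRT : Rᵀ = R) (h : Fin n → ℝ) :
    Matrix.vecMulVec (unitResidual R h) (unitResidual R h) * R
      = Matrix.vecMulVec (unitResidual R h) (unitResidual R h) := by
  rw [Matrix.vecMulVec_mul, ← Matrix.mulVec_transpose, hRT, mulVec_unitResidual hR]

lemma deflate_transpose (hRT : Rᵀ = R) (h : Fin n → ℝ) : (deflate R h)ᵀ = deflate R h := by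
  simp [deflate, Matrix.transpose_vecMulVec, hRT]

lemma deflate_mul_self (hR : R * R = R) (hRT : Rᵀ = R) (h : Fin n → ℝ) :
    deflate R h * deflate R h = deflate R h := by
  simp only [deflate, Matrix.mul_sub, Matrix.sub_mul, hR, mul_vecMulVec_unitResidual hR,
    vecMulVec_unitResidual_mul_right hR hRT, vecMulVec_unitResidual_mul]
  simp

lemma dotProduct_mulVec_symm {γ : Type*} [Fintype γ] {R : Matrix γ γ ℝ} (hRT : Rᵀ = R)
    (x y : γ → ℝ) : R *ᵥ x ⬝ᵥ y = x ⬝ᵥ R *ᵥ y := by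
  rw [Matrix.dotProduct_mulVec, ← Matrix.mulVec_transpose, hRT]

lemma deflate_mulVec_self (hR : R * R = R) (hRT : Rᵀ = R) (h : Fin n → ℝ) :
    deflate R h *ᵥ h = 0 := by
  set f := R *ᵥ h with hf
  have h1 : f ⬝ᵥ h = f ⬝ᵥ f := by
    rw [hf, dotProduct_mulVec_symm hRT, dotProduct_mulVec_symm hRT h (R *ᵥ h),
      Matrix.mulVec_mulVec, hR]
  rw [deflate, Matrix.sub_mulVec, vecMulVec_mulVec_eq_smul, unitResidual, ← hf,
    smul_dotProduct, h1, smul_eq_mul, smul_smul]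
  have h0 := dotProduct_self_nonneg' f
  rcases h0.eq_or_lt with h0 | h0
  · have : f = 0 := dotProduct_self_eq_zero.1 h0.symm
    simp [this]
  · have : (√(f ⬝ᵥ f))⁻¹ * (f ⬝ᵥ f) * (√(f ⬝ᵥ f))⁻¹ = 1 := by
      rw [mul_right_comm, ← mul_inv, Real.mul_self_sqrt h0.le, inv_mul_cancel₀ h0.ne']
    rw [this, one_smul, sub_self]

lemma deflate_mulVec_eq_zero (hRT : Rᵀ = R) (h : Fin n → ℝ) {h' : Fin n → ℝ}
    (h0 : R *ᵥ h' = 0) : deflate R h *ᵥ h' = 0 := by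
  rw [deflate, Matrix.sub_mulVec, h0, vecMulVec_mulVec_eq_smul, unitResidual, smul_dotProduct,
    dotProduct_mulVec_symm hRT h h', h0]
  simp

end Deflate

namespace Program

variable {m n : ℕ}

/-- The orthogonal projection onto the vectors orthogonal to all `h` used in instructions
`g := A h`. -/
def res : {m : ℕ} → Program ι κ m → AVar κ → {n : ℕ} → (Fin n → ι ⊕ Fin m → ℝ) →
    Matrix (Fin n) (Fin n) ℝ
  | _, inputs, _, _, _ => 1
  | _, matmul P A' h, A, _, p => open Classical in
      if A' = A then
        deflate (P.res A fun α => restrict (p α)) (fun α => h.fn (restrict (p α)))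
      else P.res A fun α => restrict (p α)

lemma res_transpose_and_mul_self (P : Program ι κ m) (A : AVar κ) (p : Fin n → ι ⊕ Fin m → ℝ) :
    (P.res A p)ᵀ = P.res A p ∧ P.res A p * P.res A p = P.res A p := by
  induction P with
  | inputs => simp [res]
  | matmul P A' h ih =>
    obtain ⟨h1, h2⟩ := ih fun α => restrict (p α)
    by_cases hA : A' = A
    · simp only [res, hA, if_true]
      exact ⟨deflate_transpose h1 _, deflate_mul_self h2 h1 _⟩
    · simp only [res, hA, if_false]
      exact ⟨h1, h2⟩

lemma res_transpose (P : Program ι κ m) (A : AVar κ) (p : Fin n → ι ⊕ Fin m → ℝ) :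
    (P.res A p)ᵀ = P.res A p := (P.res_transpose_and_mul_self A p).1

lemma res_mul_self (P : Program ι κ m) (A : AVar κ) (p : Fin n → ι ⊕ Fin m → ℝ) :
    P.res A p * P.res A p = P.res A p := (P.res_transpose_and_mul_self A p).2

lemma res_mulVec_hvec (P : Program ι κ m) {A : AVar κ} (p : Fin n → ι ⊕ Fin m → ℝ) {l : Fin m}
    (hl : P.mat l = A) : P.res A p *ᵥ P.hvec l p = 0 := by
  induction P with
  | inputs => exact l.elim0
  | matmul P A' h ih =>
    induction l using Fin.lastCases with
    | last =>
      rw [mat_matmul_last] at hl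
      simp only [res, hl, if_true, hvec_matmul_last]
      exact deflate_mulVec_self (P.res_mul_self _ _) (P.res_transpose _ _) _
    | cast l =>
      rw [mat_matmul_castSucc] at hl
      have := ih (fun α => restrict (p α)) hl
      simp only [res, hvec_matmul_castSucc]
      split_ifs with hA
      · exact deflate_mulVec_eq_zero (P.res_transpose _ _) _ this
      · exact this

/-- The span of the vectors `h` used in instructions `g := A h`. -/
def hspan (P : Program ι κ m) (A : AVar κ) (p : Fin n → ι ⊕ Fin m → ℝ) :
    Submodule ℝ (Fin n → ℝ) :=
  Submodule.span ℝ {v | ∃ l, P.mat l = A ∧ P.hvec l p = v}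

lemma one_sub_res_eq_sum (P : Program ι κ m) (A : AVar κ) (p : Fin n → ι ⊕ Fin m → ℝ) :
    ∃ e : Fin m → Fin n → ℝ, 1 - P.res A p = ∑ i, Matrix.vecMulVec (e i) (e i) ∧
      ∀ i, e i ∈ P.hspan A p := by
  induction P with
  | inputs => exact ⟨0, by simp [res], fun i => i.elim0⟩
  | matmul P A' h ih =>
    obtain ⟨e, he, hs⟩ := ih fun α => restrict (p α)
    have hle : P.hspan A (fun α => restrict (p α)) ≤ (P.matmul A' h).hspan A p := by
      refine Submodule.span_mono ?_
      rintro v ⟨l, hl, rfl⟩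
      exact ⟨l.castSucc, by simpa using hl, by ext; simp [hvec]⟩
    by_cases hA : A' = A
    · set R := P.res A (fun α => restrict (p α)) with hR
      set hv : Fin n → ℝ := fun α => h.fn (restrict (p α)) with hhv
      refine ⟨Fin.lastCases (unitResidual R hv) e, ?_, fun i => ?_⟩
      · rw [Fin.sum_univ_castSucc]
        simp only [res, hA, if_true, Fin.lastCases_castSucc, Fin.lastCases_last, ← he, deflate,
          ← hR, ← hhv]
        abel
      · induction i using Fin.lastCases with
        | last =>
          simp only [Fin.lastCases_last]
          refine Submodule.smul_mem _ _ ?_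
          have h1 : R *ᵥ hv = hv - (1 - R) *ᵥ hv := by simp [Matrix.sub_mulVec]
          rw [h1]
          refine Submodule.sub_mem _ ?_ (hle ?_)
          · exact Submodule.subset_span ⟨Fin.last _, by simpa using hA, by ext; simp [hvec, hhv]⟩
          · rw [he, Matrix.sum_mulVec]
            refine Submodule.sum_mem _ fun i _ => ?_
            rw [vecMulVec_mulVec_eq_smul]
            exact Submodule.smul_mem _ _ (hs i)
        | cast i =>
          simp only [Fin.lastCases_castSucc]
          exact hle (hs i)
    · refine ⟨Fin.lastCases 0 e, ?_, fun i => ?_⟩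
      · rw [Fin.sum_univ_castSucc]
        simp only [res, hA, if_false, Fin.lastCases_castSucc, Fin.lastCases_last, he]
        simp
      · induction i using Fin.lastCases with
        | last => simp only [Fin.lastCases_last]; exact Submodule.zero_mem _
        | cast i => simp only [Fin.lastCases_castSucc]; exact hle (hs i)

lemma one_sub_res_mulVec_mem (P : Program ι κ m) (A : AVar κ) (p : Fin n → ι ⊕ Fin m → ℝ)
    (v : Fin n → ℝ) : (1 - P.res A p) *ᵥ v ∈ P.hspan A p := by
  obtain ⟨e, he, hs⟩ := P.one_sub_res_eq_sum A p
  rw [he, Matrix.sum_mulVec]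
  refine Submodule.sum_mem _ fun i _ => ?_
  rw [vecMulVec_mulVec_eq_smul]
  exact Submodule.smul_mem _ _ (hs i)

lemma measurable_res {P : Program ι κ m} (hP : P.PolyBounded) (A : AVar κ) (i j : Fin n) :
    Measurable fun p : Fin n → ι ⊕ Fin m → ℝ => P.res A p i j := by
  induction P generalizing i j with
  | inputs => simp only [res]; exact measurable_const
  | @matmul k P A' h ih =>
    have hr : Measurable fun (p : Fin n → ι ⊕ Fin (k + 1) → ℝ) (α : Fin n) => restrict (p α) :=
      measurable_pi_lambda _ fun α => measurable_restrict.comp (measurable_pi_apply α)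
    have ih' := fun i j => (ih hP.1 i j).comp hr
    simp only [Function.comp_def] at ih'
    by_cases hA : A' = A
    · simp only [res, hA, if_true, deflate, unitResidual, Matrix.sub_apply,
        Matrix.vecMulVec_apply, Pi.smul_apply, smul_eq_mul, Matrix.mulVec, dotProduct]
      have hh (α : Fin n) : Measurable fun p : Fin n → ι ⊕ Fin (k + 1) → ℝ =>
          h.fn (restrict (p α)) :=
        hP.2.measurable.comp (measurable_restrict.comp (measurable_pi_apply α))
      fun_prop
    · simpa only [res, hA, if_false] using ih' i j

end Program

/-! ### Resampling an input matrix conditionally on the G-vars -/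

/-- The matrix `V` or its transpose, according to the kind of the A-var. -/
def AVar.orient {n : ℕ} (A : AVar κ) (V : Fin n → Fin n → ℝ) : Matrix (Fin n) (Fin n) ℝ :=
  A.eval fun _ => Matrix.of V

namespace Program

variable {m n : ℕ}

/-- Replaces the part of the input matrix `w` that the program does not see by the corresponding
part of the matrix `V`. -/
def resample (P : Program ι κ m) (w : κ) (s : Inputs ι κ n) (V : Fin n → Fin n → ℝ) :
    Inputs ι κ n :=
  let p := P.gvars s
  open Classical in
  (Function.update s.1 w fun i j =>
    (Matrix.of (s.1 w) - P.res (.transpose w) p * Matrix.of (s.1 w) * P.res (.input w) p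
      + P.res (.transpose w) p * Matrix.of V * P.res (.input w) p) i j, s.2)

lemma eval_resample (P : Program ι κ m) (A : AVar κ) (s : Inputs ι κ n)
    (V : Fin n → Fin n → ℝ) :
    A.eval (fun W => Matrix.of ((P.resample A.base s V).1 W))
      = A.eval (fun W => Matrix.of (s.1 W))
        - P.res A.flip (P.gvars s) * A.eval (fun W => Matrix.of (s.1 W)) * P.res A (P.gvars s)
        + P.res A.flip (P.gvars s) * A.orient V * P.res A (P.gvars s) := by
  cases A with
  | input w =>
    simp only [AVar.eval, AVar.base, AVar.flip, resample, AVar.orient, Function.update_self]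
    rfl
  | transpose w =>
    simp only [AVar.eval, AVar.base, AVar.flip, resample, AVar.orient, Function.update_self]
    rw [show (Matrix.of fun i j => (Matrix.of (s.1 w)
        - P.res (.transpose w) (P.gvars s) * Matrix.of (s.1 w) * P.res (.input w) (P.gvars s)
        + P.res (.transpose w) (P.gvars s) * Matrix.of V * P.res (.input w) (P.gvars s)) i j)
      = Matrix.of (s.1 w)
        - P.res (.transpose w) (P.gvars s) * Matrix.of (s.1 w) * P.res (.input w) (P.gvars s)
        + P.res (.transpose w) (P.gvars s) * Matrix.of V * P.res (.input w) (P.gvars s) from rfl]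
    simp only [Matrix.transpose_add, Matrix.transpose_sub, Matrix.transpose_mul, P.res_transpose,
      Matrix.mul_assoc]

lemma eval_resample_of_ne (P : Program ι κ m) {w : κ} {A : AVar κ} (h : A.base ≠ w)
    (s : Inputs ι κ n) (V : Fin n → Fin n → ℝ) :
    A.eval (fun W => Matrix.of ((P.resample w s V).1 W)) = A.eval (fun W => Matrix.of (s.1 W)) := by
  cases A <;> simp_all [AVar.eval, AVar.base, resample]

lemma resample_fst_of_ne (P : Program ι κ m) {w w' : κ} (h : w' ≠ w) (s : Inputs ι κ n)
    (V : Fin n → Fin n → ℝ) : (P.resample w s V).1 w' = s.1 w' := by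
  simp [resample, h]

lemma inputs_ext (A : AVar κ) {s t : Inputs ι κ n}
    (h : A.eval (fun W => Matrix.of (s.1 W)) = A.eval (fun W => Matrix.of (t.1 W)))
    (h' : ∀ w' ≠ A.base, s.1 w' = t.1 w') (h2 : s.2 = t.2) : s = t := by
  refine Prod.ext (funext fun w' => ?_) h2
  by_cases hw : w' = A.base
  · subst hw
    have h3 : Matrix.of (s.1 A.base) = Matrix.of (t.1 A.base) := by
      cases A with
      | input w => exact h
      | transpose w => exact Matrix.transpose_injective h
    exact Matrix.of.injective h3
  · exact h' w' hw

lemma gvars_resample (P : Program ι κ m) (w : κ) (s : Inputs ι κ n) (V : Fin n → Fin n → ℝ) :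
    P.gvars (P.resample w s V) = P.gvars s := by
  refine P.eval_congr fun l => ?_
  by_cases h : (P.mat l).base = w
  · subst h
    have := P.res_mulVec_hvec (P.gvars s) (l := l) rfl
    change _ *ᵥ P.hvec l (P.gvars s) = _ *ᵥ P.hvec l (P.gvars s)
    simp only [eval_resample, Matrix.add_mulVec, Matrix.sub_mulVec, ← Matrix.mulVec_mulVec, this,
      Matrix.mulVec_zero, sub_zero, add_zero]
  · rw [P.eval_resample_of_ne h]

/-- The identity behind resampling twice. -/
lemma resample_identity {α : Type*} [Ring α] {M F R F' R' V V' : α} (hF : F' * F = F')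
    (hR : R * R' = R') :
    (M - F * M * R + F * V * R) - F' * (M - F * M * R + F * V * R) * R' + F' * V' * R'
      = M - F * M * R + F * V * R - F' * V * R' + F' * V' * R' := by
  have e (X : α) : F' * (F * X * R) * R' = F' * X * R' := by
    rw [mul_assoc F X R, ← mul_assoc F' F, hF, mul_assoc F' (X * R) R', mul_assoc X R R', hR,
      mul_assoc F' X R']
  rw [mul_add, mul_sub, add_mul, sub_mul, e, e]
  abel

lemma resample_resample (P : Program ι κ m) (w : κ) (s : Inputs ι κ n)
    (V V' : Fin n → Fin n → ℝ) :
    P.resample w (P.resample w s V) V' = P.resample w s V' := by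
  refine inputs_ext (.input w) ?_ (fun w' hw => ?_) rfl
  · have h (s V) := P.eval_resample (.input w) (n := n) s V
    rw [show (AVar.input w).base = w from rfl] at h
    rw [h, h, h, gvars_resample, resample_identity (P.res_mul_self _ _) (P.res_mul_self _ _)]
    abel
  · have hw : w' ≠ w := hw
    rw [P.resample_fst_of_ne hw, P.resample_fst_of_ne hw, P.resample_fst_of_ne hw]

end Program

/-- `V e eᵀ + V' (1 - e eᵀ)`, if `V` and `V'` are identified with their orientations. -/
def AVar.mix {n : ℕ} (e : Fin n → ℝ) :
    AVar κ → (Fin n → Fin n → ℝ) → (Fin n → Fin n → ℝ) → Fin n → Fin n → ℝ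
  | input _ => mixRows e
  | transpose _ => mixCols e

lemma AVar.orient_mix {n : ℕ} (e : Fin n → ℝ) (A : AVar κ) (V V' : Fin n → Fin n → ℝ) :
    A.orient (A.mix e V V') = A.orient V * Matrix.vecMulVec e e
      + A.orient V' * (1 - Matrix.vecMulVec e e) := by
  have h (V V' : Fin n → Fin n → ℝ) : Matrix.of (mixRows e V V')
      = Matrix.of V * Matrix.vecMulVec e e + Matrix.of V' * (1 - Matrix.vecMulVec e e) := by
    have h1 : (1 - Matrix.vecMulVec e e)ᵀ = 1 - Matrix.vecMulVec e e := by
      simp [Matrix.transpose_vecMulVec]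
    ext i j
    rw [Matrix.add_apply, Matrix.mul_apply_eq_vecMul, Matrix.mul_apply_eq_vecMul,
      ← Matrix.mulVec_transpose, ← Matrix.mulVec_transpose, h1, Matrix.transpose_vecMulVec]
    rfl
  cases A with
  | input w => exact h V V'
  | transpose w =>
    have := h (fun i j => V j i) (fun i j => V' j i)
    simp only [AVar.orient, AVar.mix, AVar.eval]
    exact this

lemma Program.measurable_resample {m : ℕ} {P : Program ι κ m} (hP : P.PolyBounded) (n : ℕ)
    (w : κ) : Measurable fun p : Inputs ι κ n × (Fin n → Fin n → ℝ) => P.resample w p.1 p.2 := by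
  classical
  refine Measurable.prodMk (measurable_pi_lambda _ fun w' => ?_) (by fun_prop)
  by_cases hw : w' = w
  · subst hw
    simp only [Function.update_self]
    refine measurable_pi_lambda _ fun i => measurable_pi_lambda _ fun j => ?_
    have hR (A : AVar κ) (i j : Fin n) : Measurable
        fun p : Inputs ι κ n × (Fin n → Fin n → ℝ) => P.res A (P.gvars p.1) i j :=
      (Program.measurable_res hP A i j).comp
        ((Program.measurable_gvars hP n).comp measurable_fst)
    simp only [Matrix.add_apply, Matrix.sub_apply, Matrix.mul_apply, Matrix.of_apply]
    fun_prop
  · simp only [Function.update_of_ne hw]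
    fun_prop

section Law

variable [Fintype ι] [DecidableEq ι] [Fintype κ]

lemma measurePreserving_update (σ : κ → ℝ≥0) (μ : ι → ℝ) (S : Matrix ι ι ℝ) (n : ℕ) (w : κ) :
    MeasurePreserving (fun p : Inputs ι κ n × (Fin n → Fin n → ℝ) =>
      ((open Classical in Function.update p.1.1 w p.2, p.1.2) : Inputs ι κ n))
      ((inputLaw σ μ S n).prod (gaussianMatrix n (σ w ^ 2 / n))) (inputLaw σ μ S n) := by
  classical
  set ρ : κ → Measure (Fin n → Fin n → ℝ) := fun W => gaussianMatrix n (σ W ^ 2 / n) with hρ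
  have h1 : MeasurePreserving (fun p : (κ → Fin n → Fin n → ℝ) × (Fin n → Fin n → ℝ) =>
      Function.update p.1 w p.2) ((Measure.pi ρ).prod (ρ w)) (Measure.pi ρ) := by
    have hm : Measurable (fun p : (κ → Fin n → Fin n → ℝ) × (Fin n → Fin n → ℝ) =>
        Function.update p.1 w p.2) := by
      refine measurable_pi_lambda _ fun w' => ?_
      by_cases hw : w' = w
      · subst hw; simp only [Function.update_self]; fun_prop
      · simp only [Function.update_of_ne hw]; fun_prop
    refine ⟨hm, (Measure.pi_eq fun s hs => ?_).symm⟩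
    rw [Measure.map_apply hm (MeasurableSet.univ_pi hs)]
    have : (fun p : (κ → Fin n → Fin n → ℝ) × (Fin n → Fin n → ℝ) =>
        Function.update p.1 w p.2) ⁻¹' (Set.univ.pi s)
        = (Set.univ.pi (Function.update s w Set.univ)) ×ˢ s w := by
      ext ⟨M, V⟩
      simp only [Set.mem_preimage, Set.mem_univ_pi, Set.mem_prod]
      constructor
      · intro h
        refine ⟨fun i => ?_, by simpa using h w⟩
        by_cases hi : i = w
        · subst hi; simp
        · simpa [hi] using h i
      · rintro ⟨h, hV⟩ i
        by_cases hi : i = w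
        · subst hi; simpa using hV
        · simpa [hi] using h i
    rw [this, Measure.prod_prod, Measure.pi_pi, ← Finset.prod_erase_mul _ _ (Finset.mem_univ w),
      ← Finset.prod_erase_mul Finset.univ (fun i => ρ i (s i)) (Finset.mem_univ w)]
    simp only [Function.update_self, measure_univ, mul_one]
    congr 1
    refine Finset.prod_congr rfl fun i hi => ?_
    rw [Function.update_of_ne (Finset.ne_of_mem_erase hi)]
  set ρ' : Measure (Fin n → ι → ℝ) := Measure.pi fun _ : Fin n => gaussianVec μ S with hρ'
  have h2 := h1.prod (MeasurePreserving.id ρ')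
  have h3 : MeasurePreserving (fun p : ((κ → Fin n → Fin n → ℝ) × (Fin n → ι → ℝ)) ×
      (Fin n → Fin n → ℝ) => ((p.1.1, p.2), p.1.2)) (((Measure.pi ρ).prod ρ').prod (ρ w))
      (((Measure.pi ρ).prod (ρ w)).prod ρ') := by
    have a1 : MeasurePreserving MeasurableEquiv.prodAssoc (((Measure.pi ρ).prod ρ').prod (ρ w))
      ((Measure.pi ρ).prod (ρ'.prod (ρ w))) := measurePreserving_prodAssoc _ _ _
    have a2 := (MeasurePreserving.id (Measure.pi ρ)).prod
      (Measure.measurePreserving_swap (μ := ρ') (ν := ρ w))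
    have a3 : MeasurePreserving MeasurableEquiv.prodAssoc (((Measure.pi ρ).prod (ρ w)).prod ρ')
      ((Measure.pi ρ).prod ((ρ w).prod ρ')) := measurePreserving_prodAssoc _ _ _
    exact a3.symm.comp (a2.comp a1)
  exact h2.comp h3

/-- Resampling the part of an input matrix that the program does not see preserves the law of the
inputs. -/
theorem Program.measurePreserving_resample (σ : κ → ℝ≥0) (μ : ι → ℝ) (S : Matrix ι ι ℝ)
    {m : ℕ} {P : Program ι κ m} (hP : P.PolyBounded) (n : ℕ) (w : κ) :
    MeasurePreserving (fun p : Inputs ι κ n × (Fin n → Fin n → ℝ) => P.resample w p.1 p.2)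
      ((inputLaw σ μ S n).prod (gaussianMatrix n (σ w ^ 2 / n))) (inputLaw σ μ S n) := by
  induction P with
  | inputs =>
    convert measurePreserving_update σ μ S n w using 2 with p
    simp [resample, res]
  | @matmul m P A h ih =>
    have ih := ih hP.1
    have hg (s : Inputs ι κ n) :
        (fun α => restrict ((P.matmul A h).gvars s α)) = P.gvars s := restrict_eval_matmul ..
    by_cases hw : A.base = w
    swap
    · convert ih using 2 with p
      have h1 : A ≠ .input w := by rintro rfl; exact hw rfl
      have h2 : A ≠ .transpose w := by rintro rfl; exact hw rfl
      simp only [resample, res, h1, h2, if_false, hg]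
    subst hw
    set γ := gaussianMatrix n (σ A.base ^ 2 / n) with hγ
    set e : Inputs ι κ n → Fin n → ℝ := fun s =>
      unitResidual (P.res A (P.gvars s)) fun α => h.fn (P.gvars s α) with he
    have hem (i : Fin n) : Measurable fun s => e s i := by
      have hR (i j : Fin n) : Measurable fun s : Inputs ι κ n => P.res A (P.gvars s) i j :=
        (measurable_res hP.1 A i j).comp (measurable_gvars hP.1 n)
      have hh (α : Fin n) : Measurable fun s : Inputs ι κ n => h.fn (P.gvars s α) :=
        hP.2.measurable.comp ((measurable_pi_apply α).comp (measurable_gvars hP.1 n))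
      simp only [he, unitResidual, Pi.smul_apply, smul_eq_mul, Matrix.mulVec, dotProduct]
      fun_prop
    have he1 (s : Inputs ι κ n) : e s ⬝ᵥ e s = 1 ∨ e s = 0 := unitResidual_dotProduct_self _ _
    have hmixm : Measurable fun p : Inputs ι κ n × (Fin n → Fin n → ℝ) × (Fin n → Fin n → ℝ) =>
        A.mix (e p.1) p.2.1 p.2.2 := by
      refine measurable_pi_lambda _ fun i => measurable_pi_lambda _ fun j => ?_
      cases A <;>
      · simp only [AVar.mix, mixRows, mixCols, Matrix.mulVec, dotProduct, Pi.add_apply,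
          Matrix.vecMulVec_apply, Matrix.sub_apply]
        fun_prop
    have hmp (s : Inputs ι κ n) : MeasurePreserving
        (fun p : (Fin n → Fin n → ℝ) × (Fin n → Fin n → ℝ) => A.mix (e s) p.1 p.2)
        (γ.prod γ) γ := by
      cases A
      · exact measurePreserving_mixRows _ (he1 s)
      · exact measurePreserving_mixCols _ (he1 s)
    have key (s : Inputs ι κ n) (V V' : Fin n → Fin n → ℝ) :
        (P.matmul A h).resample A.base (P.resample A.base s V) V'
          = P.resample A.base s (A.mix (e s) V V') := by
      refine inputs_ext A ?_ (fun w' hw => ?_) rfl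
      · have hgv : (fun α => restrict ((P.matmul A h).gvars (P.resample A.base s V) α))
            = P.gvars s := by rw [hg, gvars_resample]
        have hRR := P.res_mul_self A (P.gvars s)
        have hE : P.res A (P.gvars s) * Matrix.vecMulVec (e s) (e s)
            = Matrix.vecMulVec (e s) (e s) := mul_vecMulVec_unitResidual hRR _
        have hE' : Matrix.vecMulVec (e s) (e s) * P.res A (P.gvars s)
            = Matrix.vecMulVec (e s) (e s) :=
          vecMulVec_unitResidual_mul_right hRR (P.res_transpose _ _) _
        have h1 : (P.matmul A h).res A.flip ((P.matmul A h).gvars (P.resample A.base s V))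
            = P.res A.flip (P.gvars s) := by
          simp only [res, A.flip_ne.symm, if_false, hgv]
        have h2 : (P.matmul A h).res A ((P.matmul A h).gvars (P.resample A.base s V))
            = P.res A (P.gvars s) - Matrix.vecMulVec (e s) (e s) := by
          simp only [res, if_true, hgv, deflate, he]
          congr 1
          congr 1 <;> congr 1 <;> funext α <;> rw [congrFun hgv α]
        rw [eval_resample, eval_resample, eval_resample, h1, h2, AVar.orient_mix,
          resample_identity (P.res_mul_self _ _) (by rw [Matrix.mul_sub, hRR, hE])]
        simp only [Matrix.mul_sub, Matrix.mul_add, Matrix.add_mul, Matrix.sub_mul,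
          Matrix.mul_assoc, Matrix.mul_one, hE']
        abel
      · rw [resample_fst_of_ne _ hw, resample_fst_of_ne _ hw, resample_fst_of_ne _ hw]
    have hmp1 : MeasurePreserving (fun p : Inputs ι κ n × (Fin n → Fin n → ℝ) ×
        (Fin n → Fin n → ℝ) => (P.resample A.base p.1 p.2.1, p.2.2))
        ((inputLaw σ μ S n).prod (γ.prod γ)) ((inputLaw σ μ S n).prod γ) := by
      have a1 : MeasurePreserving MeasurableEquiv.prodAssoc
        (((inputLaw σ μ S n).prod γ).prod γ) ((inputLaw σ μ S n).prod (γ.prod γ)) :=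
          measurePreserving_prodAssoc _ _ _
      exact (ih.prod (MeasurePreserving.id γ)).comp a1.symm
    have hmp2 : MeasurePreserving (fun p : Inputs ι κ n × (Fin n → Fin n → ℝ) ×
        (Fin n → Fin n → ℝ) => ((p.1, A.mix (e p.1) p.2.1 p.2.2) : Inputs ι κ n × (Fin n → Fin n → ℝ)))
        ((inputLaw σ μ S n).prod (γ.prod γ)) ((inputLaw σ μ S n).prod γ) :=
      (MeasurePreserving.id _).skew_product (g := fun s (p : (Fin n → Fin n → ℝ) × (Fin n → Fin n → ℝ)) => A.mix (e s) p.1 p.2) hmixm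
        (ae_of_all _ fun s => (hmp s).map_eq)
    have hΨ := measurable_resample hP n A.base
    refine ⟨hΨ, ?_⟩
    rw [← hmp1.map_eq, Measure.map_map hΨ hmp1.measurable]
    refine Eq.trans ?_ (ih.comp hmp2).map_eq
    congr 1
    funext p
    exact key _ _ _

end Law

/-! ### The limiting law of the newest G-var -/

/-- Orthogonal projection onto the span of finitely many square integrable functions. -/
lemma exists_orthogonal_residual {E : Type*} [MeasurableSpace E] {ν : Measure E} {K : Type*}
    [Fintype K] {f : K → E → ℝ} (hf : ∀ k, MemLp (f k) 2 ν) {φ : E → ℝ} (hφ : MemLp φ 2 ν) :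
    ∃ c : K → ℝ, ∀ l, ∫ x, (φ x - ∑ k, c k * f k x) * f l x ∂ν = 0 := by
  set U : Submodule ℝ (Lp ℝ 2 ν) := Submodule.span ℝ (Set.range fun k => (hf k).toLp) with hU
  have : FiniteDimensional ℝ U := FiniteDimensional.span_of_finite ℝ (Set.finite_range _)
  have h1 : U.starProjection hφ.toLp ∈ U := U.starProjection_apply_mem _
  obtain ⟨c, hc⟩ := (Submodule.mem_span_range_iff_exists_fun ℝ).1 h1
  refine ⟨c, fun l => ?_⟩
  have h2 := U.sub_starProjection_mem_orthogonal hφ.toLp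
  have h3 := (Submodule.mem_orthogonal' U _).1 h2 ((hf l).toLp) (Submodule.subset_span ⟨l, rfl⟩)
  rw [← hc, L2.inner_def] at h3
  rw [← h3]
  refine integral_congr_ae ?_
  have h4 : ∀ᵐ x ∂ν, ∀ k, ((hf k).toLp (f k) : E → ℝ) x = f k x := ae_all_iff.2 fun k => (hf k).coeFn_toLp
  have h5 : ((∑ k, c k • (hf k).toLp : Lp ℝ 2 ν) : E → ℝ) =ᵐ[ν]
      ∑ k, ((c k • (hf k).toLp : Lp ℝ 2 ν) : E → ℝ) := by
    have : ∀ s : Finset K, ((∑ k ∈ s, c k • (hf k).toLp : Lp ℝ 2 ν) : E → ℝ) =ᵐ[ν]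
        ∑ k ∈ s, ((c k • (hf k).toLp : Lp ℝ 2 ν) : E → ℝ) := by
      classical
      intro s
      induction s using Finset.induction_on with
      | empty => simpa using Lp.coeFn_zero ℝ 2 ν
      | insert i s hi ih =>
        rw [Finset.sum_insert hi, Finset.sum_insert hi]
        exact (Lp.coeFn_add _ _).trans (ih.mono fun x hx => by rw [Pi.add_apply, Pi.add_apply, hx])
    exact this Finset.univ
  have h6 : ∀ᵐ x ∂ν, ∀ k, (c k • (hf k).toLp : Lp ℝ 2 ν) x = c k * ((hf k).toLp (f k) : E → ℝ) x :=
    ae_all_iff.2 fun k => (Lp.coeFn_smul (c k) _).mono fun x hx => hx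
  filter_upwards [h4, h5, h6, hφ.coeFn_toLp, Lp.coeFn_sub hφ.toLp (∑ k, c k • (hf k).toLp)]
    with x h4 h5 h6 h7 h8
  rw [h8]
  simp only [Pi.sub_apply, h5, Finset.sum_apply, h6, h4, h7]
  simp [mul_comm]

section

variable {E : Type*} [NormedAddCommGroup E] [NormedSpace ℝ E] [CompleteSpace E]
  [SecondCountableTopology E] [MeasurableSpace E] [BorelSpace E]

lemma PolyBd.memLp_two {f : E → ℝ} (hf : PolyBd f) (hm : Measurable f) (ν : Measure E)
    [IsGaussian ν] : MemLp f 2 ν :=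
  (memLp_two_iff_integrable_sq hm.aestronglyMeasurable).2
    ((hf.pow 2).integrable (hm.pow_const 2) ν)

end

namespace Program

variable {m : ℕ}

/-- The part of the H-var `h` that is orthogonal to the H-vars multiplied by `A` earlier: `b` are
the coefficients of the orthogonal projection with respect to `ν`. -/
structure IsResidual [Fintype ι] (P : Program ι κ m) (A : AVar κ) (h : HVar (ι ⊕ Fin m))
    (ν : Measure (ι ⊕ Fin m → ℝ)) (b : Fin m → ℝ) : Prop where
  eq_zero : ∀ l, P.mat l ≠ A → b l = 0
  orthogonal : ∀ l, P.mat l = A → ∫ z, (h.fn z - ∑ k, b k * P.hfn k z) * P.hfn l z ∂ν = 0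

/-- The residual of an H-var, a function of the previous G-vars. -/
def residual (P : Program ι κ m) (h : HVar (ι ⊕ Fin m)) (b : Fin m → ℝ)
    (z : ι ⊕ Fin m → ℝ) : ℝ :=
  h.fn z - ∑ k, b k * P.hfn k z

lemma exists_isResidual [Fintype ι] {P : Program ι κ m} (hP : P.PolyBounded) (A : AVar κ)
    {h : HVar (ι ⊕ Fin m)} (hh : h.PolyBounded) (ν : Measure (ι ⊕ Fin m → ℝ)) [IsGaussian ν] :
    ∃ b, P.IsResidual A h ν b := by
  classical
  have hL (l : Fin m) : MemLp (fun z => if P.mat l = A then P.hfn l z else 0) 2 ν := by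
    split_ifs
    · exact (polyBd_hfn hP l).memLp_two (measurable_hfn hP l) ν
    · exact MemLp.zero
  obtain ⟨c, hc⟩ := exists_orthogonal_residual hL (hh.polyBd.memLp_two hh.measurable ν)
  refine ⟨fun l => if P.mat l = A then c l else 0, fun l hl => by simp [hl], fun l hl => ?_⟩
  have := hc l
  simpa [hl, ite_mul, mul_ite] using this

lemma measurable_residual {P : Program ι κ m} (hP : P.PolyBounded)
    {h : HVar (ι ⊕ Fin m)} (hh : h.PolyBounded) (b : Fin m → ℝ) :
    Measurable (P.residual h b) :=
  hh.measurable.sub (Finset.measurable_sum _ fun k _ => (measurable_hfn hP k).const_mul _)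

lemma polyBd_residual [Fintype ι] {P : Program ι κ m} (hP : P.PolyBounded)
    {h : HVar (ι ⊕ Fin m)} (hh : h.PolyBounded) (b : Fin m → ℝ) :
    PolyBd (P.residual h b) :=
  hh.polyBd.sub (PolyBd.sum _ fun k _ => (polyBd_hfn hP k).const_mul _)

end Program

section Limit

variable [Fintype ι] [DecidableEq ι] (σ : κ → ℝ≥0) (μ : ι → ℝ) (S : Matrix ι ι ℝ)

/-- The limiting law of the G-vars. -/
abbrev Program.limitLaw {m : ℕ} (P : Program ι κ m) : Measure (ι ⊕ Fin m → ℝ) :=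
  gaussianVec (limitMean μ m) (P.limitCov σ μ S)

/-- The limiting standard deviation of the newest G-var, conditionally on the previous ones. -/
def Program.limitStd {m : ℕ} (P : Program ι κ m) (A : AVar κ) (h : HVar (ι ⊕ Fin m))
    (b : Fin m → ℝ) : ℝ≥0 :=
  .mk (√((σ A.base : ℝ) ^ 2 * ∫ z, P.residual h b z ^ 2 ∂(P.limitLaw σ μ S))) (Real.sqrt_nonneg _)

/-- The matrix of `z ↦ extend z (∑ b l * z l)`. -/
def extendMatrix {m : ℕ} (b : Fin m → ℝ) : Matrix (ι ⊕ Fin (m + 1)) (ι ⊕ Fin m) ℝ :=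
  Matrix.of fun g g'' =>
    match previous? g with
    | some g' => if g' = g'' then 1 else 0
    | none => Sum.elim (fun _ => 0) b g''

lemma extendMatrix_mulVec {m : ℕ} (b : Fin m → ℝ) (z : ι ⊕ Fin m → ℝ) :
    extendMatrix b *ᵥ z = extend z (∑ l, b l * z (Sum.inr l)) := by
  funext g
  simp only [Matrix.mulVec, dotProduct, extendMatrix, Matrix.of_apply, extend]
  cases previous? g with
  | none => simp [Fintype.sum_sum_type]
  | some g' => simp

/-- The entries of the limiting covariance, as expectations under the limiting law itself. -/
structure Program.CovSpec {m : ℕ} (P : Program ι κ m) : Prop where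
  posSemidef : (P.limitCov σ μ S).PosSemidef
  inl_inr : ∀ i l, P.limitCov σ μ S (Sum.inl i) (Sum.inr l) = 0
  inr_inr_eq : ∀ k l, P.mat k = P.mat l → P.limitCov σ μ S (Sum.inr k) (Sum.inr l)
    = (σ (P.mat k).base : ℝ) ^ 2 * ∫ z, P.hfn k z * P.hfn l z ∂(P.limitLaw σ μ S)
  inr_inr_ne : ∀ k l, P.mat k ≠ P.mat l → P.limitCov σ μ S (Sum.inr k) (Sum.inr l) = 0

section Step

variable {σ μ S} {m : ℕ} {P : Program ι κ m} {A : AVar κ} {h : HVar (ι ⊕ Fin m)} {b : Fin m → ℝ}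

lemma Program.CovSpec.sum_cross (H : P.CovSpec σ μ S) (hP : P.PolyBounded) (hh : h.PolyBounded)
    (hb : P.IsResidual A h (P.limitLaw σ μ S) b) {k : Fin m} (hk : P.mat k = A) :
    ∑ l, b l * P.limitCov σ μ S (Sum.inr k) (Sum.inr l)
      = (σ A.base : ℝ) ^ 2 * ∫ z, h.fn z * P.hfn k z ∂(P.limitLaw σ μ S) := by
  have h1 (l : Fin m) : b l * P.limitCov σ μ S (Sum.inr k) (Sum.inr l)
      = (σ A.base : ℝ) ^ 2 * ∫ z, b l * P.hfn l z * P.hfn k z ∂(P.limitLaw σ μ S) := by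
    by_cases hl : P.mat l = A
    · rw [H.inr_inr_eq k l (hk.trans hl.symm), hk]
      simp only [mul_assoc]
      rw [integral_const_mul, mul_left_comm]
      simp only [mul_comm (P.hfn k _)]
    · simp [hb.eq_zero l hl]
  have hi (l : Fin m) : Integrable (fun z => b l * P.hfn l z * P.hfn k z) (P.limitLaw σ μ S) :=
    (((polyBd_hfn hP l).const_mul _).mul (polyBd_hfn hP k)).integrable
      (((measurable_hfn hP l).const_mul _).mul (measurable_hfn hP k)) _
  rw [Finset.sum_congr rfl fun l _ => h1 l, ← Finset.mul_sum, ← integral_finsetSum _ fun l _ => hi l]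
  congr 1
  have h2 := hb.orthogonal k hk
  simp only [sub_mul] at h2
  rw [integral_sub] at h2
  · rw [sub_eq_zero.1 h2]
    simp only [Finset.sum_mul]
  · exact (hh.polyBd.mul (polyBd_hfn hP k)).integrable (hh.measurable.mul (measurable_hfn hP k)) _
  · simp only [Finset.sum_mul]
    exact integrable_finsetSum _ fun l _ => hi l

lemma Program.CovSpec.sum_cross_ne (H : P.CovSpec σ μ S)
    (hb : P.IsResidual A h (P.limitLaw σ μ S) b) {k : Fin m} (hk : P.mat k ≠ A) :
    ∑ l, b l * P.limitCov σ μ S (Sum.inr k) (Sum.inr l) = 0 := by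
  refine Finset.sum_eq_zero fun l _ => ?_
  by_cases hl : P.mat l = A
  · rw [H.inr_inr_ne k l fun h => hk (h.trans hl), mul_zero]
  · rw [hb.eq_zero l hl, zero_mul]

lemma Program.IsResidual.integral_sq (hP : P.PolyBounded) (hh : h.PolyBounded)
    (hb : P.IsResidual A h (P.limitLaw σ μ S) b) :
    ∫ z, P.residual h b z ^ 2 ∂(P.limitLaw σ μ S)
      = ∫ z, h.fn z * h.fn z ∂(P.limitLaw σ μ S)
        - ∑ k, b k * ∫ z, h.fn z * P.hfn k z ∂(P.limitLaw σ μ S) := by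
  set ν := P.limitLaw σ μ S
  have hr := polyBd_residual hP hh b
  have hrm := measurable_residual hP hh b
  have h1 : ∀ k, b k * ∫ z, P.residual h b z * P.hfn k z ∂ν = 0 := fun k => by
    by_cases hk : P.mat k = A
    · rw [show ∫ z, P.residual h b z * P.hfn k z ∂ν = 0 from hb.orthogonal k hk, mul_zero]
    · rw [hb.eq_zero k hk, zero_mul]
  have hi (k : Fin m) : Integrable (fun z => b k * (P.residual h b z * P.hfn k z)) ν :=
    ((hr.mul (polyBd_hfn hP k)).integrable (hrm.mul (measurable_hfn hP k)) _).const_mul _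
  have hi' (k : Fin m) : Integrable (fun z => b k * (h.fn z * P.hfn k z)) ν :=
    ((hh.polyBd.mul (polyBd_hfn hP k)).integrable
      (hh.measurable.mul (measurable_hfn hP k)) _).const_mul _
  have hj : Integrable (fun z => P.residual h b z * h.fn z) ν :=
    (hr.mul hh.polyBd).integrable (hrm.mul hh.measurable) _
  have hj' : Integrable (fun z => h.fn z * h.fn z) ν :=
    (hh.polyBd.mul hh.polyBd).integrable (hh.measurable.mul hh.measurable) _
  calc ∫ z, P.residual h b z ^ 2 ∂ν
      = ∫ z, (P.residual h b z * h.fn z - ∑ k, b k * (P.residual h b z * P.hfn k z)) ∂ν := by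
        congr 1; funext z
        have : ∑ k, b k * (P.residual h b z * P.hfn k z)
            = P.residual h b z * ∑ k, b k * P.hfn k z := by
          rw [Finset.mul_sum]; exact Finset.sum_congr rfl fun k _ => by ring
        rw [this, ← mul_sub, sq]; rfl
    _ = ∫ z, P.residual h b z * h.fn z ∂ν := by
        rw [integral_sub hj (integrable_finsetSum _ fun k _ => hi k),
          integral_finsetSum _ fun k _ => hi k]
        simp only [integral_const_mul, h1, Finset.sum_const_zero, sub_zero]
    _ = ∫ z, (h.fn z * h.fn z - ∑ k, b k * (h.fn z * P.hfn k z)) ∂ν := by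
        congr 1; funext z
        simp only [residual, sub_mul, Finset.sum_mul]
        congr 1
        exact Finset.sum_congr rfl fun k _ => by ring
    _ = _ := by
        rw [integral_sub hj' (integrable_finsetSum _ fun k _ => hi' k),
          integral_finsetSum _ fun k _ => hi' k]
        simp only [integral_const_mul]

lemma Program.limitStd_sq (σ : κ → ℝ≥0) (μ : ι → ℝ) (S : Matrix ι ι ℝ) (P : Program ι κ m)
    (A : AVar κ) (h : HVar (ι ⊕ Fin m)) (b : Fin m → ℝ) :
    (P.limitStd σ μ S A h b : ℝ) ^ 2
      = (σ A.base : ℝ) ^ 2 * ∫ z, P.residual h b z ^ 2 ∂(P.limitLaw σ μ S) :=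
  Real.sq_sqrt (mul_nonneg (sq_nonneg _) (integral_nonneg fun _ => sq_nonneg _))

lemma Program.CovSpec.limitCov_matmul (H : P.CovSpec σ μ S) (hP : P.PolyBounded)
    (hh : h.PolyBounded) (hb : P.IsResidual A h (P.limitLaw σ μ S) b) :
    (P.matmul A h).limitCov σ μ S
      = (extendMatrix (ι := ι) b * P.limitCov σ μ S : Matrix _ _ ℝ) * (extendMatrix (ι := ι) b)ᵀ
        + ((P.limitStd σ μ S A h b ^ 2 : ℝ≥0) : ℝ) • Matrix.vecMulVec (extend 0 1) (extend 0 1) := by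
  have hsymm (g g' : ι ⊕ Fin m) : P.limitCov σ μ S g g' = P.limitCov σ μ S g' g := by
    simpa using (H.posSemidef.isHermitian.apply g g').symm
  have hJ (g g' : ι ⊕ Fin (m + 1)) :
      ((extendMatrix (ι := ι) b * P.limitCov σ μ S : Matrix _ _ ℝ) * (extendMatrix (ι := ι) b)ᵀ) g g'
        = extend (fun i => extend (fun j => P.limitCov σ μ S i j)
              (∑ l, b l * P.limitCov σ μ S i (Sum.inr l)) g')
            (∑ k, b k * extend (fun j => P.limitCov σ μ S (Sum.inr k) j)
              (∑ l, b l * P.limitCov σ μ S (Sum.inr k) (Sum.inr l)) g') g := by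
    rw [← extendMatrix_mulVec, Matrix.mul_assoc, Matrix.mul_apply, Matrix.mulVec, dotProduct]
    refine Finset.sum_congr rfl fun i _ => ?_
    congr 1
    rw [← extendMatrix_mulVec, Matrix.mul_apply, Matrix.mulVec, dotProduct]
    exact Finset.sum_congr rfl fun j _ => by rw [Matrix.transpose_apply, mul_comm]
  have hcross (i : ι ⊕ Fin m) : ∑ l, b l * P.limitCov σ μ S i (Sum.inr l)
      = Sum.elim (fun _ => (0 : ℝ)) (fun l => open Classical in
        if P.mat l = A then (σ A.base : ℝ) ^ 2 * ∫ z, h.fn z * P.hfn l z ∂(P.limitLaw σ μ S)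
        else 0) i := by
    rcases i with i | k
    · simp [H.inl_inr]
    · rw [Sum.elim_inr]
      split_ifs with hk
      · exact H.sum_cross hP hh hb hk
      · exact H.sum_cross_ne hb hk
  ext g g'
  rw [Matrix.add_apply, hJ, Matrix.smul_apply, Matrix.vecMulVec_apply]
  simp only [limitCov, Matrix.of_apply, extend]
  cases hg : previous? g with
  | some i =>
    cases hg' : previous? g' with
    | some j => simp
    | none => simp [hcross]
  | none =>
    cases hg' : previous? g' with
    | some j =>
      simp only [hsymm _ j]
      rw [hcross]
      simp
    | none =>
      have : ∀ k, b k * ∑ l, b l * P.limitCov σ μ S (Sum.inr k) (Sum.inr l)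
          = (σ A.base : ℝ) ^ 2 * (b k * ∫ z, h.fn z * P.hfn k z ∂(P.limitLaw σ μ S)) := fun k => by
        by_cases hk : P.mat k = A
        · rw [H.sum_cross hP hh hb hk]; ring
        · rw [hb.eq_zero k hk]; simp
      simp only [this, ← Finset.mul_sum]
      rw [NNReal.coe_pow, P.limitStd_sq, hb.integral_sq hP hh]
      simp only [smul_eq_mul, mul_one]
      ring

lemma Program.CovSpec.limitLaw_matmul (H : P.CovSpec σ μ S) (hP : P.PolyBounded)
    (hh : h.PolyBounded) (hb : P.IsResidual A h (P.limitLaw σ μ S) b) :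
    (P.matmul A h).limitLaw σ μ S
      = ((P.limitLaw σ μ S).prod (gaussianReal 0 1)).map fun p =>
        extend p.1 (∑ l, b l * p.1 (Sum.inr l) + P.limitStd σ μ S A h b * p.2) := by
  set c := P.limitStd σ μ S A h b
  have hm : limitMean μ (m + 1) = extendMatrix b *ᵥ limitMean μ m := by
    rw [extendMatrix_mulVec]
    funext g
    rcases g with i | l
    · simp [limitMean]
    · induction l using Fin.lastCases <;> simp [limitMean]
  have hJ : ((extendMatrix (ι := ι) b * P.limitCov σ μ S : Matrix _ _ ℝ) * (extendMatrix (ι := ι) b)ᵀ).PosSemidef := by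
    simpa using H.posSemidef.mul_mul_conjTranspose_same (extendMatrix (ι := ι) b)
  have hc : gaussianReal 0 (c ^ 2) = (gaussianReal 0 1).map fun t => (c : ℝ) * t := by
    rw [gaussianReal_map_const_mul]
    congr 1
    · simp
    · ext; simp
  rw [limitLaw, H.limitCov_matmul hP hh hb, hm, gaussianVec_add_vecMulVec _ _ hJ,
    ← gaussianVec_map_mulVec _ H.posSemidef, hc,
    Measure.map_prod_map _ _ (measurable_mulVec _) (by fun_prop), Measure.map_map]
  · congr 1
    funext p
    simp only [Function.comp_apply, Prod.map, extendMatrix_mulVec]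
    funext g
    rcases g with i | l
    · simp
    · induction l using Fin.lastCases <;> simp [c]
  · fun_prop
  · exact (measurable_mulVec _).prodMap (by fun_prop)

lemma Program.CovSpec.limitLaw_map_restrict (H : P.CovSpec σ μ S) (hP : P.PolyBounded)
    (hh : h.PolyBounded) :
    ((P.matmul A h).limitLaw σ μ S).map restrict = P.limitLaw σ μ S := by
  obtain ⟨b, hb⟩ := P.exists_isResidual hP A hh (P.limitLaw σ μ S)
  rw [H.limitLaw_matmul hP hh hb, Measure.map_map measurable_restrict]
  · simp only [Function.comp_def, restrict_extend]
    exact measurePreserving_fst.map_eq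
  · have : Measurable fun p : (ι ⊕ Fin m → ℝ) × ℝ =>
        ∑ l, b l * p.1 (Sum.inr l) + P.limitStd σ μ S A h b * p.2 := by fun_prop
    exact measurable_extend.comp (measurable_fst.prodMk this)

end Step

lemma Program.covSpec {S : Matrix ι ι ℝ} (hS : S.PosSemidef) {m : ℕ} {P : Program ι κ m}
    (hP : P.PolyBounded) : P.CovSpec σ μ S := by
  induction P with
  | inputs =>
    refine ⟨?_, fun i l => l.elim0, fun k => k.elim0, fun k => k.elim0⟩
    have : (inputs : Program ι κ 0).limitCov σ μ S
        = S.submatrix (Equiv.sumEmpty ι (Fin 0)) (Equiv.sumEmpty ι (Fin 0)) := by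
      ext g g'
      rcases g with i | l
      · rcases g' with j | l
        · simp [limitCov]
        · exact l.elim0
      · exact l.elim0
    rw [this]
    exact hS.submatrix _
  | @matmul m P A h ih =>
    obtain ⟨hP, hh⟩ := hP
    have H := ih hP
    obtain ⟨b, hb⟩ := P.exists_isResidual hP A hh (P.limitLaw σ μ S)
    have hpsd : ((P.matmul A h).limitCov σ μ S).PosSemidef := by
      rw [H.limitCov_matmul hP hh hb]
      refine Matrix.PosSemidef.add ?_ (Matrix.PosSemidef.smul ?_ (NNReal.coe_nonneg _))
      · simpa using H.posSemidef.mul_mul_conjTranspose_same (extendMatrix (ι := ι) b)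
      · simpa using Matrix.posSemidef_vecMulVec_self_star (extend (0 : ι ⊕ Fin m → ℝ) 1)
    have hsymm (g g') : (P.matmul A h).limitCov σ μ S g g'
        = (P.matmul A h).limitCov σ μ S g' g := by
      simpa using (hpsd.isHermitian.apply g g').symm
    have hint {f : (ι ⊕ Fin m → ℝ) → ℝ} (hf : Measurable f) :
        ∫ z, f (restrict z) ∂((P.matmul A h).limitLaw σ μ S) = ∫ z, f z ∂(P.limitLaw σ μ S) := by
      rw [← H.limitLaw_map_restrict (A := A) hP hh, integral_map measurable_restrict.aemeasurable
        hf.aestronglyMeasurable]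
    have hnew (k : Fin m) : (P.matmul A h).limitCov σ μ S (Sum.inr (Fin.last m))
        (Sum.inr k.castSucc) = open Classical in
          if P.mat k = A then (σ A.base : ℝ) ^ 2 * ∫ z, h.fn z * P.hfn k z ∂(P.limitLaw σ μ S)
          else 0 := by
      simp [limitCov, previous?]
    have hnew' : (P.matmul A h).limitCov σ μ S (Sum.inr (Fin.last m)) (Sum.inr (Fin.last m))
        = (σ A.base : ℝ) ^ 2 * ∫ z, h.fn z * h.fn z ∂(P.limitLaw σ μ S) := by
      simp [limitCov, previous?]
    have hold (k l : Fin m) : (P.matmul A h).limitCov σ μ S (Sum.inr k.castSucc)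
        (Sum.inr l.castSucc) = P.limitCov σ μ S (Sum.inr k) (Sum.inr l) := by
      simp [limitCov, previous?]
    refine ⟨hpsd, fun i l => ?_, fun k l hkl => ?_, fun k l hkl => ?_⟩
    · induction l using Fin.lastCases with
      | last => simp [limitCov, previous?]
      | cast l => simpa [limitCov, previous?] using H.inl_inr i l
    · induction k using Fin.lastCases with
      | last =>
        induction l using Fin.lastCases with
        | last =>
          simp only [hnew', mat_matmul_last, hfn_matmul_last]
          rw [hint (f := fun z => h.fn z * h.fn z) (hh.measurable.mul hh.measurable)]
        | cast l =>
          simp only [mat_matmul_last, mat_matmul_castSucc] at hkl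
          rw [hnew, if_pos hkl.symm]
          simp only [mat_matmul_last, hfn_matmul_last, hfn_matmul_castSucc]
          rw [hint (f := fun z => h.fn z * P.hfn l z) (hh.measurable.mul (measurable_hfn hP l))]
      | cast k =>
        induction l using Fin.lastCases with
        | last =>
          simp only [mat_matmul_last, mat_matmul_castSucc] at hkl
          rw [hsymm, hnew, if_pos hkl]
          simp only [mat_matmul_castSucc, hfn_matmul_last, hfn_matmul_castSucc, hkl]
          rw [hint (f := fun z => P.hfn k z * h.fn z) ((measurable_hfn hP k).mul hh.measurable)]
          simp only [mul_comm (h.fn _)]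
        | cast l =>
          simp only [mat_matmul_castSucc] at hkl
          rw [hold, H.inr_inr_eq k l hkl]
          simp only [mat_matmul_castSucc, hfn_matmul_castSucc]
          rw [hint (f := fun z => P.hfn k z * P.hfn l z)
            ((measurable_hfn hP k).mul (measurable_hfn hP l))]
    · induction k using Fin.lastCases with
      | last =>
        induction l using Fin.lastCases with
        | last => exact absurd rfl hkl
        | cast l =>
          simp only [mat_matmul_last, mat_matmul_castSucc] at hkl
          rw [hnew, if_neg fun h => hkl h.symm]
      | cast k =>
        induction l using Fin.lastCases with
        | last =>
          simp only [mat_matmul_last, mat_matmul_castSucc] at hkl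
          rw [hsymm, hnew, if_neg hkl]
        | cast l =>
          simp only [mat_matmul_castSucc] at hkl
          rw [hold, H.inr_inr_ne k l hkl]

end Limit

/-! ### Averages over the coordinates of one parity -/

/-- The part of the mean of a vector that comes from the coordinates of parity `b`. -/
def parityMean (b : Bool) {n : ℕ} (f : Fin n → ℝ) : ℝ :=
  1 / (n : ℝ) * ∑ α with α.val.bodd = b, f α

lemma parityMean_sub (b : Bool) {n : ℕ} (f g : Fin n → ℝ) :
    parityMean b (fun α => f α - g α) = parityMean b f - parityMean b g := by
  simp only [parityMean, Finset.sum_sub_distrib, mul_sub]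

lemma parityMean_const_mul (b : Bool) {n : ℕ} (c : ℝ) (f : Fin n → ℝ) :
    parityMean b (fun α => c * f α) = c * parityMean b f := by
  simp only [parityMean, ← Finset.mul_sum]; ring

lemma parityMean_mono (b : Bool) {n : ℕ} {f g : Fin n → ℝ} (h : ∀ α, f α ≤ g α) :
    parityMean b f ≤ parityMean b g :=
  mul_le_mul_of_nonneg_left (Finset.sum_le_sum fun α _ => h α) (by positivity)

lemma abs_parityMean_le (b : Bool) {n : ℕ} (f : Fin n → ℝ) :
    |parityMean b f| ≤ parityMean b fun α => |f α| := by
  rw [parityMean, abs_mul, abs_of_nonneg (by positivity)]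
  exact mul_le_mul_of_nonneg_left (Finset.abs_sum_le_sum_abs _ _) (by positivity)

lemma parityMean_sum (b : Bool) {n : ℕ} {K : Type*} (s : Finset K) (f : K → Fin n → ℝ) :
    parityMean b (fun α => ∑ k ∈ s, f k α) = ∑ k ∈ s, parityMean b (f k) := by
  simp only [parityMean, ← Finset.mul_sum]
  rw [Finset.sum_comm]

lemma parityMean_add_parityMean {n : ℕ} (f : Fin n → ℝ) :
    parityMean false f + parityMean true f = 1 / (n : ℝ) * ∑ α, f α := by
  rw [parityMean, parityMean, ← mul_add]
  congr 1
  rw [← Finset.sum_filter_add_sum_filter_not Finset.univ (fun α : Fin n => α.val.bodd = false)]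
  congr 2
  ext α
  simp

lemma card_parity_bounds (b : Bool) (n : ℕ) :
    2 * (Finset.univ.filter fun α : Fin n => α.val.bodd = b).card ≤ n + 1 ∧
      n ≤ 2 * (Finset.univ.filter fun α : Fin n => α.val.bodd = b).card + 1 := by
  have key : ∀ n, (Finset.univ.filter fun α : Fin (n + 2) => α.val.bodd = b).card
      = (Finset.univ.filter fun α : Fin n => α.val.bodd = b).card + 1 := fun n => by
    simp only [Finset.card_filter, Fin.sum_univ_castSucc, Fin.val_castSucc, Fin.val_last,
      add_assoc, Nat.bodd_succ]
    congr 1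
    rcases Bool.eq_false_or_eq_true n.bodd with h | h <;> cases b <;> simp [h]
  induction n using Nat.twoStepInduction with
  | zero => simp
  | one =>
    simp only [Finset.card_filter, Fin.sum_univ_castSucc]
    cases b <;> simp
  | more n h1 _ => rw [key]; omega

lemma tendsto_parityMean_const (b : Bool) (c : ℝ) :
    Tendsto (fun n : ℕ => parityMean b fun _ : Fin n => c) atTop (𝓝 (1 / 2 * c)) := by
  have h0 : Tendsto (fun n : ℕ => (1 / (n : ℝ)) * |c|) atTop (𝓝 0) := by
    simpa using tendsto_one_div_atTop_nhds_zero_nat.mul_const |c|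
  rw [tendsto_iff_dist_tendsto_zero]
  refine squeeze_zero' (Eventually.of_forall fun _ => dist_nonneg) ?_ h0
  filter_upwards [eventually_gt_atTop 0] with n hn
  obtain ⟨h1, h2⟩ := card_parity_bounds b n
  set k := (Finset.univ.filter fun α : Fin n => α.val.bodd = b).card with hk
  have hn' : (0 : ℝ) < n := by exact_mod_cast hn
  have h1' : (2 : ℝ) * k ≤ n + 1 := by exact_mod_cast h1
  have h2' : (n : ℝ) ≤ 2 * k + 1 := by exact_mod_cast h2
  have : (1 / (n : ℝ)) * (k * c) - 1 / 2 * c = (1 / (n : ℝ)) * c * (k - n / 2) := by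
    field_simp
  rw [Real.dist_eq, parityMean, Finset.sum_const, ← hk, nsmul_eq_mul, this, abs_mul, abs_mul,
    abs_of_nonneg (show 0 ≤ 1 / (n : ℝ) by positivity)]
  refine mul_le_of_le_one_right (by positivity) ?_
  rw [abs_le]
  constructor <;> linarith

/-- The induction hypothesis of the master theorem: the law of large numbers over the coordinates
of each parity, and null sets of the limiting law are eventually avoided. -/
structure Program.Converges [Fintype ι] [DecidableEq ι] [Fintype κ] (σ : κ → ℝ≥0) (μ : ι → ℝ)
    (S : Matrix ι ι ℝ) {m : ℕ} (P : Program ι κ m) : Prop where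
  lln : ∀ ψ : (ι ⊕ Fin m → ℝ) → ℝ, Measurable ψ → PolyBd ψ →
    ∀ᵐ s ∂(jointLaw (κ := κ) σ μ S), ∀ b, Tendsto
      (fun n => parityMean b fun α => ψ (P.gvars (s n) α)) atTop
      (𝓝 (1 / 2 * ∫ z, ψ z ∂(P.limitLaw σ μ S)))
  null : ∀ N : Set (ι ⊕ Fin m → ℝ), MeasurableSet N → P.limitLaw σ μ S N = 0 →
    ∀ᵐ s ∂(jointLaw (κ := κ) σ μ S), ∀ᶠ n in atTop, ∀ α, P.gvars (s n) α ∉ N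

section

variable {E : Type*} [NormedAddCommGroup E] [NormedSpace ℝ E] [CompleteSpace E]
  [SecondCountableTopology E] [MeasurableSpace E] [BorelSpace E]

lemma PolyBd.memLp_four {f : E → ℝ} (hf : PolyBd f) (hm : Measurable f) (ν : Measure E)
    [IsGaussian ν] : MemLp f 4 ν := by
  refine (integrable_norm_rpow_iff hm.aestronglyMeasurable (by norm_num) (by norm_num)).1 ?_
  refine ((hf.pow 4).integrable (hm.pow_const 4) ν).congr (ae_of_all _ fun x => ?_)
  have : (4 : ENNReal).toReal = ((4 : ℕ) : ℝ) := by norm_num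
  simp only [this, Real.rpow_natCast, Real.norm_eq_abs]
  rw [Even.pow_abs (by decide)]

end

section

variable [Fintype ι] [DecidableEq ι] [Fintype κ] {σ : κ → ℝ≥0} {μ : ι → ℝ} {S : Matrix ι ι ℝ}
  {m : ℕ} {P : Program ι κ m}

lemma Program.Converges.mean (H : P.Converges σ μ S) {ψ : (ι ⊕ Fin m → ℝ) → ℝ}
    (hm : Measurable ψ) (hψ : PolyBd ψ) :
    ∀ᵐ s ∂(jointLaw (κ := κ) σ μ S), Tendsto
      (fun n : ℕ => 1 / (n : ℝ) * ∑ α, ψ (P.gvars (s n) α)) atTop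
      (𝓝 (∫ z, ψ z ∂(P.limitLaw σ μ S))) := by
  filter_upwards [H.lln ψ hm hψ] with s hs
  have := (hs false).add (hs true)
  rw [← add_mul] at this
  norm_num at this
  refine this.congr fun n => ?_
  simpa using parityMean_add_parityMean fun α => ψ (P.gvars (s n) α)

/-- Almost sure convergence, from almost sure eventual bounds for each single tolerance. -/
lemma tendsto_of_eventually_dist_lt {X : Type*} [MeasurableSpace X] {ρ : Measure X}
    {F : ℕ → X → ℝ} {l : ℝ}
    (h : ∀ t : ℝ, 0 < t → ∀ᵐ s ∂ρ, ∀ᶠ n in atTop, |F n s - l| < t) :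
    ∀ᵐ s ∂ρ, Tendsto (fun n => F n s) atTop (𝓝 l) := by
  have h1 := ae_all_iff.2 fun k : ℕ => h (1 / ((k : ℝ) + 1)) (by positivity)
  filter_upwards [h1] with s hs
  rw [Metric.tendsto_atTop']
  intro ε hε
  obtain ⟨k, hk⟩ := exists_nat_one_div_lt hε
  obtain ⟨N, hN⟩ := eventually_atTop.1 (hs k)
  exact ⟨N, fun n hn => (hN n hn.le).trans hk⟩

lemma ennreal_tsum_ofReal_div_sq_ne_top (K : ℝ) :
    ∑' n : ℕ, ENNReal.ofReal (K / (n : ℝ) ^ 2) ≠ ⊤ := by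
  have : Summable fun n : ℕ => K / (n : ℝ) ^ 2 := by
    simpa [div_eq_mul_inv] using (Real.summable_nat_pow_inv.2 (by norm_num : 1 < 2)).mul_left K
  exact this.tsum_ofReal_ne_top

/-! ### Input vectors -/

lemma limitLaw_inputs (hS : S.PosSemidef) :
    (Program.inputs : Program ι κ 0).limitLaw σ μ S
      = (gaussianVec μ S).map fun x => Sum.elim x Fin.elim0 := by
  set M : Matrix (ι ⊕ Fin 0) ι ℝ := Matrix.of fun g i => if g = Sum.inl i then 1 else 0 with hM
  have h1 (x : ι → ℝ) : M *ᵥ x = Sum.elim x Fin.elim0 := by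
    funext g
    rcases g with i | l
    · simp [hM, Matrix.mulVec, dotProduct]
    · exact l.elim0
  have h2 : limitMean μ 0 = M *ᵥ μ := by
    rw [h1]
    funext g
    rcases g with i | l
    · rfl
    · exact l.elim0
  have h3 : (Program.inputs : Program ι κ 0).limitCov σ μ S = M * S * Mᵀ := by
    ext g g'
    rcases g with i | l
    · rcases g' with j | l
      · simp [Program.limitCov, hM, Matrix.mul_apply]
      · exact l.elim0
    · exact l.elim0
  rw [Program.limitLaw, h2, h3, ← gaussianVec_map_mulVec _ hS]
  congr 1
  funext x
  exact h1 x

lemma measurable_elim_inputs : Measurable fun x : ι → ℝ => (Sum.elim x Fin.elim0 : ι ⊕ Fin 0 → ℝ) := by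
  refine measurable_pi_lambda _ fun g => ?_
  rcases g with i | l
  · exact measurable_pi_apply i
  · exact l.elim0

/-- A form of the first Borel–Cantelli lemma for independent samples. -/
lemma eventually_notMem_of_law_le {X : ℕ → Type*} [∀ n, MeasurableSpace (X n)]
    {P : ∀ n, Measure (X n)} [∀ n, IsProbabilityMeasure (P n)] {Bad : ∀ n, Set (X n)}
    (hBad : ∀ n, MeasurableSet (Bad n)) {δ : ℕ → ENNReal} (hδ : ∑' n, δ n ≠ ⊤)
    (h : ∀ᶠ n in atTop, P n (Bad n) ≤ δ n) :
    ∀ᵐ s ∂(Measure.infinitePi P), ∀ᶠ n in atTop, s n ∉ Bad n :=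
  eventually_notMem_of_resampling (γ := P) (Φ := fun _ _ v => v)
    (fun _ => measurePreserving_snd) (fun _ _ _ _ => rfl) hBad hδ (ae_of_all _ fun _ => h)

lemma converges_inputs (hS : S.PosSemidef) :
    (Program.inputs : Program ι κ 0).Converges σ μ S := by
  have hg (n : ℕ) : Measurable fun s : Inputs ι κ n => (Program.inputs : Program ι κ 0).gvars s :=
    Program.measurable_gvars (by trivial : (Program.inputs : Program ι κ 0).PolyBounded) n
  have hgα (n : ℕ) (α : Fin n) : Measurable fun s : Inputs ι κ n =>
      (Program.inputs : Program ι κ 0).gvars s α := (measurable_pi_apply α).comp (hg n)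
  have hmp (n : ℕ) : MeasurePreserving (fun s : Inputs ι κ n => s.2) (inputLaw σ μ S n)
      (Measure.pi fun _ => gaussianVec μ S) := measurePreserving_snd
  refine ⟨fun ψ hψm hψ => ?_, fun N hN hN0 => ?_⟩
  · set f : (ι → ℝ) → ℝ := fun x => ψ (Sum.elim x Fin.elim0) with hf
    have hfm : Measurable f := hψm.comp measurable_elim_inputs
    have hfp : PolyBd f := hψ.comp <| PolyBd.norm_pi fun g => by
      rcases g with i | l
      · exact PolyBd.eval i
      · exact l.elim0
    have hf4 : MemLp f 4 (gaussianVec μ S) := hfp.memLp_four hfm _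
    have hint : ∫ z, ψ z ∂((Program.inputs : Program ι κ 0).limitLaw σ μ S)
        = ∫ x, f x ∂(gaussianVec μ S) := by
      rw [limitLaw_inputs hS, integral_map measurable_elim_inputs.aemeasurable
        hψm.aestronglyMeasurable]
    rw [hint]
    set I := ∫ x, f x ∂(gaussianVec μ S)
    refine ae_all_iff.2 fun b => ?_
    have hdev : ∀ᵐ s ∂(jointLaw (κ := κ) σ μ S), Tendsto (fun n => (parityMean b fun α =>
        ψ ((Program.inputs : Program ι κ 0).gvars (s n) α)) - parityMean b fun _ : Fin n => I)
        atTop (𝓝 0) := by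
      refine tendsto_of_eventually_dist_lt fun t ht => ?_
      set J := ∫ x, f x ^ 4 ∂(gaussianVec μ S)
      have hJ : 0 ≤ J := integral_nonneg fun x => by positivity
      set Bad : ∀ n, Set (Inputs ι κ n) := fun n => {s | t ≤ |(parityMean b fun α =>
        ψ ((Program.inputs : Program ι κ 0).gvars s α)) - parityMean b fun _ : Fin n => I|}
        with hBad
      have hBm : ∀ n, MeasurableSet (Bad n) := fun n => by
        have : Measurable fun s : Inputs ι κ n => parityMean b fun α =>
            ψ ((Program.inputs : Program ι κ 0).gvars s α) := by
          unfold parityMean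
          exact (Finset.measurable_sum _ fun α _ => hψm.comp (hgα n α)).const_mul _
        exact measurableSet_le measurable_const (this.sub_const _).abs
      have := eventually_notMem_of_law_le (P := fun n => inputLaw (κ := κ) σ μ S n) hBm
        (ennreal_tsum_ofReal_div_sq_ne_top (64 * J / t ^ 4)) ?_
      · refine this.mono fun s hs => hs.mono fun n hn => ?_
        simpa [hBad] using hn
      · filter_upwards [eventually_gt_atTop 0] with n hn
        have hn' : (0 : ℝ) < n := by exact_mod_cast hn
        have h1 := pi_sum_deviation_le (P := fun _ : Fin n => gaussianVec μ S)
          (f := fun _ => f) (fun _ => hfm) (fun _ => hf4)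
          (Finset.univ.filter fun α : Fin n => α.val.bodd = b) (t := n * t) (by positivity)
        have hsub : Bad n ⊆ (fun s : Inputs ι κ n => s.2) ⁻¹' {x | n * t ≤
            |∑ i with i.val.bodd = b, f (x i) - ∑ i : Fin n with i.val.bodd = b, I|} := by
          intro s hs
          have hs' : t ≤ _ := hs
          rw [parityMean, parityMean, ← mul_sub, abs_mul, abs_of_nonneg (by positivity),
            div_mul_eq_mul_div, one_mul, le_div_iff₀ hn', mul_comm] at hs'
          exact hs'
        refine (measure_mono hsub).trans ?_
        rw [(hmp n).measure_preimage]
        · refine h1.trans (ENNReal.ofReal_le_ofReal ?_)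
          rw [Finset.sum_const, nsmul_eq_mul]
          have hc : ((Finset.univ.filter fun α : Fin n => α.val.bodd = b).card : ℝ) ≤ n := by
            exact_mod_cast (Finset.card_le_univ _).trans_eq (by simp)
          rw [mul_pow, div_div, div_le_div_iff₀ (by positivity) (by positivity)]
          have : (64 * (n : ℝ) * ((Finset.univ.filter fun α : Fin n => α.val.bodd = b).card * J))
              ≤ 64 * n * (n * J) := by gcongr
          calc _ ≤ 64 * (n : ℝ) * (n * J) * (t ^ 4 * n ^ 2) := by gcongr
            _ = _ := by ring
        · refine (measurableSet_le measurable_const (Measurable.abs ?_)).nullMeasurableSet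
          exact (Finset.measurable_sum _ fun i _ => hfm.comp (measurable_pi_apply i)).sub_const _
    filter_upwards [hdev] with s hs
    simpa using hs.add (tendsto_parityMean_const b I)
  · set Bad : ∀ n, Set (Inputs ι κ n) := fun n =>
      {s | ∃ α, (Program.inputs : Program ι κ 0).gvars s α ∈ N} with hBad
    have hBm : ∀ n, MeasurableSet (Bad n) := fun n => by
      have : Bad n = ⋃ α, (fun s : Inputs ι κ n =>
          (Program.inputs : Program ι κ 0).gvars s α) ⁻¹' N := by ext; simp [hBad]
      rw [this]
      exact MeasurableSet.iUnion fun α => (hgα n α) hN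
    have := eventually_notMem_of_law_le (P := fun n => inputLaw (κ := κ) σ μ S n) hBm
      (δ := 0) (by simp) (Eventually.of_forall fun n => ?_)
    · refine this.mono fun s hs => hs.mono fun n hn => ?_
      simpa [hBad] using hn
    · have : Bad n = ⋃ α, (fun s : Inputs ι κ n =>
          (Program.inputs : Program ι κ 0).gvars s α) ⁻¹' N := by ext; simp [hBad]
      rw [this]
      refine (measure_iUnion_null fun α => ?_).le
      have h1 : MeasurePreserving (fun s : Inputs ι κ n => s.2 α) (inputLaw σ μ S n)
          (gaussianVec μ S) := (measurePreserving_eval _ α).comp (hmp n)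
      have h2 : (fun s : Inputs ι κ n => (Program.inputs : Program ι κ 0).gvars s α) ⁻¹' N
          = (fun s : Inputs ι κ n => s.2 α) ⁻¹' ((fun x => Sum.elim x Fin.elim0) ⁻¹' N) := rfl
      rw [h2, h1.measure_preimage (measurable_elim_inputs hN).nullMeasurableSet,
        ← Measure.map_apply measurable_elim_inputs hN, ← limitLaw_inputs (κ := κ) (σ := σ) hS, hN0]

end

/-! ### Negating the special input vectors -/

/-- The sign acquired by the H-vars multiplied by an A-var when the special vectors are negated. -/
def AVar.sign : AVar κ → ℝ
  | input _ => 1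
  | transpose _ => -1

lemma AVar.sign_mul_sign_flip (A : AVar κ) : A.sign * A.flip.sign = -1 := by
  cases A <;> simp [sign, flip]

lemma Program.MatmulsBPLike.of_matmul {V : Set ι} {m : ℕ} {P : Program ι κ m} {A : AVar κ}
    {h : HVar (ι ⊕ Fin m)} (hP : (P.matmul A h).MatmulsBPLike V) : P.MatmulsBPLike V := by
  cases A <;> exact hP.1

lemma Program.MatmulsBPLike.evalH_negateOn {V : Set ι} {m : ℕ} {P : Program ι κ m} {A : AVar κ}
    {h : HVar (ι ⊕ Fin m)} (hP : (P.matmul A h).MatmulsBPLike V) {n : ℕ}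
    (W : κ → Matrix (Fin n) (Fin n) ℝ) (x : Fin n → ι → ℝ) :
    P.evalH h W (negateOn V x) = A.sign • P.evalH h W x := by
  cases A with
  | input w =>
    rw [AVar.sign, one_smul]
    exact hP.2 n W _ _ fun α i hi => by simp [negateOn, hi]
  | transpose w =>
    rw [AVar.sign, neg_one_smul]
    exact hP.2 n W x

lemma Program.MatmulsBPLike.hvec_negateOn {V : Set ι} {m : ℕ} {P : Program ι κ m}
    (hP : P.MatmulsBPLike V) {n : ℕ} (W : κ → Matrix (Fin n) (Fin n) ℝ) (x : Fin n → ι → ℝ)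
    (l : Fin m) :
    P.hvec l (P.eval W (negateOn V x)) = (P.mat l).sign • P.hvec l (P.eval W x) := by
  induction P with
  | inputs => exact l.elim0
  | matmul P A h ih =>
    induction l using Fin.lastCases with
    | last =>
      rw [hvec_matmul_last, hvec_matmul_last, mat_matmul_last]
      simp only [eval_matmul, restrict_extend]
      exact hP.evalH_negateOn W x
    | cast l =>
      rw [hvec_matmul_castSucc, hvec_matmul_castSucc, mat_matmul_castSucc, restrict_eval_matmul,
        restrict_eval_matmul]
      exact ih hP.of_matmul l

lemma Program.MatmulsBPLike.eval_negateOn {V : Set ι} {m : ℕ} {P : Program ι κ m}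
    (hP : P.MatmulsBPLike V) {n : ℕ} (W : κ → Matrix (Fin n) (Fin n) ℝ) (x : Fin n → ι → ℝ)
    (l : Fin m) (α : Fin n) :
    P.eval W (negateOn V x) α (Sum.inr l) = (P.mat l).sign * P.eval W x α (Sum.inr l) := by
  rw [P.eval_inr, P.eval_inr, hP.hvec_negateOn, Matrix.mulVec_smul]
  rfl

lemma Program.MatmulsBPLike.residual_negateOn {V : Set ι} {m : ℕ} {P : Program ι κ m} {A : AVar κ}
    {h : HVar (ι ⊕ Fin m)} (hP : (P.matmul A h).MatmulsBPLike V) {b : Fin m → ℝ}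
    (hb : ∀ l, P.mat l ≠ A → b l = 0) {n : ℕ} (W : κ → Matrix (Fin n) (Fin n) ℝ)
    (x : Fin n → ι → ℝ) (α : Fin n) :
    P.residual h b (P.eval W (negateOn V x) α) = A.sign * P.residual h b (P.eval W x α) := by
  have h1 : h.fn (P.eval W (negateOn V x) α) = A.sign * h.fn (P.eval W x α) :=
    congrFun (hP.evalH_negateOn W x) α
  have h2 (k : Fin m) : b k * P.hfn k (P.eval W (negateOn V x) α)
      = A.sign * (b k * P.hfn k (P.eval W x α)) := by
    by_cases hk : P.mat k = A
    · have : P.hfn k (P.eval W (negateOn V x) α) = (P.mat k).sign * P.hfn k (P.eval W x α) :=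
        congrFun (hP.of_matmul.hvec_negateOn W x k) α
      rw [this, hk]; ring
    · simp [hb k hk]
  simp only [residual, h1, h2, ← Finset.mul_sum, mul_sub]

section

variable [Fintype ι] [DecidableEq ι] [Fintype κ] {σ : κ → ℝ≥0} {μ : ι → ℝ} {S : Matrix ι ι ℝ}
  {V : Set ι}

open Classical in
lemma gaussianVec_measurePreserving_negate (hS : S.PosSemidef) (hμ : ∀ i ∈ V, μ i = 0)
    (hSV : ∀ i ∈ V, ∀ j ∉ V, S i j = 0 ∧ S j i = 0) :
    MeasurePreserving (fun (z : ι → ℝ) i => if i ∈ V then -z i else z i)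
      (gaussianVec μ S) (gaussianVec μ S) := by
  set d : ι → ℝ := fun i => if i ∈ V then -1 else 1 with hd
  have h1 (z : ι → ℝ) : Matrix.diagonal d *ᵥ z = fun i => if i ∈ V then -z i else z i := by
    funext i
    rw [Matrix.mulVec_diagonal]
    by_cases hi : i ∈ V <;> simp [hd, hi]
  have h2 : Matrix.diagonal d *ᵥ μ = μ := by
    rw [h1]
    funext i
    by_cases hi : i ∈ V <;> simp [hi, hμ]
  have h3 : Matrix.diagonal d * S * (Matrix.diagonal d)ᵀ = S := by
    ext i j
    rw [Matrix.diagonal_transpose, Matrix.mul_diagonal, Matrix.diagonal_mul]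
    by_cases hi : i ∈ V <;> by_cases hj : j ∈ V <;> simp [hd, hi, hj]
    · simp [(hSV i hi j hj).1]
    · simp [(hSV j hj i hi).2]
  have h4 := gaussianVec_map_mulVec μ hS (Matrix.diagonal d)
  rw [h2, h3] at h4
  rw [show (fun (z : ι → ℝ) i => if i ∈ V then -z i else z i) = fun z => Matrix.diagonal d *ᵥ z from
    funext fun z => (h1 z).symm]
  exact ⟨measurable_mulVec _, h4⟩

lemma measurePreserving_negateOn (σ : κ → ℝ≥0) (hS : S.PosSemidef) (hμ : ∀ i ∈ V, μ i = 0)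
    (hSV : ∀ i ∈ V, ∀ j ∉ V, S i j = 0 ∧ S j i = 0) :
    MeasurePreserving (fun (s : ∀ n, Inputs ι κ n) n => ((s n).1, negateOn V (s n).2))
      (jointLaw σ μ S) (jointLaw σ μ S) := by
  have h1 (n : ℕ) : MeasurePreserving (fun s : Inputs ι κ n => (s.1, negateOn V s.2))
      (inputLaw σ μ S n) (inputLaw σ μ S n) := by
    refine (MeasurePreserving.id _).prod ?_
    exact measurePreserving_pi _ _ fun _ => gaussianVec_measurePreserving_negate hS hμ hSV
  refine ⟨measurable_pi_lambda _ fun n => (h1 n).measurable.comp (measurable_pi_apply n), ?_⟩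
  have := Measure.infinitePi_map_pi (μ := fun n => inputLaw (κ := κ) σ μ S n)
    (f := fun n s => (s.1, negateOn V s.2)) (fun n => (h1 n).measurable)
  rw [jointLaw, this]
  simp only [(h1 _).map_eq]

variable {m : ℕ} {P : Program ι κ m}

lemma Program.Converges.integral_eq_zero_of_odd (H : P.Converges σ μ S) (hS : S.PosSemidef)
    (hμ : ∀ i ∈ V, μ i = 0) (hSV : ∀ i ∈ V, ∀ j ∉ V, S i j = 0 ∧ S j i = 0)
    {f : (ι ⊕ Fin m → ℝ) → ℝ} (hm : Measurable f) (hf : PolyBd f)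
    (hodd : ∀ (n : ℕ) (W : κ → Matrix (Fin n) (Fin n) ℝ) (x : Fin n → ι → ℝ) (α : Fin n),
      f (P.eval W (negateOn V x) α) = -f (P.eval W x α)) :
    ∫ z, f z ∂(P.limitLaw σ μ S) = 0 := by
  have h1 := H.mean hm hf
  have h2 := (measurePreserving_negateOn σ hS hμ hSV).quasiMeasurePreserving.ae h1
  have : NeZero (jointLaw (κ := κ) σ μ S) := by unfold jointLaw; infer_instance
  obtain ⟨s, hs1, hs2⟩ := (h1.and h2).exists
  have h3 : Tendsto (fun n : ℕ => 1 / (n : ℝ) * ∑ α, f (P.gvars (s n) α)) atTop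
      (𝓝 (-∫ z, f z ∂(P.limitLaw σ μ S))) := by
    refine hs2.neg.congr fun n => ?_
    rw [← mul_neg, ← Finset.sum_neg_distrib]
    congr 1
    refine Finset.sum_congr rfl fun α _ => ?_
    simp only [gvars, hodd, neg_neg]
  linarith [tendsto_nhds_unique hs1 h3]

lemma Program.Converges.integral_residual_mul_eq_zero (H : P.Converges σ μ S) {A : AVar κ}
    {h : HVar (ι ⊕ Fin m)} (hS : S.PosSemidef) (hP : P.PolyBounded) (hh : h.PolyBounded)
    (hV : (P.matmul A h).MatmulsBPLike V) (hμ : ∀ i ∈ V, μ i = 0)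
    (hSV : ∀ i ∈ V, ∀ j ∉ V, S i j = 0 ∧ S j i = 0) {b : Fin m → ℝ}
    (hb : ∀ l, P.mat l ≠ A → b l = 0) {j : Fin m} (hj : P.mat j = A.flip) :
    ∫ z, P.residual h b z * z (Sum.inr j) ∂(P.limitLaw σ μ S) = 0 := by
  refine H.integral_eq_zero_of_odd hS hμ hSV
    ((measurable_residual hP hh b).mul (measurable_pi_apply _))
    ((polyBd_residual hP hh b).mul (PolyBd.eval _)) fun n W x α => ?_
  rw [hV.residual_negateOn hb, hV.of_matmul.eval_negateOn, hj, mul_mul_mul_comm,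
    A.sign_mul_sign_flip, neg_one_mul]

end

/-! ### Control of the span of finitely many vectors -/

lemma eventually_gram_control {K : Type*} [Fintype K] {G : K → K → ℝ} {c : ℝ} (hc : 0 < c)
    (hG : ∀ a : K → ℝ, c * ∑ k, a k ^ 2 ≤ ∑ k, ∑ l, a k * a l * G k l)
    {v : ∀ n, K → Fin n → ℝ}
    (hv : ∀ k l b, Tendsto (fun n => parityMean b fun α => v n k α * v n l α) atTop
      (𝓝 (1 / 2 * G k l))) :
    ∀ᶠ n : ℕ in atTop, ∀ a : K → ℝ,
      ∑ k, a k ^ 2 ≤ 2 / c * (1 / (n : ℝ) * ∑ α, (∑ k, a k * v n k α) ^ 2) ∧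
      ∀ b, ∑ α : Fin n with α.val.bodd = b, (∑ k, a k * v n k α) ^ 2
        ≤ 2 / 3 * ∑ α, (∑ k, a k * v n k α) ^ 2 := by
  set N : ℝ := (Fintype.card K : ℝ) with hN
  have hN0 : 0 ≤ N := by positivity
  set η : ℝ := c / (20 * (N + 1)) with hη
  have hη0 : 0 < η := by positivity
  have hηN : η * N ≤ c / 20 := by
    rw [hη, div_mul_eq_mul_div, div_le_div_iff₀ (by positivity) (by norm_num)]
    nlinarith
  have hev : ∀ᶠ n : ℕ in atTop, ∀ k l b,
      |(parityMean b fun α => v n k α * v n l α) - 1 / 2 * G k l| ≤ η := by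
    simp only [eventually_all]
    intro k l b
    filter_upwards [(Metric.tendsto_nhds.1 (hv k l b)) η hη0] with n hn
    exact (Real.dist_eq _ _ ▸ hn).le
  filter_upwards [hev, eventually_gt_atTop 0] with n hn hn0 a
  have hn0' : (0 : ℝ) < n := by exact_mod_cast hn0
  set s := ∑ k, a k ^ 2 with hs
  have hs0 : 0 ≤ s := Finset.sum_nonneg fun _ _ => sq_nonneg _
  set q := ∑ k, ∑ l, a k * a l * G k l with hq
  set w : Fin n → ℝ := fun α => (∑ k, a k * v n k α) ^ 2 with hw
  have hqb (b : Bool) : parityMean b w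
      = ∑ k, ∑ l, a k * a l * parityMean b fun α => v n k α * v n l α := by
    have h1 : w = fun α => ∑ k, ∑ l, a k * a l * (v n k α * v n l α) := by
      funext α
      simp only [hw]; rw [sq, Finset.sum_mul_sum]
      exact Finset.sum_congr rfl fun k _ => Finset.sum_congr rfl fun l _ => by ring
    rw [h1, parityMean_sum]
    refine Finset.sum_congr rfl fun k _ => ?_
    rw [parityMean_sum]
    exact Finset.sum_congr rfl fun l _ => parityMean_const_mul _ _ _
  have habs : (∑ k, |a k|) ^ 2 ≤ N * s := by
    have := sq_sum_le_card_mul_sum_sq (s := (Finset.univ : Finset K)) (f := fun k => |a k|)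
    simpa [hs, hN] using this
  have hdiff (b : Bool) : |parityMean b w - 1 / 2 * q| ≤ c / 20 * s := by
    have h1 : parityMean b w - 1 / 2 * q = ∑ k, ∑ l, a k * a l *
        ((parityMean b fun α => v n k α * v n l α) - 1 / 2 * G k l) := by
      rw [hqb, hq, Finset.mul_sum, ← Finset.sum_sub_distrib]
      refine Finset.sum_congr rfl fun k _ => ?_
      rw [Finset.mul_sum, ← Finset.sum_sub_distrib]
      exact Finset.sum_congr rfl fun l _ => by ring
    have h2 : |parityMean b w - 1 / 2 * q| ≤ ∑ k, ∑ l, |a k| * |a l| * η := by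
      rw [h1]
      refine (Finset.abs_sum_le_sum_abs _ _).trans (Finset.sum_le_sum fun k _ => ?_)
      refine (Finset.abs_sum_le_sum_abs _ _).trans (Finset.sum_le_sum fun l _ => ?_)
      rw [abs_mul, abs_mul]
      exact mul_le_mul_of_nonneg_left (hn k l b) (by positivity)
    have h3 : ∑ k, ∑ l, |a k| * |a l| * η = η * (∑ k, |a k|) ^ 2 := by
      rw [sq, Finset.sum_mul_sum, Finset.mul_sum]
      refine Finset.sum_congr rfl fun k _ => ?_
      rw [Finset.mul_sum]
      exact Finset.sum_congr rfl fun l _ => by ring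
    rw [h3] at h2
    calc _ ≤ η * (∑ k, |a k|) ^ 2 := h2
      _ ≤ η * (N * s) := by gcongr
      _ = η * N * s := by ring
      _ ≤ _ := by gcongr
  have hqs : c * s ≤ q := hG a
  set Q := 1 / (n : ℝ) * ∑ α, w α with hQ
  have hsum : parityMean false w + parityMean true w = Q := parityMean_add_parityMean w
  have hf := abs_le.1 (hdiff false)
  have ht := abs_le.1 (hdiff true)
  have hcs : 0 ≤ c * s := by positivity
  refine ⟨?_, fun b => ?_⟩
  · rw [div_mul_eq_mul_div, le_div_iff₀ hc]
    linarith
  · have hb := abs_le.1 (hdiff b)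
    have h1 : parityMean b w ≤ 2 / 3 * Q := by linarith
    rw [parityMean, hQ] at h1
    have h2 := mul_le_mul_of_nonneg_left h1 hn0'.le
    have e1 : (n : ℝ) * (1 / n * ∑ α : Fin n with α.val.bodd = b, w α)
        = ∑ α : Fin n with α.val.bodd = b, w α := by field_simp
    have e2 : (n : ℝ) * (2 / 3 * (1 / n * ∑ α, w α)) = 2 / 3 * ∑ α, w α := by field_simp
    rwa [e1, e2] at h2

lemma exists_basis_of_memLp {E : Type*} [MeasurableSpace E] {ν : Measure E} {K : Type}
    [Finite K] {f : K → E → ℝ} (hf : ∀ k, MemLp (f k) 2 ν) :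
    ∃ (K' : Type) (_ : Fintype K') (e : K' → K) (c : ℝ), 0 < c ∧
      (∀ a : K' → ℝ, c * ∑ k, a k ^ 2 ≤ ∫ x, (∑ k, a k * f (e k) x) ^ 2 ∂ν) ∧
      ∀ k, ∃ d : K' → ℝ, f k =ᵐ[ν] fun x => ∑ t, d t * f (e t) x := by
  set F : K → Lp ℝ 2 ν := fun k => (hf k).toLp (f k) with hF
  obtain ⟨K', e, he, hspan, hli⟩ := exists_linearIndependent' ℝ F
  have : Finite K' := Finite.of_injective e he
  have := Fintype.ofFinite K'
  have hcomb (a : K' → ℝ) : ((∑ k, a k • F (e k) : Lp ℝ 2 ν) : E → ℝ)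
      =ᵐ[ν] fun x => ∑ k, a k * f (e k) x := by
    have h1 : MemLp (fun x => ∑ k, a k * f (e k) x) 2 ν :=
      memLp_finsetSum _ fun k _ => (hf (e k)).const_mul (a k)
    have h2 : ∑ k, a k • F (e k) = h1.toLp _ := by
      have h3 : ∀ s : Finset K', ∑ k ∈ s, a k • F (e k)
          = (memLp_finsetSum s fun k _ => (hf (e k)).const_mul (a k) :
            MemLp (fun x => ∑ k ∈ s, a k * f (e k) x) 2 ν).toLp _ := by
        classical
        intro s
        induction s using Finset.induction_on with
        | empty => simp; rfl
        | insert i s hi ih =>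
          rw [Finset.sum_insert hi, ih, hF, ← MemLp.toLp_const_smul, ← MemLp.toLp_add]
          congr 1
          funext x
          simp [Finset.sum_insert hi]
      exact h3 Finset.univ
    rw [h2]
    exact h1.coeFn_toLp
  have hnorm (a : K' → ℝ) : ‖(∑ k, a k • F (e k) : Lp ℝ 2 ν)‖ ^ 2
      = ∫ x, (∑ k, a k * f (e k) x) ^ 2 ∂ν := by
    rw [← real_inner_self_eq_norm_sq, L2.inner_def]
    refine integral_congr_ae ((hcomb a).mono fun x hx => ?_)
    simp only [hx]
    simp [sq]
  have hker : LinearMap.ker (Fintype.linearCombination ℝ (F ∘ e)) = ⊥ := by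
    rw [LinearMap.ker_eq_bot]
    exact linearIndependent_iff_injective_fintypeLinearCombination.1 hli
  obtain ⟨C, hC, hanti⟩ := LinearMap.exists_antilipschitzWith _ hker
  have hC' : (0 : ℝ) < C := hC
  refine ⟨K', inferInstance, e, 1 / ((Fintype.card K' + 1) * C ^ 2), by positivity, fun a => ?_,
    fun k => ?_⟩
  · have h1 : ‖a‖ ≤ C * ‖∑ k, a k • F (e k)‖ := by
      have := hanti.le_mul_dist a 0
      simpa [Fintype.linearCombination_apply] using this
    have h2 : ∑ k, a k ^ 2 ≤ Fintype.card K' * ‖a‖ ^ 2 := by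
      have : ∀ k ∈ Finset.univ, a k ^ 2 ≤ ‖a‖ ^ 2 := fun k _ => by
        rw [← sq_abs]
        exact pow_le_pow_left₀ (abs_nonneg _) (norm_le_pi_norm a k) 2
      simpa using Finset.sum_le_card_nsmul _ _ _ this
    rw [← hnorm, div_mul_eq_mul_div, one_mul, div_le_iff₀ (by positivity)]
    have h3 : ‖a‖ ^ 2 ≤ (C * ‖∑ k, a k • F (e k)‖) ^ 2 := by gcongr
    have h4 := mul_le_mul_of_nonneg_left h3 (Nat.cast_nonneg (α := ℝ) (Fintype.card K'))
    nlinarith [sq_nonneg ((C : ℝ) * ‖∑ k, a k • F (e k)‖)]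
  · have h1 : F k ∈ Submodule.span ℝ (Set.range (F ∘ e)) :=
      hspan ▸ Submodule.subset_span ⟨k, rfl⟩
    obtain ⟨d, hd⟩ := (Submodule.mem_span_range_iff_exists_fun ℝ).1 h1
    refine ⟨d, (hf k).coeFn_toLp.symm.trans ?_⟩
    have h2 := hcomb d
    rw [show (∑ k, d k • F (e k)) = F k from hd] at h2
    exact h2

section

variable [Fintype ι] [DecidableEq ι] [Fintype κ] {σ : κ → ℝ≥0} {μ : ι → ℝ} {S : Matrix ι ι ℝ}
  {m : ℕ} {P : Program ι κ m}

lemma Program.Converges.span_control (H : P.Converges σ μ S) (hP : P.PolyBounded) (A : AVar κ) :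
    ∃ C : ℝ, 0 < C ∧ ∀ᵐ s ∂(jointLaw (κ := κ) σ μ S), ∀ᶠ n : ℕ in atTop,
      ∀ v ∈ P.hspan A (P.gvars (s n)),
        (∃ a : Fin m → ℝ, (∀ k, P.mat k ≠ A → a k = 0) ∧
          v = ∑ k, a k • P.hvec k (P.gvars (s n)) ∧ ∀ k, a k ^ 2 ≤ C * (1 / (n : ℝ) * (v ⬝ᵥ v))) ∧
        ∀ b, ∑ α : Fin n with α.val.bodd = b, v α ^ 2 ≤ 2 / 3 * (v ⬝ᵥ v) := by
  classical
  set ν := P.limitLaw σ μ S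
  obtain ⟨K', _, e, c, hc, hlow, hspan⟩ := exists_basis_of_memLp (ν := ν)
    (f := fun k : {k // P.mat k = A} => P.hfn k) fun k =>
      (polyBd_hfn hP k).memLp_two (measurable_hfn hP k) ν
  choose d hd using hspan
  have hmul (k l : Fin m) : Measurable fun z => P.hfn k z * P.hfn l z :=
    (measurable_hfn hP k).mul (measurable_hfn hP l)
  have hmulp (k l : Fin m) : PolyBd fun z => P.hfn k z * P.hfn l z :=
    (polyBd_hfn hP k).mul (polyBd_hfn hP l)
  set G : K' → K' → ℝ := fun k l => ∫ z, P.hfn (e k) z * P.hfn (e l) z ∂ν with hG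
  have hGq (a : K' → ℝ) : ∫ x, (∑ k, a k * P.hfn (e k) x) ^ 2 ∂ν
      = ∑ k, ∑ l, a k * a l * G k l := by
    have h1 : ∀ x, (∑ k, a k * P.hfn (e k) x) ^ 2
        = ∑ k, ∑ l, a k * a l * (P.hfn (e k) x * P.hfn (e l) x) := fun x => by
      rw [sq, Finset.sum_mul_sum]
      exact Finset.sum_congr rfl fun k _ => Finset.sum_congr rfl fun l _ => by ring
    have h2 (k l : K') : Integrable (fun x => a k * a l * (P.hfn (e k) x * P.hfn (e l) x)) ν :=
      ((hmulp _ _).integrable (hmul _ _) ν).const_mul _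
    simp only [h1]
    rw [integral_finsetSum _ fun k _ => integrable_finsetSum _ fun l _ => h2 k l]
    refine Finset.sum_congr rfl fun k _ => ?_
    rw [integral_finsetSum _ fun l _ => h2 k l]
    exact Finset.sum_congr rfl fun l _ => integral_const_mul _ _
  have hlln := ae_all_iff.2 fun k : K' => ae_all_iff.2 fun l : K' =>
    H.lln _ (hmul (e k) (e l)) (hmulp (e k) (e l))
  have hnull := ae_all_iff.2 fun k : {k // P.mat k = A} =>
    H.null {z | P.hfn k z ≠ ∑ t, d k t * P.hfn (e t) z}
      (measurableSet_eq_fun (measurable_hfn hP k) (Finset.measurable_sum _ fun t _ =>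
        (measurable_hfn hP (e t)).const_mul _)).compl (hd k)
  refine ⟨(Fintype.card K' + 1) * (2 / c), by positivity, ?_⟩
  filter_upwards [hlln, hnull] with s hs1 hs2
  have hgram := eventually_gram_control (G := G) hc (fun a => (hlow a).trans_eq (hGq a))
    (v := fun n k => P.hvec (e k) (P.gvars (s n))) fun k l b => hs1 k l b
  filter_upwards [hgram, eventually_all.2 hs2] with n h1 h2 v hv
  have hle : P.hspan A (P.gvars (s n))
      ≤ Submodule.span ℝ (Set.range fun t => P.hvec (e t) (P.gvars (s n))) := by
    refine Submodule.span_le.2 ?_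
    rintro _ ⟨l, hl, rfl⟩
    refine (Submodule.mem_span_range_iff_exists_fun ℝ).2 ⟨d ⟨l, hl⟩, ?_⟩
    funext α
    have h3 := h2 ⟨l, hl⟩ α
    have h4 : P.hfn l (P.gvars (s n) α)
        = ∑ t, d ⟨l, hl⟩ t * P.hfn (e t) (P.gvars (s n) α) := by
      by_contra h
      exact h3 h
    simpa [hvec] using h4.symm
  obtain ⟨x, hx⟩ := (Submodule.mem_span_range_iff_exists_fun ℝ).1 (hle hv)
  have hvα (α : Fin n) : ∑ k, x k * P.hvec (e k) (P.gvars (s n)) α = v α := by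
    rw [← hx]; simp
  obtain ⟨h3, h4⟩ := h1 x
  simp only [hvα] at h3 h4
  have hvv : v ⬝ᵥ v = ∑ α, v α ^ 2 := by simp [dotProduct, sq]
  rw [← hvv] at h3 h4
  refine ⟨⟨fun l => ∑ t, if (e t : Fin m) = l then x t else 0, fun k hk => ?_, ?_, fun k => ?_⟩, h4⟩
  · refine Finset.sum_eq_zero fun t _ => if_neg fun h => hk ?_
    rw [← h]; exact (e t).2
  · rw [← hx]
    simp only [Finset.sum_smul, ite_smul, zero_smul]
    rw [Finset.sum_comm]
    simp
  · have h5 : |∑ t, if (e t : Fin m) = k then x t else 0| ≤ ∑ t, |x t| := by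
      refine (Finset.abs_sum_le_sum_abs _ _).trans (Finset.sum_le_sum fun t _ => ?_)
      split_ifs <;> simp
    have h6 := sq_sum_le_card_mul_sum_sq (s := (Finset.univ : Finset K')) (f := fun k => |x k|)
    simp only [sq_abs, Finset.card_univ] at h6
    rw [← sq_abs]
    have h7 : 0 ≤ ∑ t, x t ^ 2 := Finset.sum_nonneg fun _ _ => sq_nonneg _
    calc _ ≤ (∑ t, |x t|) ^ 2 := by gcongr
      _ ≤ Fintype.card K' * ∑ t, x t ^ 2 := h6
      _ ≤ (Fintype.card K' + 1) * ∑ t, x t ^ 2 := by gcongr; simp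
      _ ≤ (Fintype.card K' + 1) * (2 / c * (1 / (n : ℝ) * (v ⬝ᵥ v))) := by gcongr
      _ = _ := by ring

end

/-! ### The newest G-var, conditionally on the previous ones -/

lemma projection_coeff_bound {n m : ℕ} {a : Fin m → ℝ} {x : Fin m → Fin n → ℝ} {v y : Fin n → ℝ}
    {C τ : ℝ} (hC : 0 < C) (hτ : 0 ≤ τ) (hv : v = ∑ k, a k • x k) (hvy : v ⬝ᵥ v = v ⬝ᵥ y)
    (ha : ∀ k, a k ^ 2 ≤ C * (1 / (n : ℝ) * (v ⬝ᵥ v)))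
    (hx : ∀ k, a k = 0 ∨ |1 / (n : ℝ) * (x k ⬝ᵥ y)| ≤ τ) :
    1 / (n : ℝ) * (v ⬝ᵥ v) ≤ C * m ^ 2 * τ ^ 2 ∧ ∀ k, |a k| ≤ C * m * τ := by
  set q := 1 / (n : ℝ) * (v ⬝ᵥ v) with hq
  have hq0 : 0 ≤ q := mul_nonneg (by positivity) (dotProduct_self_nonneg' v)
  have hak (k : Fin m) : |a k| ≤ √(C * q) := Real.abs_le_sqrt (ha k)
  have h1 : q ≤ m * (√(C * q) * τ) := by
    have h2 : q = ∑ k, a k * (1 / (n : ℝ) * (x k ⬝ᵥ y)) := by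
      rw [hq, hvy]
      conv_lhs => rw [hv]
      rw [sum_dotProduct, Finset.mul_sum]
      refine Finset.sum_congr rfl fun k _ => ?_
      rw [smul_dotProduct, smul_eq_mul]; ring
    calc q = ∑ k, a k * (1 / (n : ℝ) * (x k ⬝ᵥ y)) := h2
      _ ≤ ∑ _k : Fin m, √(C * q) * τ := by
        refine Finset.sum_le_sum fun k _ => ?_
        rcases hx k with h | h
        · rw [h, zero_mul]; positivity
        · refine (le_abs_self _).trans ?_
          rw [abs_mul]
          exact mul_le_mul (hak k) h (abs_nonneg _) (Real.sqrt_nonneg _)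
      _ = _ := by simp
  have h3 : q ≤ C * m ^ 2 * τ ^ 2 := by
    rcases hq0.eq_or_lt with h0 | h0
    · rw [← h0]; positivity
    · have h4 : q ^ 2 ≤ (m * (√(C * q) * τ)) ^ 2 := pow_le_pow_left₀ hq0 h1 2
      rw [mul_pow (m : ℝ), mul_pow (√(C * q)), Real.sq_sqrt (by positivity)] at h4
      have h5 : q * q ≤ (C * m ^ 2 * τ ^ 2) * q := by
        calc q * q = q ^ 2 := by ring
          _ ≤ _ := h4
          _ = _ := by ring
      exact le_of_mul_le_mul_right h5 h0
  refine ⟨h3, fun k => ?_⟩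
  refine abs_le_of_sq_le_sq ?_ (by positivity)
  calc a k ^ 2 ≤ C * q := ha k
    _ ≤ C * (C * m ^ 2 * τ ^ 2) := by gcongr
    _ = _ := by ring

namespace Program

variable {m n : ℕ} {P : Program ι κ m}

/-- The values of the residual of an H-var. -/
def residualVec (P : Program ι κ m) (h : HVar (ι ⊕ Fin m)) (b : Fin m → ℝ)
    (p : Fin n → ι ⊕ Fin m → ℝ) : Fin n → ℝ :=
  fun α => P.residual h b (p α)

/-- The conditional mean of the product of an A-var with the residual of an H-var. -/
def drift (P : Program ι κ m) (A : AVar κ) (h : HVar (ι ⊕ Fin m)) (b : Fin m → ℝ)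
    (s : Inputs ι κ n) : Fin n → ℝ :=
  (A.eval (fun W => Matrix.of (s.1 W))
    - P.res A.flip (P.gvars s) * A.eval (fun W => Matrix.of (s.1 W)) * P.res A (P.gvars s))
      *ᵥ P.residualVec h b (P.gvars s)

lemma gvars_inr (P : Program ι κ m) (s : Inputs ι κ n) {A : AVar κ} {k : Fin m}
    (hk : P.mat k = A) :
    (fun α => P.gvars s α (Sum.inr k))
      = A.eval (fun W => Matrix.of (s.1 W)) *ᵥ P.hvec k (P.gvars s) := by
  subst hk
  funext α
  exact P.eval_inr _ _ α k

lemma one_sub_res_dotProduct (P : Program ι κ m) (A : AVar κ) (p : Fin n → ι ⊕ Fin m → ℝ)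
    (u : Fin n → ℝ) :
    (1 - P.res A p) *ᵥ u ⬝ᵥ (1 - P.res A p) *ᵥ u = (1 - P.res A p) *ᵥ u ⬝ᵥ u := by
  have hT : (1 - P.res A p)ᵀ = 1 - P.res A p := by simp [P.res_transpose]
  have h2 : (1 - P.res A p) * (1 - P.res A p) = 1 - P.res A p := by
    simp [mul_sub, sub_mul, P.res_mul_self]
  rw [dotProduct_mulVec_symm hT, Matrix.mulVec_mulVec, h2, dotProduct_mulVec_symm hT]

/-- The conclusion of `Converges.span_control` about the coefficients. -/
def SpanBound (P : Program ι κ m) (A : AVar κ) (C : ℝ) (p : Fin n → ι ⊕ Fin m → ℝ) : Prop :=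
  ∀ v ∈ P.hspan A p, ∃ a : Fin m → ℝ, (∀ k, P.mat k ≠ A → a k = 0) ∧
    v = ∑ k, a k • P.hvec k p ∧ ∀ k, a k ^ 2 ≤ C * (1 / (n : ℝ) * (v ⬝ᵥ v))

lemma drift_bound {A : AVar κ} {h : HVar (ι ⊕ Fin m)} {b : Fin m → ℝ} {s : Inputs ι κ n}
    {C τ B : ℝ} (hC : 0 < C) (hτ : 0 ≤ τ) (hB : 0 ≤ B)
    (hA : P.SpanBound A C (P.gvars s)) (hA' : P.SpanBound A.flip C (P.gvars s))
    (h1 : ∀ k, P.mat k = A →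
      |1 / (n : ℝ) * (P.hvec k (P.gvars s) ⬝ᵥ P.residualVec h b (P.gvars s))| ≤ τ)
    (h2 : ∀ j, P.mat j = A.flip →
      |1 / (n : ℝ) * ((fun α => P.gvars s α (Sum.inr j)) ⬝ᵥ P.residualVec h b (P.gvars s))| ≤ τ)
    (h3 : ∀ j k, |1 / (n : ℝ) * ((fun α => P.gvars s α (Sum.inr j)) ⬝ᵥ P.hvec k (P.gvars s))| ≤ B) :
    1 / (n : ℝ) * ((1 - P.res A (P.gvars s)) *ᵥ P.residualVec h b (P.gvars s) ⬝ᵥ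
        (1 - P.res A (P.gvars s)) *ᵥ P.residualVec h b (P.gvars s)) ≤ C * m ^ 2 * τ ^ 2 ∧
      ∃ ε δ : Fin m → ℝ, (∀ k, |ε k| ≤ C * m * τ) ∧
        (∀ k, |δ k| ≤ C * m * (τ + m * (C * m * τ * B))) ∧
        ∀ α, P.drift A h b s α
          = ∑ k, ε k * P.gvars s α (Sum.inr k) + ∑ k, δ k * P.hfn k (P.gvars s α) := by
  set p := P.gvars s with hp
  set u := P.residualVec h b p with hu
  set R := P.res A p with hR
  set L := P.res A.flip p with hL
  set M := A.eval (fun W => Matrix.of (s.1 W)) with hM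
  obtain ⟨ε, hε0, hε, hεC⟩ := hA _ (P.one_sub_res_mulVec_mem A p u)
  have hbd1 := projection_coeff_bound hC hτ hε (P.one_sub_res_dotProduct A p u) hεC fun k => by
    by_cases hk : P.mat k = A
    · exact Or.inr (h1 k hk)
    · exact Or.inl (hε0 k hk)
  have hτ' : 0 ≤ τ + m * (C * m * τ * B) := by positivity
  obtain ⟨δ, hδ0, hδ, hδC⟩ := hA' _ (P.one_sub_res_mulVec_mem A.flip p (M *ᵥ R *ᵥ u))
  have hRu : R *ᵥ u = u - (1 - R) *ᵥ u := by simp [Matrix.sub_mulVec]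
  have hbd2 := projection_coeff_bound hC hτ' hδ (P.one_sub_res_dotProduct A.flip p _) hδC
    fun j => by
      by_cases hj : P.mat j = A.flip
      · right
        have e1 : P.hvec j p ⬝ᵥ M *ᵥ R *ᵥ u = (fun α => p α (Sum.inr j)) ⬝ᵥ R *ᵥ u := by
          rw [hp, P.gvars_inr s hj, AVar.eval_flip, ← hM, Matrix.dotProduct_mulVec,
            ← Matrix.mulVec_transpose]
        rw [e1, hRu, dotProduct_sub, hε, dotProduct_sum, mul_sub, Finset.mul_sum]
        refine (abs_sub _ _).trans (add_le_add (h2 j hj) ?_)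
        refine (Finset.abs_sum_le_sum_abs _ _).trans ?_
        have : ∀ k ∈ Finset.univ, |1 / (n : ℝ) * ((fun α => p α (Sum.inr j)) ⬝ᵥ
            ε k • P.hvec k p)| ≤ C * m * τ * B := fun k _ => by
          rw [dotProduct_smul, smul_eq_mul, mul_left_comm, abs_mul]
          exact mul_le_mul (hbd1.2 k) (h3 j k) (abs_nonneg _) (by positivity)
        simpa using Finset.sum_le_card_nsmul _ _ _ this
      · exact Or.inl (hδ0 j hj)
  refine ⟨hbd1.1, ε, δ, hbd1.2, hbd2.2, fun α => ?_⟩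
  have hd : P.drift A h b s = M *ᵥ (1 - R) *ᵥ u + (1 - L) *ᵥ M *ᵥ R *ᵥ u := by
    rw [drift, ← hp, ← hM, ← hR, ← hL, ← hu]
    simp only [Matrix.sub_mulVec, Matrix.one_mulVec, Matrix.mulVec_sub, ← Matrix.mulVec_mulVec]
    abel
  rw [hd, hε, hδ, Matrix.mulVec_sum, Pi.add_apply, Finset.sum_apply, Finset.sum_apply]
  congr 1
  refine Finset.sum_congr rfl fun k _ => ?_
  by_cases hk : P.mat k = A
  · rw [Matrix.mulVec_smul, ← P.gvars_inr s hk]; rfl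
  · simp [hε0 k hk]

end Program

section

variable [Fintype ι] [DecidableEq ι] [Fintype κ] {σ : κ → ℝ≥0} {μ : ι → ℝ} {S : Matrix ι ι ℝ}
  {m : ℕ} {P : Program ι κ m} {A : AVar κ} {h : HVar (ι ⊕ Fin m)} {b : Fin m → ℝ}

lemma Program.Converges.dotProduct (H : P.Converges σ μ S) {f g : (ι ⊕ Fin m → ℝ) → ℝ}
    (hf : Measurable f) (hf' : PolyBd f) (hg : Measurable g) (hg' : PolyBd g) :
    ∀ᵐ s ∂(jointLaw (κ := κ) σ μ S), Tendsto (fun n : ℕ => 1 / (n : ℝ) *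
      ((fun α => f (P.gvars (s n) α)) ⬝ᵥ fun α => g (P.gvars (s n) α))) atTop
      (𝓝 (∫ z, f z * g z ∂(P.limitLaw σ μ S))) :=
  H.mean (hf.mul hg) (hf'.mul hg')

lemma Program.Converges.drift_small (H : P.Converges σ μ S) (hP : P.PolyBounded)
    (hh : h.PolyBounded) (hb : P.IsResidual A h (P.limitLaw σ μ S) b)
    (horth : ∀ j, P.mat j = A.flip →
      ∫ z, P.residual h b z * z (Sum.inr j) ∂(P.limitLaw σ μ S) = 0) :
    ∀ᵐ s ∂(jointLaw (κ := κ) σ μ S), ∀ ω > 0, ∀ᶠ n : ℕ in atTop,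
      1 / (n : ℝ) * ((1 - P.res A (P.gvars (s n))) *ᵥ P.residualVec h b (P.gvars (s n)) ⬝ᵥ
        (1 - P.res A (P.gvars (s n))) *ᵥ P.residualVec h b (P.gvars (s n))) ≤ ω ∧
      ∃ ε δ : Fin m → ℝ, (∀ k, |ε k| ≤ ω) ∧ (∀ k, |δ k| ≤ ω) ∧
        ∀ α, P.drift A h b (s n) α = ∑ k, ε k * P.gvars (s n) α (Sum.inr k)
          + ∑ k, δ k * P.hfn k (P.gvars (s n) α) := by
  set ν := P.limitLaw σ μ S with hν
  obtain ⟨C₁, hC₁, hs₁⟩ := H.span_control hP A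
  obtain ⟨C₂, hC₂, hs₂⟩ := H.span_control hP A.flip
  set C := max C₁ C₂ with hC
  have hC0 : 0 < C := hC₁.trans_le (le_max_left _ _)
  have hr := polyBd_residual hP hh b
  have hrm := measurable_residual hP hh b
  have e1 := ae_all_iff.2 fun k => H.dotProduct (measurable_hfn hP k) (polyBd_hfn hP k) hrm hr
  have e2 := ae_all_iff.2 fun j : Fin m =>
    H.dotProduct (measurable_pi_apply (Sum.inr j)) (PolyBd.eval (Sum.inr j)) hrm hr
  have e3 := ae_all_iff.2 fun j : Fin m => ae_all_iff.2 fun k : Fin m =>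
    H.dotProduct (measurable_pi_apply (Sum.inr j)) (PolyBd.eval (Sum.inr j))
      (measurable_hfn hP k) (polyBd_hfn hP k)
  set B : ℝ := 1 + ∑ j : Fin m, ∑ k, |∫ z, z (Sum.inr j) * P.hfn k z ∂ν| with hB
  have hB0 : 0 ≤ B := by positivity
  filter_upwards [hs₁, hs₂, e1, e2, e3] with s hs₁ hs₂ e1 e2 e3 ω hω
  obtain ⟨τ, hτ0, hτ1, hτ2, hτ3⟩ : ∃ τ : ℝ, 0 < τ ∧ C * m ^ 2 * τ ^ 2 ≤ ω ∧ C * m * τ ≤ ω ∧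
      C * m * (τ + m * (C * m * τ * B)) ≤ ω := by
    have t1 : Tendsto (fun τ : ℝ => C * m ^ 2 * τ ^ 2) (𝓝[>] 0) (𝓝 0) := by
      have : Continuous fun τ : ℝ => C * m ^ 2 * τ ^ 2 := by fun_prop
      simpa using (this.tendsto 0).mono_left nhdsWithin_le_nhds
    have t2 : Tendsto (fun τ : ℝ => C * m * τ) (𝓝[>] 0) (𝓝 0) := by
      have : Continuous fun τ : ℝ => C * m * τ := by fun_prop
      simpa using (this.tendsto 0).mono_left nhdsWithin_le_nhds
    have t3 : Tendsto (fun τ : ℝ => C * m * (τ + m * (C * m * τ * B))) (𝓝[>] 0) (𝓝 0) := by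
      have : Continuous fun τ : ℝ => C * m * (τ + m * (C * m * τ * B)) := by fun_prop
      simpa using (this.tendsto 0).mono_left nhdsWithin_le_nhds
    obtain ⟨τ, hτ⟩ := (eventually_mem_nhdsWithin.and ((t1.eventually_le_const hω).and
      ((t2.eventually_le_const hω).and (t3.eventually_le_const hω)))).exists
    exact ⟨τ, hτ⟩
  have f1 : ∀ᶠ n : ℕ in atTop, ∀ k, P.mat k = A → |1 / (n : ℝ) *
      (P.hvec k (P.gvars (s n)) ⬝ᵥ P.residualVec h b (P.gvars (s n)))| ≤ τ := by
    simp only [eventually_all]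
    intro k hk
    have h0 : ∫ z, P.hfn k z * P.residual h b z ∂ν = 0 := by
      simp only [mul_comm (P.hfn k _)]; exact hb.orthogonal k hk
    have := (e1 k).abs
    rw [h0, abs_zero] at this
    exact this.eventually_le_const hτ0
  have f2 : ∀ᶠ n : ℕ in atTop, ∀ j, P.mat j = A.flip → |1 / (n : ℝ) *
      ((fun α => P.gvars (s n) α (Sum.inr j)) ⬝ᵥ P.residualVec h b (P.gvars (s n)))| ≤ τ := by
    simp only [eventually_all]
    intro j hj
    have h0 : ∫ z, z (Sum.inr j) * P.residual h b z ∂ν = 0 := by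
      rw [← horth j hj]; congr 1; funext z; ring
    have := (e2 j).abs
    rw [h0, abs_zero] at this
    exact this.eventually_le_const hτ0
  have f3 : ∀ᶠ n : ℕ in atTop, ∀ j k, |1 / (n : ℝ) *
      ((fun α => P.gvars (s n) α (Sum.inr j)) ⬝ᵥ P.hvec k (P.gvars (s n)))| ≤ B := by
    simp only [eventually_all]
    intro j k
    refine (e3 j k).abs.eventually_le_const ?_
    have h4 : |∫ z, z (Sum.inr j) * P.hfn k z ∂ν|
        ≤ ∑ k, |∫ z, z (Sum.inr j) * P.hfn k z ∂ν| :=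
      Finset.single_le_sum (f := fun k => |∫ z, z (Sum.inr j) * P.hfn k z ∂ν|)
        (fun _ _ => abs_nonneg _) (Finset.mem_univ k)
    have h5 : ∑ k, |∫ z, z (Sum.inr j) * P.hfn k z ∂ν|
        ≤ ∑ j : Fin m, ∑ k, |∫ z, z (Sum.inr j) * P.hfn k z ∂ν| :=
      Finset.single_le_sum (f := fun j : Fin m => ∑ k, |∫ z, z (Sum.inr j) * P.hfn k z ∂ν|)
        (fun _ _ => Finset.sum_nonneg fun _ _ => abs_nonneg _) (Finset.mem_univ j)
    rw [hB]
    linarith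
  filter_upwards [hs₁, hs₂, f1, f2, f3] with n hs₁ hs₂ f1 f2 f3
  have hmono {A' : AVar κ} {C' : ℝ} (hC' : C' ≤ C) (hs : P.SpanBound A' C' (P.gvars (s n))) :
      P.SpanBound A' C (P.gvars (s n)) := fun v hv => by
    obtain ⟨a, h1, h2, h3⟩ := hs v hv
    refine ⟨a, h1, h2, fun k => (h3 k).trans ?_⟩
    exact mul_le_mul_of_nonneg_right hC'
      (mul_nonneg (by positivity) (dotProduct_self_nonneg' v))
  obtain ⟨g1, ε, δ, g2, g3, g4⟩ := P.drift_bound hC0 hτ0.le hB0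
    (hmono (le_max_left _ _) fun v hv => (hs₁ v hv).1)
    (hmono (le_max_right _ _) fun v hv => (hs₂ v hv).1) f1 f2 f3
  exact ⟨g1.trans hτ1, ε, δ, fun k => (g2 k).trans hτ2, fun k => (g3 k).trans hτ3, g4⟩

lemma Program.Converges.tendsto_res_residualVec (H : P.Converges σ μ S) (hP : P.PolyBounded)
    (hh : h.PolyBounded) (hb : P.IsResidual A h (P.limitLaw σ μ S) b)
    (horth : ∀ j, P.mat j = A.flip →
      ∫ z, P.residual h b z * z (Sum.inr j) ∂(P.limitLaw σ μ S) = 0) :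
    ∀ᵐ s ∂(jointLaw (κ := κ) σ μ S), Tendsto (fun n : ℕ => 1 / (n : ℝ) *
      (P.res A (P.gvars (s n)) *ᵥ P.residualVec h b (P.gvars (s n)) ⬝ᵥ
        P.res A (P.gvars (s n)) *ᵥ P.residualVec h b (P.gvars (s n)))) atTop
      (𝓝 (∫ z, P.residual h b z ^ 2 ∂(P.limitLaw σ μ S))) := by
  have hr := polyBd_residual hP hh b
  have hrm := measurable_residual hP hh b
  filter_upwards [H.drift_small hP hh hb horth, H.dotProduct hrm hr hrm hr] with s hs1 hs2
  have h1 : Tendsto (fun n : ℕ => 1 / (n : ℝ) *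
      ((1 - P.res A (P.gvars (s n))) *ᵥ P.residualVec h b (P.gvars (s n)) ⬝ᵥ
        (1 - P.res A (P.gvars (s n))) *ᵥ P.residualVec h b (P.gvars (s n)))) atTop (𝓝 0) := by
    refine Metric.tendsto_nhds.2 fun ε hε => ?_
    filter_upwards [hs1 (ε / 2) (half_pos hε)] with n hn
    rw [Real.dist_0_eq_abs, abs_of_nonneg (mul_nonneg (by positivity) (dotProduct_self_nonneg' _))]
    linarith [hn.1]
  have h2 := hs2.sub h1
  rw [sub_zero] at h2
  simp only [← sq] at h2
  refine h2.congr fun n => ?_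
  set R := P.res A (P.gvars (s n)) with hR
  set u := P.residualVec h b (P.gvars (s n)) with hu
  rw [show ((fun α => P.residual h b (P.gvars (s n) α)) ⬝ᵥ
    fun α => P.residual h b (P.gvars (s n) α)) = u ⬝ᵥ u from rfl, P.one_sub_res_dotProduct,
    ← mul_sub, Matrix.sub_mulVec, Matrix.one_mulVec, sub_dotProduct, sub_sub_cancel,
    dotProduct_mulVec_symm (P.res_transpose _ _) u (_ *ᵥ u), Matrix.mulVec_mulVec, P.res_mul_self,
    dotProduct_comm]

end

/-! ### The conditional law of the newest G-var -/

lemma AVar.gaussianMatrix_map_orient_mulVec (A : AVar κ) {n : ℕ} (v : ℝ≥0) (a : Fin n → ℝ) :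
    (gaussianMatrix n v).map (fun V => A.orient V *ᵥ a)
      = (Measure.pi fun _ : Fin n => gaussianReal 0 1).map fun ζ => √(v * (a ⬝ᵥ a)) • ζ := by
  cases A with
  | input w => exact gaussianMatrix_map_mulVec v a
  | transpose w => exact gaussianMatrix_map_transpose_mulVec v a

lemma AVar.measurable_orient_mulVec (A : AVar κ) {n : ℕ} (a : Fin n → ℝ) :
    Measurable fun V : Fin n → Fin n → ℝ => A.orient V *ᵥ a := by
  have (i : Fin n) : Measurable fun V : Fin n → Fin n → ℝ => ∑ j, A.orient V i j * a j := by
    cases A <;> simp only [orient, eval, Matrix.of_apply, Matrix.transpose_apply] <;> fun_prop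
  exact measurable_pi_lambda _ this

namespace Program

variable {m n : ℕ} {P : Program ι κ m} {A : AVar κ} {h : HVar (ι ⊕ Fin m)} {b : Fin m → ℝ}

lemma gvars_matmul (hb : ∀ l, P.mat l ≠ A → b l = 0) (s : Inputs ι κ n) (α : Fin n) :
    (P.matmul A h).gvars s α = extend (P.gvars s α) (∑ l, b l * P.gvars s α (Sum.inr l)
      + (A.eval (fun W => Matrix.of (s.1 W)) *ᵥ P.residualVec h b (P.gvars s)) α) := by
  have h1 : P.evalH h (fun W => Matrix.of (s.1 W)) s.2
      = (∑ l, b l • P.hvec l (P.gvars s)) + P.residualVec h b (P.gvars s) := by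
    funext β
    simp only [evalH, residualVec, residual, hvec, Pi.add_apply, Finset.sum_apply, Pi.smul_apply,
      smul_eq_mul, add_sub_cancel]
    rfl
  rw [gvars, eval_matmul, h1, Matrix.mulVec_add, Matrix.mulVec_sum, Pi.add_apply, Finset.sum_apply]
  change extend (P.gvars s α) _ = _
  congr 2
  refine Finset.sum_congr rfl fun l _ => ?_
  by_cases hl : P.mat l = A
  · rw [Matrix.mulVec_smul, ← P.gvars_inr s hl]; rfl
  · simp [hb l hl]

lemma gvars_matmul_resample (hb : ∀ l, P.mat l ≠ A → b l = 0) (s : Inputs ι κ n)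
    (V : Fin n → Fin n → ℝ) (α : Fin n) :
    (P.matmul A h).gvars (P.resample A.base s V) α
      = extend (P.gvars s α) (∑ l, b l * P.gvars s α (Sum.inr l) + P.drift A h b s α
        + (P.res A.flip (P.gvars s) *ᵥ A.orient V *ᵥ
          (P.res A (P.gvars s) *ᵥ P.residualVec h b (P.gvars s))) α) := by
  rw [gvars_matmul hb, gvars_resample, eval_resample, Matrix.add_mulVec, Pi.add_apply, drift,
    ← add_assoc]
  simp only [Matrix.mulVec_mulVec, Matrix.mul_assoc]

/-- The conditional standard deviation of the newest G-var. -/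
def stdAt (σ : κ → ℝ≥0) (P : Program ι κ m) (A : AVar κ) (h : HVar (ι ⊕ Fin m)) (b : Fin m → ℝ)
    (s : Inputs ι κ n) : ℝ :=
  √(((σ A.base ^ 2 / n : ℝ≥0) : ℝ) *
    (P.res A (P.gvars s) *ᵥ P.residualVec h b (P.gvars s) ⬝ᵥ
      P.res A (P.gvars s) *ᵥ P.residualVec h b (P.gvars s)))

lemma resample_kernel_le (σ : κ → ℝ≥0) (hb : ∀ l, P.mat l ≠ A → b l = 0) (s : Inputs ι κ n)
    (b' : Bool)
    (hI : ∀ v ∈ P.hspan A.flip (P.gvars s),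
      ∑ α : Fin n with α.val.bodd = b', v α ^ 2 ≤ 2 / 3 * (v ⬝ᵥ v))
    {Q : Set (Fin n → ι ⊕ Fin (m + 1) → ℝ)} (hQ : MeasurableSet Q)
    (hQI : ∀ x y : Fin n → ι ⊕ Fin (m + 1) → ℝ, (∀ α, α.val.bodd = b' → x α = y α) →
      x ∈ Q → y ∈ Q) :
    gaussianMatrix n (σ A.base ^ 2 / n)
        {V | (P.matmul A h).gvars (P.resample A.base s V) ∈ Q}
      ≤ 2 ^ m * (Measure.pi fun _ : Fin n => gaussianReal 0 1) {y | (fun α =>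
          extend (P.gvars s α) (∑ l, b l * P.gvars s α (Sum.inr l) + (P.drift A h b s α
            + P.stdAt σ A h b s * y α))) ∈ Q} := by
  set p := P.gvars s with hp
  set L := P.res A.flip p with hL
  set a := P.res A p *ᵥ P.residualVec h b p with ha
  set T : (Fin n → ℝ) → Fin n → ι ⊕ Fin (m + 1) → ℝ := fun y α =>
    extend (p α) (∑ l, b l * p α (Sum.inr l) + (P.drift A h b s α + y α)) with hT
  have hTm : Measurable T := by
    refine measurable_pi_lambda _ fun α => ?_
    have : Measurable fun y : Fin n → ℝ =>
      ∑ l, b l * p α (Sum.inr l) + (P.drift A h b s α + y α) := by fun_prop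
    exact measurable_extend.comp (measurable_const.prodMk this)
  set c := P.stdAt σ A h b s with hc
  have e1 : {V | (P.matmul A h).gvars (P.resample A.base s V) ∈ Q}
      = (fun V => A.orient V *ᵥ a) ⁻¹' {x | T (L *ᵥ x) ∈ Q} := by
    ext V
    have : (P.matmul A h).gvars (P.resample A.base s V) = T (L *ᵥ A.orient V *ᵥ a) := by
      funext α
      rw [gvars_matmul_resample hb, add_assoc]
    change _ ∈ Q ↔ _ ∈ Q
    rw [this]
  have hm1 : MeasurableSet {x | T (L *ᵥ x) ∈ Q} := (hTm.comp (measurable_mulVec L)) hQ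
  have hcm : Measurable fun ζ : Fin n → ℝ => c • ζ := by fun_prop
  rw [e1, ← Measure.map_apply (A.measurable_orient_mulVec a) hm1,
    A.gaussianMatrix_map_orient_mulVec, Measure.map_apply (by fun_prop) hm1]
  obtain ⟨e, he, hes⟩ := P.one_sub_res_eq_sum A.flip p
  have := pi_gaussianReal_preimage_projection_le (fun α : Fin n => α.val.bodd = b') e he
    (P.res_mul_self _ _) (fun x => hI _ (P.one_sub_res_mulVec_mem A.flip p x))
    (B := {y | T (c • y) ∈ Q}) ((hTm.comp hcm) hQ) fun x y hxy hx => by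
      refine hQI _ _ (fun α hα => ?_) hx
      simp only [hT, Pi.smul_apply, hxy α hα]
  refine le_trans (le_of_eq ?_) (this.trans (le_of_eq ?_))
  · congr 1
    ext ζ
    change T (L *ᵥ c • ζ) ∈ Q ↔ T (c • L *ᵥ ζ) ∈ Q
    rw [Matrix.mulVec_smul]
  · rfl

end Program

/-- Chebyshev's inequality for fourth moments, for the coordinates of one parity. -/
lemma pi_parityMean_deviation_le {n : ℕ} (hn : 0 < n) (b : Bool) {ρ : Measure ℝ}
    [IsProbabilityMeasure ρ] {F : Fin n → ℝ → ℝ} (hFm : ∀ α, Measurable (F α))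
    (hF : ∀ α, MemLp (F α) 4 ρ) {c : Fin n → ℝ} {t M : ℝ} (ht : 0 < t)
    (hc : |(parityMean b fun α => ∫ y, F α y ∂ρ) - parityMean b c| ≤ t / 2)
    (hM : 1 / (n : ℝ) * ∑ α, ∫ y, F α y ^ 4 ∂ρ ≤ M) :
    (Measure.pi fun _ : Fin n => ρ) {y | t ≤ |(parityMean b fun α => F α (y α)) - parityMean b c|}
      ≤ ENNReal.ofReal (1024 * M / t ^ 4 / (n : ℝ) ^ 2) := by
  have hn' : (0 : ℝ) < n := by exact_mod_cast hn
  have h1 := pi_sum_deviation_le (P := fun _ : Fin n => ρ) hFm hF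
    (Finset.univ.filter fun α : Fin n => α.val.bodd = b) (t := n * (t / 2)) (by positivity)
  refine (measure_mono fun y hy => ?_).trans (h1.trans (ENNReal.ofReal_le_ofReal ?_))
  · have hy' : t ≤ |(parityMean b fun α => F α (y α)) - parityMean b c| := hy
    have h2 : t / 2 ≤ |(parityMean b fun α => F α (y α)) - parityMean b fun α => ∫ y, F α y ∂ρ| := by
      have := abs_sub_le (parityMean b fun α => F α (y α)) (parityMean b fun α => ∫ y, F α y ∂ρ)
        (parityMean b c)
      linarith
    rw [parityMean, parityMean, ← mul_sub, abs_mul, abs_of_nonneg (by positivity),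
      div_mul_eq_mul_div, one_mul, le_div_iff₀ hn', mul_comm] at h2
    exact h2
  · have h2 : ∑ α : Fin n with α.val.bodd = b, ∫ y, F α y ^ 4 ∂ρ ≤ n * M := by
      have h3 : ∑ α : Fin n with α.val.bodd = b, ∫ y, F α y ^ 4 ∂ρ ≤ ∑ α, ∫ y, F α y ^ 4 ∂ρ :=
        Finset.sum_le_sum_of_subset_of_nonneg (Finset.filter_subset _ _) fun _ _ _ =>
          integral_nonneg fun _ => by positivity
      rw [div_mul_eq_mul_div, one_mul, div_le_iff₀ hn'] at hM
      linarith
    rw [div_div, div_le_div_iff₀ (by positivity) (by positivity)]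
    calc _ ≤ 64 * (n : ℝ) * (n * M) * (t ^ 4 * n ^ 2) := by gcongr
      _ = _ := by ring

section Shifted

variable {m : ℕ} (ψ : (ι ⊕ Fin m.succ → ℝ) → ℝ) (b : Fin m → ℝ)

/-- `ψ` as a function of the old G-vars and of the deviation of the newest G-var from a linear
combination of them. -/
def shifted (z : ι ⊕ Fin m → ℝ) (y : ℝ) : ℝ := ψ (extend z (∑ l, b l * z (Sum.inr l) + y))

variable {ψ}

lemma measurable_shifted (hψ : Measurable ψ) :
    Measurable fun p : (ι ⊕ Fin m → ℝ) × ℝ => shifted ψ b p.1 p.2 := by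
  have : Measurable fun p : (ι ⊕ Fin m → ℝ) × ℝ => ∑ l, b l * p.1 (Sum.inr l) + p.2 := by fun_prop
  exact hψ.comp (measurable_extend.comp (measurable_fst.prodMk this))

variable [Fintype ι]

lemma norm_extend_le (z : ι ⊕ Fin m → ℝ) (t : ℝ) : ‖extend z t‖ ≤ ‖z‖ + |t| := by
  refine (pi_norm_le_iff_of_nonneg (by positivity)).2 fun g => ?_
  rcases g with i | l
  · rw [extend_inl]
    linarith [norm_le_pi_norm z (Sum.inl i), abs_nonneg t]
  · induction l using Fin.lastCases with
    | last => rw [extend_last, Real.norm_eq_abs]; linarith [norm_nonneg z]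
    | cast l =>
      rw [extend_castSucc]
      linarith [norm_le_pi_norm z (Sum.inr l), abs_nonneg t]

lemma PolyBd.exists_shifted_bound (hψ : PolyBd ψ) :
    ∃ C ≥ 0, ∃ q : ℕ, ∀ z y, |shifted ψ b z y| ≤ C * (1 + ‖z‖) ^ q * (1 + |y|) ^ q := by
  obtain ⟨C, q, hC, hψ⟩ := hψ
  set B := ∑ l, |b l| with hB
  have hB0 : 0 ≤ B := Finset.sum_nonneg fun _ _ => abs_nonneg _
  refine ⟨C * (1 + B) ^ q, by positivity, q, fun z y => (hψ _).trans ?_⟩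
  have h1 : |∑ l, b l * z (Sum.inr l)| ≤ B * ‖z‖ := by
    refine (Finset.abs_sum_le_sum_abs _ _).trans ?_
    rw [hB, Finset.sum_mul]
    refine Finset.sum_le_sum fun l _ => ?_
    rw [abs_mul]
    exact mul_le_mul_of_nonneg_left (norm_le_pi_norm z (Sum.inr l)) (abs_nonneg _)
  have h2 : 1 + ‖extend z (∑ l, b l * z (Sum.inr l) + y)‖ ≤ (1 + B) * (1 + ‖z‖) * (1 + |y|) := by
    have h3 := norm_extend_le z (∑ l, b l * z (Sum.inr l) + y)
    have h4 := abs_add_le (∑ l, b l * z (Sum.inr l)) y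
    have h5 := norm_nonneg z
    have h6 := abs_nonneg y
    nlinarith [mul_nonneg hB0 h5, mul_nonneg hB0 h6, mul_nonneg h5 h6,
      mul_nonneg (mul_nonneg hB0 h5) h6]
  calc C * (1 + ‖extend z (∑ l, b l * z (Sum.inr l) + y)‖) ^ q
      ≤ C * ((1 + B) * (1 + ‖z‖) * (1 + |y|)) ^ q := by gcongr
    _ = _ := by rw [mul_pow, mul_pow]; ring

end Shifted

/-! ### The law of large numbers for the newest G-var -/

lemma parityMean_le_mean (b : Bool) {n : ℕ} {f : Fin n → ℝ} (hf : ∀ α, 0 ≤ f α) :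
    parityMean b f ≤ 1 / (n : ℝ) * ∑ α, f α :=
  mul_le_mul_of_nonneg_left (Finset.sum_le_sum_of_subset_of_nonneg (Finset.filter_subset _ _)
    fun α _ _ => hf α) (by positivity)

lemma parityMean_congr (b : Bool) {n : ℕ} {f g : Fin n → ℝ}
    (h : ∀ α : Fin n, α.val.bodd = b → f α = g α) : parityMean b f = parityMean b g := by
  unfold parityMean
  congr 1
  exact Finset.sum_congr rfl fun α hα => h α (Finset.mem_filter.1 hα).2

lemma integrable_one_add_mul_abs_pow (c : ℝ) (q : ℕ) :
    Integrable (fun t : ℝ => (1 + c * |t|) ^ q) (gaussianReal 0 1) := by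
  have h1 : PolyBd fun t : ℝ => (1 + c * |t|) ^ q :=
    ((PolyBd.const 1).add (PolyBd.norm.const_mul c)).pow q
  exact h1.integrable (by fun_prop) _

section Shifted

variable [Fintype ι] {m : ℕ} {ψ : (ι ⊕ Fin m.succ → ℝ) → ℝ} {b : Fin m → ℝ} {C : ℝ} {q : ℕ}

lemma measurable_integral_shifted (hψ : Measurable ψ) (c : ℝ) :
    Measurable fun z => ∫ t, shifted ψ b z (c * t) ∂(gaussianReal 0 1) := by
  have h1 : Measurable fun p : (ι ⊕ Fin m → ℝ) × ℝ => shifted ψ b p.1 (c * p.2) :=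
    (measurable_shifted b hψ).comp (measurable_fst.prodMk (measurable_snd.const_mul c))
  exact (h1.stronglyMeasurable.integral_prod_right' (ν := gaussianReal 0 1)).measurable

lemma abs_shifted_le (hC : 0 ≤ C)
    (hψb : ∀ z y, |shifted ψ b z y| ≤ C * (1 + ‖z‖) ^ q * (1 + |y|) ^ q) {c c₁ : ℝ}
    (hc : |c| ≤ c₁) (z : ι ⊕ Fin m → ℝ) (d t : ℝ) :
    |shifted ψ b z (d + c * t)|
      ≤ C * (1 + ‖z‖) ^ q * (1 + |d|) ^ q * (1 + c₁ * |t|) ^ q := by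
  refine (hψb z _).trans ?_
  have h0 : 0 ≤ c₁ := (abs_nonneg c).trans hc
  have h1 : 1 + |d + c * t| ≤ (1 + |d|) * (1 + c₁ * |t|) := by
    have h2 := abs_add_le d (c * t)
    rw [abs_mul] at h2
    have h3 := mul_le_mul_of_nonneg_right hc (abs_nonneg t)
    have h4 : 0 ≤ |d| * (c₁ * |t|) := by positivity
    nlinarith
  calc _ ≤ C * (1 + ‖z‖) ^ q * ((1 + |d|) * (1 + c₁ * |t|)) ^ q := by gcongr
    _ = _ := by rw [mul_pow]; ring

lemma memLp_shifted (hψ : Measurable ψ) (hC : 0 ≤ C)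
    (hψb : ∀ z y, |shifted ψ b z y| ≤ C * (1 + ‖z‖) ^ q * (1 + |y|) ^ q)
    (z : ι ⊕ Fin m → ℝ) (d c : ℝ) :
    MemLp (fun t => shifted ψ b z (d + c * t)) 4 (gaussianReal 0 1) := by
  have hm : Measurable fun t => shifted ψ b z (d + c * t) :=
    (measurable_shifted b hψ).comp (measurable_const.prodMk (by fun_prop))
  have h1 : PolyBd fun t => shifted ψ b z (d + c * t) := by
    have h2 : PolyBd fun t : ℝ => (1 + |c| * |t|) ^ q :=
      ((PolyBd.const 1).add (PolyBd.norm.const_mul |c|)).pow q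
    exact (h2.const_mul (C * (1 + ‖z‖) ^ q * (1 + |d|) ^ q)).mono fun t =>
      (abs_shifted_le hC hψb le_rfl z d t).trans (le_abs_self _)
  exact h1.memLp_four hm _

lemma integral_shifted_pow_four_le (hC : 0 ≤ C)
    (hψb : ∀ z y, |shifted ψ b z y| ≤ C * (1 + ‖z‖) ^ q * (1 + |y|) ^ q) {c c₁ : ℝ}
    (hc : |c| ≤ c₁) (z : ι ⊕ Fin m → ℝ) {d e : ℝ} (hd : |d| ≤ e) :
    ∫ t, shifted ψ b z (d + c * t) ^ 4 ∂(gaussianReal 0 1)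
      ≤ (∫ t, (1 + c₁ * |t|) ^ (q * 4) ∂(gaussianReal 0 1))
        * (C * (1 + ‖z‖) ^ q * (1 + e) ^ q) ^ 4 := by
  rw [mul_comm, ← integral_const_mul]
  refine integral_mono_of_nonneg (ae_of_all _ fun t => by positivity)
    ((integrable_one_add_mul_abs_pow c₁ (q * 4)).const_mul _) (ae_of_all _ fun t => ?_)
  have h0 : 0 ≤ c₁ := (abs_nonneg c).trans hc
  have h1 := abs_shifted_le hC hψb hc z d t
  calc shifted ψ b z (d + c * t) ^ 4 = |shifted ψ b z (d + c * t)| ^ 4 := by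
        rw [Even.pow_abs (by decide)]
    _ ≤ (C * (1 + ‖z‖) ^ q * (1 + |d|) ^ q * (1 + c₁ * |t|) ^ q) ^ 4 := by gcongr
    _ ≤ (C * (1 + ‖z‖) ^ q * (1 + e) ^ q * (1 + c₁ * |t|) ^ q) ^ 4 := by gcongr
    _ = _ := by rw [mul_pow _ ((1 + c₁ * |t|) ^ q), ← pow_mul]

lemma polyBd_integral_shifted (hC : 0 ≤ C)
    (hψb : ∀ z y, |shifted ψ b z y| ≤ C * (1 + ‖z‖) ^ q * (1 + |y|) ^ q) (c : ℝ) :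
    PolyBd fun z => ∫ t, shifted ψ b z (c * t) ∂(gaussianReal 0 1) := by
  have h2 : PolyBd fun z : ι ⊕ Fin m → ℝ => (1 + ‖z‖) ^ q := ((PolyBd.const 1).add PolyBd.norm).pow q
  refine (h2.const_mul (C * ∫ t, (1 + |c| * |t|) ^ q ∂(gaussianReal 0 1))).mono fun z => ?_
  refine le_trans ?_ (le_abs_self _)
  have h3 : C * (∫ t, (1 + |c| * |t|) ^ q ∂(gaussianReal 0 1)) * (1 + ‖z‖) ^ q
      = ∫ t, C * (1 + ‖z‖) ^ q * (1 + |c| * |t|) ^ q ∂(gaussianReal 0 1) := by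
    rw [integral_const_mul]; ring
  rw [h3]
  refine abs_integral_le_integral_abs.trans ?_
  refine integral_mono_of_nonneg (ae_of_all _ fun t => abs_nonneg _)
    ((integrable_one_add_mul_abs_pow |c| q).const_mul _) (ae_of_all _ fun t => ?_)
  simpa using abs_shifted_le hC hψb le_rfl z 0 t

end Shifted

section

variable [Fintype ι] [DecidableEq ι] [Fintype κ] {σ : κ → ℝ≥0} {μ : ι → ℝ} {S : Matrix ι ι ℝ}
  {m : ℕ} {P : Program ι κ m} {A : AVar κ} {h : HVar (ι ⊕ Fin m)} {b : Fin m → ℝ}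

lemma integral_integral_shifted (Hc : P.CovSpec σ μ S) (hP : P.PolyBounded)
    (hh : h.PolyBounded) (hb : P.IsResidual A h (P.limitLaw σ μ S) b)
    {ψ : (ι ⊕ Fin (m + 1) → ℝ) → ℝ} (hψm : Measurable ψ) (hψ : PolyBd ψ) :
    ∫ z, (∫ t, shifted ψ b z (P.limitStd σ μ S A h b * t) ∂(gaussianReal 0 1))
        ∂(P.limitLaw σ μ S)
      = ∫ z, ψ z ∂((P.matmul A h).limitLaw σ μ S) := by
  have hi := hψ.integrable hψm ((P.matmul A h).limitLaw σ μ S)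
  have hm : Measurable fun p : (ι ⊕ Fin m → ℝ) × ℝ =>
      extend p.1 (∑ l, b l * p.1 (Sum.inr l) + P.limitStd σ μ S A h b * p.2) := by
    have : Measurable fun p : (ι ⊕ Fin m → ℝ) × ℝ =>
        ∑ l, b l * p.1 (Sum.inr l) + P.limitStd σ μ S A h b * p.2 := by fun_prop
    exact measurable_extend.comp (measurable_fst.prodMk this)
  rw [Hc.limitLaw_matmul hP hh hb] at hi ⊢
  rw [integral_map hm.aemeasurable hψm.aestronglyMeasurable, integral_prod]
  · rfl
  · exact (integrable_map_measure hψm.aestronglyMeasurable hm.aemeasurable).1 hi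

lemma Program.Converges.tendsto_stdAt (H : P.Converges σ μ S) (hP : P.PolyBounded)
    (hh : h.PolyBounded) (hb : P.IsResidual A h (P.limitLaw σ μ S) b)
    (horth : ∀ j, P.mat j = A.flip →
      ∫ z, P.residual h b z * z (Sum.inr j) ∂(P.limitLaw σ μ S) = 0) :
    ∀ᵐ s ∂(jointLaw (κ := κ) σ μ S), Tendsto (fun n => P.stdAt σ A h b (s n)) atTop
      (𝓝 (P.limitStd σ μ S A h b)) := by
  filter_upwards [H.tendsto_res_residualVec hP hh hb horth] with s hs
  refine ((hs.const_mul ((σ A.base : ℝ) ^ 2)).sqrt).congr fun n => ?_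
  rw [stdAt]
  congr 1
  push_cast
  ring

/-- The size of the conditional mean of the newest G-var. -/
def Program.driftScale (P : Program ι κ m) (z : ι ⊕ Fin m → ℝ) : ℝ :=
  ∑ k, |z (Sum.inr k)| + ∑ k, |P.hfn k z|

lemma Program.driftScale_nonneg (P : Program ι κ m) (z : ι ⊕ Fin m → ℝ) : 0 ≤ P.driftScale z := by
  unfold driftScale; positivity

lemma Program.measurable_driftScale (hP : P.PolyBounded) : Measurable P.driftScale :=
  (Finset.measurable_sum _ fun k _ => (measurable_pi_apply (Sum.inr k)).abs).add
    (Finset.measurable_sum _ fun k _ => (measurable_hfn hP k).abs)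

lemma Program.polyBd_driftScale (hP : P.PolyBounded) : PolyBd P.driftScale :=
  (PolyBd.sum _ fun _ _ => (PolyBd.eval _).abs).add (PolyBd.sum _ fun k _ => (polyBd_hfn hP k).abs)

lemma Program.Converges.drift_le (H : P.Converges σ μ S) (hP : P.PolyBounded)
    (hh : h.PolyBounded) (hb : P.IsResidual A h (P.limitLaw σ μ S) b)
    (horth : ∀ j, P.mat j = A.flip →
      ∫ z, P.residual h b z * z (Sum.inr j) ∂(P.limitLaw σ μ S) = 0) :
    ∀ᵐ s ∂(jointLaw (κ := κ) σ μ S), ∀ ω > 0, ∀ᶠ n : ℕ in atTop, ∀ α,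
      |P.drift A h b (s n) α| ≤ ω * P.driftScale (P.gvars (s n) α) := by
  filter_upwards [H.drift_small hP hh hb horth] with s hs ω hω
  filter_upwards [hs ω hω] with n hn α
  obtain ⟨-, ε, δ, hε, hδ, hd⟩ := hn
  rw [hd, driftScale, mul_add, Finset.mul_sum, Finset.mul_sum]
  refine (abs_add_le _ _).trans (add_le_add ?_ ?_)
  · refine (Finset.abs_sum_le_sum_abs _ _).trans (Finset.sum_le_sum fun k _ => ?_)
    rw [abs_mul]
    exact mul_le_mul_of_nonneg_right (hε k) (abs_nonneg _)
  · refine (Finset.abs_sum_le_sum_abs _ _).trans (Finset.sum_le_sum fun k _ => ?_)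
    rw [abs_mul]
    exact mul_le_mul_of_nonneg_right (hδ k) (abs_nonneg _)

lemma Program.Converges.eventually_mean_le (H : P.Converges σ μ S) {f : (ι ⊕ Fin m → ℝ) → ℝ}
    (hm : Measurable f) (hf : PolyBd f) :
    ∀ᵐ s ∂(jointLaw (κ := κ) σ μ S), ∀ᶠ n : ℕ in atTop,
      1 / (n : ℝ) * ∑ α, f (P.gvars (s n) α) ≤ ∫ z, f z ∂(P.limitLaw σ μ S) + 1 := by
  filter_upwards [H.mean hm hf] with s hs
  exact hs.eventually_le_const (by linarith)

/-- With high conditional probability, the averages of `ψ` are close to the averages of its limiting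
conditional mean. -/
lemma Program.Converges.deviation_matmul (H : P.Converges σ μ S) (hP : P.PolyBounded)
    (hh : h.PolyBounded) (hb : P.IsResidual A h (P.limitLaw σ μ S) b)
    (horth : ∀ j, P.mat j = A.flip →
      ∫ z, P.residual h b z * z (Sum.inr j) ∂(P.limitLaw σ μ S) = 0)
    (hc : 0 < P.limitStd σ μ S A h b)
    {ψ : (ι ⊕ Fin (m + 1) → ℝ) → ℝ} (hψm : Measurable ψ) (hψ : PolyBd ψ) (b' : Bool) {t : ℝ}
    (ht : 0 < t) :
    ∃ K : ℝ, ∀ᵐ s ∂(jointLaw (κ := κ) σ μ S), ∀ᶠ n : ℕ in atTop,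
      gaussianMatrix n (σ A.base ^ 2 / n) {V | t ≤ |(parityMean b' fun α =>
          ψ ((P.matmul A h).gvars (P.resample A.base (s n) V) α)) - parityMean b' fun α =>
            ∫ y, shifted ψ b (restrict ((P.matmul A h).gvars (P.resample A.base (s n) V) α))
              (P.limitStd σ μ S A h b * y) ∂(gaussianReal 0 1)|}
        ≤ ENNReal.ofReal (K / (n : ℝ) ^ 2) := by
  set c : ℝ := ((P.limitStd σ μ S A h b : ℝ≥0) : ℝ) with hcdef
  have hc0 : 0 < c := hc
  obtain ⟨C, hC, q, hψb⟩ := hψ.exists_shifted_bound b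
  set Ψ : (ι ⊕ Fin m → ℝ) → ℝ := fun z => ∫ y, shifted ψ b z (c * y) ∂(gaussianReal 0 1) with hΨ
  have hΨm : Measurable Ψ := measurable_integral_shifted hψm c
  set D : (ι ⊕ Fin m → ℝ) → ℝ := fun z => C * (1 + ‖z‖) ^ q with hD
  have hD0 (z) : 0 ≤ D z := by positivity
  have hDm : Measurable D := by fun_prop
  have hDp : PolyBd D := (((PolyBd.const 1).add PolyBd.norm).pow q).const_mul C
  have hE0 := P.driftScale_nonneg
  have hEm := measurable_driftScale hP
  have hEp := polyBd_driftScale hP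
  set Θ : (ι ⊕ Fin m → ℝ) → ℝ := fun z => (D z * (1 + P.driftScale z) ^ q) ^ 4 with hΘ
  have hΘm : Measurable Θ := by fun_prop
  have hΘp : PolyBd Θ := (hDp.mul (((PolyBd.const 1).add hEp).pow q)).pow 4
  set Ξ : (ι ⊕ Fin m → ℝ) → ℝ := fun z => D z * P.driftScale z ^ (q + 1) with hΞ
  have hΞm : Measurable Ξ := by fun_prop
  have hΞp : PolyBd Ξ := hDp.mul (hEp.pow _)
  have hΞ0 (z) : 0 ≤ Ξ z := mul_nonneg (hD0 z) (pow_nonneg (hE0 z) _)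
  set J := ∫ t, (1 + (c + 1) * |t|) ^ (q * 4) ∂(gaussianReal 0 1) with hJ
  have hJ0 : 0 ≤ J := integral_nonneg fun t => by positivity
  set M := J * (∫ z, Θ z ∂(P.limitLaw σ μ S) + 1) with hM
  set M₁ := ∫ z, D z ∂(P.limitLaw σ μ S) + 1 with hM₁
  have hM₁0 : 0 < M₁ := add_pos_of_nonneg_of_pos (integral_nonneg hD0) one_pos
  set M₂ := ∫ z, Ξ z ∂(P.limitLaw σ μ S) + 1 with hM₂
  have hM₂0 : 0 < M₂ := add_pos_of_nonneg_of_pos (integral_nonneg hΞ0) one_pos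
  obtain ⟨δ, hδ, K, hK, hsmooth⟩ := exists_gaussian_smoothing_bound q hc0
    (show 0 < t / (4 * M₁) by positivity)
  set ω := min 1 (t / (4 * (K * M₂ + 1))) with hω
  have hω0 : 0 < ω := lt_min one_pos (by positivity)
  have hωt : K * ω * M₂ ≤ t / 4 := by
    have h1 : ω ≤ t / (4 * (K * M₂ + 1)) := min_le_right _ _
    rw [le_div_iff₀ (by positivity)] at h1
    have : 0 ≤ ω * 4 := by positivity
    nlinarith
  refine ⟨2 ^ m * (1024 * M / t ^ 4), ?_⟩
  obtain ⟨C', -, hspan⟩ := H.span_control hP A.flip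
  filter_upwards [hspan, H.drift_le hP hh hb horth, H.tendsto_stdAt hP hh hb horth,
    H.eventually_mean_le hΘm hΘp, H.eventually_mean_le hDm hDp, H.eventually_mean_le hΞm hΞp]
    with s h1 h2 h3 h4 h5 h6
  have h3' := Metric.tendsto_nhds.1 h3 (min δ 1) (lt_min hδ one_pos)
  filter_upwards [h1, h2 ω hω0, h3', h4, h5, h6, eventually_gt_atTop 0] with n h1 h2 h3 h4 h5 h6 hn
  set p := P.gvars (s n) with hp
  set cn := P.stdAt σ A h b (s n) with hcn
  rw [Real.dist_eq] at h3
  have hcn1 : |cn - c| ≤ δ := h3.le.trans (min_le_left _ _)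
  have hcn2 : |cn| ≤ c + 1 := by
    have h7 : |cn - c| ≤ 1 := h3.le.trans (min_le_right _ _)
    have h8 := abs_sub_abs_le_abs_sub cn c
    rw [abs_of_pos hc0] at h8
    linarith
  set Q : Set (Fin n → ι ⊕ Fin (m + 1) → ℝ) := {z | t ≤ |(parityMean b' fun α => ψ (z α))
    - parityMean b' fun α => Ψ (restrict (z α))|} with hQ
  have hQm : MeasurableSet Q := by
    have e1 : Measurable fun z : Fin n → ι ⊕ Fin (m + 1) → ℝ => parityMean b' fun α => ψ (z α) := by
      unfold parityMean
      exact (Finset.measurable_sum _ fun α _ => hψm.comp (measurable_pi_apply α)).const_mul _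
    have e2 : Measurable fun z : Fin n → ι ⊕ Fin (m + 1) → ℝ =>
        parityMean b' fun α => Ψ (restrict (z α)) := by
      unfold parityMean
      exact (Finset.measurable_sum _ fun α _ =>
        hΨm.comp (measurable_restrict.comp (measurable_pi_apply α))).const_mul _
    exact measurableSet_le measurable_const (e1.sub e2).abs
  have hker := P.resample_kernel_le (h := h) σ hb.eq_zero (s n) b' (fun v hv => (h1 v hv).2 b') hQm
    fun x y hxy hx => by
      have e1 : (parityMean b' fun α => ψ (y α)) = parityMean b' fun α => ψ (x α) :=
        parityMean_congr _ fun α hα => by rw [hxy α hα]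
      have e2 : (parityMean b' fun α => Ψ (restrict (y α)))
          = parityMean b' fun α => Ψ (restrict (x α)) :=
        parityMean_congr _ fun α hα => by rw [hxy α hα]
      change t ≤ _
      rw [e1, e2]
      exact hx
  refine hker.trans ?_
  rw [mul_div_assoc, ENNReal.ofReal_mul (by positivity), ENNReal.ofReal_pow (by norm_num),
    ENNReal.ofReal_ofNat]
  gcongr
  set d := P.drift A h b (s n) with hd
  have hd1 (α : Fin n) : |d α| ≤ P.driftScale (p α) :=
    (h2 α).trans (mul_le_of_le_one_left (hE0 _) (min_le_left _ _))
  have hdev := pi_parityMean_deviation_le hn b' (ρ := gaussianReal 0 1)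
    (F := fun α y => shifted ψ b (p α) (d α + cn * y)) (c := fun α => Ψ (p α)) (t := t) (M := M)
    (fun α => (measurable_shifted b hψm).comp (measurable_const.prodMk (by fun_prop)))
    (fun α => memLp_shifted hψm hC hψb _ _ _) ht ?_ ?_
  · refine (measure_mono fun y hy => ?_).trans hdev
    have hy' : t ≤ _ := hy
    simp only [restrict_extend] at hy'
    exact hy'
  · have e1 (α : Fin n) : |(∫ y, shifted ψ b (p α) (d α + cn * y) ∂(gaussianReal 0 1)) - Ψ (p α)|
        ≤ t / (4 * M₁) * D (p α) + K * ω * Ξ (p α) := by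
      have e2 := hsmooth (shifted ψ b (p α))
        ((measurable_shifted b hψm).comp (measurable_const.prodMk measurable_id)) (D (p α))
        (hψb (p α)) (d α) cn hcn1
      refine e2.trans ?_
      have e3 : |d α| ^ (q + 1) ≤ ω * P.driftScale (p α) ^ (q + 1) := by
        calc |d α| ^ (q + 1) ≤ (ω * P.driftScale (p α)) ^ (q + 1) := by gcongr; exact h2 α
          _ = ω ^ (q + 1) * P.driftScale (p α) ^ (q + 1) := mul_pow _ _ _
          _ ≤ _ := by
            refine mul_le_mul_of_nonneg_right ?_ (pow_nonneg (hE0 _) _)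
            exact pow_le_of_le_one hω0.le (min_le_left _ _) (by omega)
      calc D (p α) * (t / (4 * M₁) + K * |d α| ^ (q + 1))
          ≤ D (p α) * (t / (4 * M₁) + K * (ω * P.driftScale (p α) ^ (q + 1))) := by
            refine mul_le_mul_of_nonneg_left ?_ (hD0 _)
            gcongr
        _ = _ := by simp only [hΞ]; ring
    rw [← parityMean_sub]
    refine (abs_parityMean_le _ _).trans ((parityMean_mono _ e1).trans ?_)
    refine (parityMean_le_mean _ fun α => add_nonneg (mul_nonneg (by positivity) (hD0 _))
      (mul_nonneg (by positivity) (hΞ0 _))).trans ?_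
    have e3 (f g : Fin n → ℝ) (x y : ℝ) : 1 / (n : ℝ) * ∑ α, (x * f α + y * g α)
        = x * (1 / (n : ℝ) * ∑ α, f α) + y * (1 / (n : ℝ) * ∑ α, g α) := by
      rw [Finset.sum_add_distrib, ← Finset.mul_sum, ← Finset.mul_sum]; ring
    refine (e3 (fun α => D (p α)) (fun α => Ξ (p α)) _ _).trans_le ?_
    have e4 : t / (4 * M₁) * (1 / (n : ℝ) * ∑ α, D (p α)) ≤ t / (4 * M₁) * M₁ := by gcongr
    have e5 : t / (4 * M₁) * M₁ = t / 4 := by field_simp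
    have e6 : K * ω * (1 / (n : ℝ) * ∑ α, Ξ (p α)) ≤ K * ω * M₂ := by gcongr
    linarith
  · have e1 (α : Fin n) : ∫ y, shifted ψ b (p α) (d α + cn * y) ^ 4 ∂(gaussianReal 0 1)
        ≤ J * Θ (p α) := integral_shifted_pow_four_le hC hψb hcn2 _ (hd1 α)
    calc 1 / (n : ℝ) * ∑ α, ∫ y, shifted ψ b (p α) (d α + cn * y) ^ 4 ∂(gaussianReal 0 1)
        ≤ 1 / (n : ℝ) * ∑ α, J * Θ (p α) := by gcongr; exact e1 _
      _ = J * (1 / (n : ℝ) * ∑ α, Θ (p α)) := by rw [← Finset.mul_sum]; ring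
      _ ≤ M := by rw [hM]; gcongr

lemma Program.Converges.lln_matmul (H : P.Converges σ μ S) (Hc : P.CovSpec σ μ S)
    (hP : P.PolyBounded) (hh : h.PolyBounded) (hb : P.IsResidual A h (P.limitLaw σ μ S) b)
    (horth : ∀ j, P.mat j = A.flip →
      ∫ z, P.residual h b z * z (Sum.inr j) ∂(P.limitLaw σ μ S) = 0)
    (hc : 0 < P.limitStd σ μ S A h b)
    {ψ : (ι ⊕ Fin (m + 1) → ℝ) → ℝ} (hψm : Measurable ψ) (hψ : PolyBd ψ) :
    ∀ᵐ s ∂(jointLaw (κ := κ) σ μ S), ∀ b', Tendsto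
      (fun n => parityMean b' fun α => ψ ((P.matmul A h).gvars (s n) α)) atTop
      (𝓝 (1 / 2 * ∫ z, ψ z ∂((P.matmul A h).limitLaw σ μ S))) := by
  set c : ℝ := ((P.limitStd σ μ S A h b : ℝ≥0) : ℝ) with hcdef
  set Ψ : (ι ⊕ Fin m → ℝ) → ℝ := fun z => ∫ y, shifted ψ b z (c * y) ∂(gaussianReal 0 1) with hΨ
  have hΨm : Measurable Ψ := measurable_integral_shifted hψm c
  have hΨp : PolyBd Ψ := by
    obtain ⟨C, hC, q, hψb⟩ := hψ.exists_shifted_bound b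
    exact polyBd_integral_shifted hC hψb c
  have hg (n : ℕ) : Measurable fun s : Inputs ι κ n => (P.matmul A h).gvars s :=
    measurable_gvars (P := P.matmul A h) (And.intro hP hh) n
  have hr {n : ℕ} (s : Inputs ι κ n) (α : Fin n) :
      restrict ((P.matmul A h).gvars s α) = P.gvars s α :=
    congrFun (restrict_eval_matmul P A h _ s.2) α
  have hdev : ∀ b', ∀ᵐ s ∂(jointLaw (κ := κ) σ μ S), Tendsto (fun n => (parityMean b' fun α =>
      ψ ((P.matmul A h).gvars (s n) α)) - parityMean b' fun α =>
        Ψ (restrict ((P.matmul A h).gvars (s n) α))) atTop (𝓝 0) := fun b' => by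
    refine tendsto_of_eventually_dist_lt fun t ht => ?_
    obtain ⟨K, hK⟩ := H.deviation_matmul hP hh hb horth hc hψm hψ b' ht
    set Bad : ∀ n, Set (Inputs ι κ n) := fun n => {s | t ≤ |(parityMean b' fun α =>
      ψ ((P.matmul A h).gvars s α)) - parityMean b' fun α =>
        Ψ (restrict ((P.matmul A h).gvars s α))|} with hBad
    have hBm : ∀ n, MeasurableSet (Bad n) := fun n => by
      have hgα (α : Fin n) : Measurable fun s : Inputs ι κ n => (P.matmul A h).gvars s α :=
        (measurable_pi_apply α).comp (hg n)
      have e1 : Measurable fun s : Inputs ι κ n =>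
          parityMean b' fun α => ψ ((P.matmul A h).gvars s α) := by
        unfold parityMean
        exact (Finset.measurable_sum _ fun α _ => hψm.comp (hgα α)).const_mul _
      have e2 : Measurable fun s : Inputs ι κ n =>
          parityMean b' fun α => Ψ (restrict ((P.matmul A h).gvars s α)) := by
        unfold parityMean
        exact (Finset.measurable_sum _ fun α _ =>
          hΨm.comp (measurable_restrict.comp (hgα α))).const_mul _
      exact measurableSet_le measurable_const (e1.sub e2).abs
    have := eventually_notMem_of_resampling (P := fun n => inputLaw (κ := κ) σ μ S n)
      (Φ := fun n => P.resample A.base) (fun n => measurePreserving_resample σ μ S hP n A.base)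
      (fun n => P.resample_resample A.base) hBm (ennreal_tsum_ofReal_div_sq_ne_top K) hK
    refine this.mono fun s hs => hs.mono fun n hn => ?_
    simpa [hBad] using hn
  filter_upwards [ae_all_iff.2 hdev, H.lln Ψ hΨm hΨp] with s h1 h2 b'
  have h3 := (h1 b').add (h2 b')
  simp only [hr] at h3
  rw [zero_add, integral_integral_shifted Hc hP hh hb hψm hψ] at h3
  simpa using h3

end

/-! ### Null sets for the newest G-var -/

lemma gaussianReal_affine_preimage_eq_zero_iff {T : Set ℝ} (hT : MeasurableSet T) (a : ℝ) {c : ℝ}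
    (hc : c ≠ 0) : gaussianReal 0 1 {y | a + c * y ∈ T} = 0 ↔ volume T = 0 := by
  have h1 : (gaussianReal 0 1).map (fun t => a + c * t)
      = gaussianReal a (.mk (c ^ 2) (sq_nonneg _)) := by
    have : (fun t : ℝ => a + c * t) = (fun x => a + x) ∘ (fun t => c * t) := rfl
    rw [this, ← Measure.map_map (by fun_prop) (by fun_prop), gaussianReal_map_const_mul,
      gaussianReal_map_const_add]
    simp
  have hv : (NNReal.mk (c ^ 2) (sq_nonneg _)) ≠ 0 := by
    rw [Ne, ← NNReal.coe_eq_zero]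
    simpa using hc
  have h2 : gaussianReal 0 1 {y | a + c * y ∈ T}
      = gaussianReal a (.mk (c ^ 2) (sq_nonneg _)) T := by
    rw [← h1, Measure.map_apply (by fun_prop) hT]
    rfl
  rw [h2]
  exact ⟨fun h => gaussianReal_absolutelyContinuous' a hv h,
    fun h => gaussianReal_absolutelyContinuous a hv h⟩

section

variable [Fintype ι] [DecidableEq ι] [Fintype κ] {σ : κ → ℝ≥0} {μ : ι → ℝ} {S : Matrix ι ι ℝ}
  {m : ℕ} {P : Program ι κ m} {A : AVar κ} {h : HVar (ι ⊕ Fin m)} {b : Fin m → ℝ}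

lemma Program.Converges.null_matmul (H : P.Converges σ μ S) (Hc : P.CovSpec σ μ S)
    (hP : P.PolyBounded) (hh : h.PolyBounded) (hb : P.IsResidual A h (P.limitLaw σ μ S) b)
    (horth : ∀ j, P.mat j = A.flip →
      ∫ z, P.residual h b z * z (Sum.inr j) ∂(P.limitLaw σ μ S) = 0)
    (hc : 0 < P.limitStd σ μ S A h b)
    {N : Set (ι ⊕ Fin (m + 1) → ℝ)} (hN : MeasurableSet N)
    (hN0 : (P.matmul A h).limitLaw σ μ S N = 0) :
    ∀ᵐ s ∂(jointLaw (κ := κ) σ μ S), ∀ᶠ n in atTop, ∀ α, (P.matmul A h).gvars (s n) α ∉ N := by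
  set c : ℝ := ((P.limitStd σ μ S A h b : ℝ≥0) : ℝ) with hcdef
  have hc0 : 0 < c := hc
  have hN' : MeasurableSet {p : (ι ⊕ Fin m → ℝ) × ℝ | extend p.1 p.2 ∈ N} := measurable_extend hN
  have hNz (z : ι ⊕ Fin m → ℝ) : MeasurableSet {y | extend z y ∈ N} :=
    (measurable_extend.comp (measurable_const.prodMk measurable_id)) hN
  set N₀ : Set (ι ⊕ Fin m → ℝ) := {z | volume {y | extend z y ∈ N} ≠ 0} with hN₀
  have hN₀m : MeasurableSet N₀ := by
    have : Measurable fun z => volume {y | extend z y ∈ N} :=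
      measurable_measure_prodMk_left (ν := (volume : Measure ℝ)) hN'
    exact (this (measurableSet_singleton 0)).compl
  have hN₀0 : P.limitLaw σ μ S N₀ = 0 := by
    have hm : Measurable fun p : (ι ⊕ Fin m → ℝ) × ℝ =>
        extend p.1 (∑ l, b l * p.1 (Sum.inr l) + P.limitStd σ μ S A h b * p.2) := by
      have : Measurable fun p : (ι ⊕ Fin m → ℝ) × ℝ =>
          ∑ l, b l * p.1 (Sum.inr l) + P.limitStd σ μ S A h b * p.2 := by fun_prop
      exact measurable_extend.comp (measurable_fst.prodMk this)
    rw [Hc.limitLaw_matmul hP hh hb, Measure.map_apply hm hN,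
      Measure.measure_prod_null (hm hN)] at hN0
    rw [measure_eq_zero_iff_ae_notMem]
    filter_upwards [hN0] with z hz
    refine not_not.2 ?_
    exact (gaussianReal_affine_preimage_eq_zero_iff (hNz z) (∑ l, b l * z (Sum.inr l)) hc0.ne').1 hz
  have hg (n : ℕ) (α : Fin n) : Measurable fun s : Inputs ι κ n => (P.matmul A h).gvars s α :=
    (measurable_pi_apply α).comp
      (measurable_gvars (P := P.matmul A h) (And.intro hP hh) n)
  set Bad : ∀ n, Set (Inputs ι κ n) := fun n => {s | ∃ α, (P.matmul A h).gvars s α ∈ N} with hBad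
  have hBad' (n : ℕ) : Bad n = ⋃ α, (fun s : Inputs ι κ n => (P.matmul A h).gvars s α) ⁻¹' N := by
    ext; simp [hBad]
  have hBm (n : ℕ) : MeasurableSet (Bad n) := by
    rw [hBad']
    exact MeasurableSet.iUnion fun α => (hg n α) hN
  obtain ⟨C', -, hspan⟩ := H.span_control hP A.flip
  have hker : ∀ᵐ s ∂(jointLaw (κ := κ) σ μ S), ∀ᶠ n in atTop,
      gaussianMatrix n (σ A.base ^ 2 / n) {V | P.resample A.base (s n) V ∈ Bad n}
        ≤ (0 : ℕ → ENNReal) n := by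
    filter_upwards [hspan, H.null N₀ hN₀m hN₀0, H.tendsto_stdAt hP hh hb horth] with s h1 h2 h3
    filter_upwards [h1, h2, h3.eventually_const_lt hc0] with n h1 h2 h3
    have e1 : {V | P.resample A.base (s n) V ∈ Bad n} = ⋃ α : Fin n,
        {V | (P.matmul A h).gvars (P.resample A.base (s n) V) ∈ {z | z α ∈ N}} := by
      ext; simp [hBad]
    rw [e1]
    refine (measure_iUnion_null fun α => ?_).le
    have hQm : MeasurableSet {z : Fin n → ι ⊕ Fin (m + 1) → ℝ | z α ∈ N} := measurable_pi_apply α hN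
    have h4 := P.resample_kernel_le (h := h) σ hb.eq_zero (s n) α.val.bodd
      (fun v hv => (h1 v hv).2 _) hQm fun x y hxy hx => by
        change y α ∈ N
        rw [← hxy α rfl]
        exact hx
    refine le_antisymm (h4.trans (le_of_eq ?_)) zero_le
    set p := P.gvars (s n) with hp
    have h5 : (Measure.pi fun _ : Fin n => gaussianReal 0 1) {y | (fun α =>
          extend (p α) (∑ l, b l * p α (Sum.inr l) + (P.drift A h b (s n) α
            + P.stdAt σ A h b (s n) * y α))) ∈ {z : Fin n → ι ⊕ Fin (m + 1) → ℝ | z α ∈ N}}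
        = gaussianReal 0 1 {y | (∑ l, b l * p α (Sum.inr l) + P.drift A h b (s n) α)
            + P.stdAt σ A h b (s n) * y ∈ {y | extend (p α) y ∈ N}} := by
      have hm : Measurable fun y : ℝ => (∑ l, b l * p α (Sum.inr l) + P.drift A h b (s n) α)
            + P.stdAt σ A h b (s n) * y := by fun_prop
      refine Eq.trans ?_ ((measurePreserving_eval (fun _ : Fin n => gaussianReal 0 1)
        α).measure_preimage (hm (hNz (p α))).nullMeasurableSet)
      congr 1
      ext y
      simp only [Set.mem_preimage, Set.mem_ofPred_eq, Function.eval, add_assoc]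
    have h6 : volume {y | extend (p α) y ∈ N} = 0 := by
      have := h2 α
      rw [hN₀] at this
      exact not_not.1 this
    rw [h5, (gaussianReal_affine_preimage_eq_zero_iff (hNz _) _ h3.ne').2 h6, mul_zero]
  have := eventually_notMem_of_resampling (P := fun n => inputLaw (κ := κ) σ μ S n)
    (Φ := fun n => P.resample A.base) (fun n => measurePreserving_resample σ μ S hP n A.base)
    (fun n => P.resample_resample A.base) hBm (δ := 0) (by simp) hker
  refine this.mono fun s hs => hs.mono fun n hn => ?_
  simpa [hBad] using hn

/-! ### The degenerate case, and the conclusion -/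

lemma ae_fst_eq_zero {w : κ} (hw : σ w = 0) :
    ∀ᵐ s ∂(jointLaw (κ := κ) σ μ S), ∀ n, (s n).1 w = 0 := by
  refine ae_all_iff.2 fun n => ?_
  have h1 : ∀ᵐ s ∂(inputLaw (κ := κ) σ μ S n), s.1 w = 0 := by
    have h2 : ∀ i j, ∀ᵐ s ∂(inputLaw (κ := κ) σ μ S n), s.1 w i j = 0 := fun i j => by
      have hmp : MeasurePreserving (fun s : Inputs ι κ n => s.1 w i j) (inputLaw σ μ S n)
          (gaussianReal 0 (σ w ^ 2 / n)) :=
        (measurePreserving_eval (fun _ : Fin n => gaussianReal 0 (σ w ^ 2 / n)) j).comp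
          ((measurePreserving_eval (fun _ : Fin n => Measure.pi fun _ : Fin n =>
            gaussianReal 0 (σ w ^ 2 / n)) i).comp
          ((measurePreserving_eval (fun w : κ => Measure.pi fun _ : Fin n =>
            Measure.pi fun _ : Fin n => gaussianReal 0 (σ w ^ 2 / n)) w).comp
              measurePreserving_fst))
      have h0 : ∀ᵐ x ∂(gaussianReal 0 (σ w ^ 2 / n)), x = 0 := by
        simp [hw, ae_dirac_eq]
      exact hmp.quasiMeasurePreserving.ae h0
    filter_upwards [ae_all_iff.2 fun i => ae_all_iff.2 fun j => h2 i j] with s hs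
    funext i j
    exact hs i j
  exact (measurePreserving_eval_infinitePi (fun n => inputLaw (κ := κ) σ μ S n)
    n).quasiMeasurePreserving.ae h1

lemma Program.Converges.mulVec_residualVec_eq_zero (H : P.Converges σ μ S) (hP : P.PolyBounded)
    (hh : h.PolyBounded) (hc : P.limitStd σ μ S A h b = 0) :
    ∀ᵐ s ∂(jointLaw (κ := κ) σ μ S), ∀ᶠ n in atTop,
      A.eval (fun W => Matrix.of ((s n).1 W)) *ᵥ P.residualVec h b (P.gvars (s n)) = 0 := by
  have h0 := P.limitStd_sq σ μ S A h b
  rw [hc] at h0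
  rcases mul_eq_zero.1 (h0.symm.trans (by simp)) with hσ | hr
  · have hσ' : σ A.base = 0 := by simpa using hσ
    filter_upwards [ae_fst_eq_zero (μ := μ) (S := S) hσ'] with s hs
    refine Eventually.of_forall fun n => ?_
    have : A.eval (fun W => Matrix.of ((s n).1 W)) = 0 := by
      cases A with
      | input w => exact hs n
      | transpose w =>
        have : Matrix.of ((s n).1 w) = 0 := hs n
        simp [AVar.eval, this]
    rw [this, Matrix.zero_mulVec]
  · have hrm := measurable_residual hP hh b
    have hr2 : Integrable (fun z => P.residual h b z ^ 2) (P.limitLaw σ μ S) :=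
      ((polyBd_residual hP hh b).pow 2).integrable (hrm.pow_const 2) _
    have h1 := (integral_eq_zero_iff_of_nonneg (fun z => sq_nonneg _) hr2).1 hr
    have h2 : P.limitLaw σ μ S {z | P.residual h b z ≠ 0} = 0 := by
      rw [measure_eq_zero_iff_ae_notMem]
      filter_upwards [h1] with z hz
      simpa using hz
    filter_upwards [H.null _ (hrm (measurableSet_singleton 0)).compl h2] with s hs
    refine hs.mono fun n hn => ?_
    have : P.residualVec h b (P.gvars (s n)) = 0 := funext fun α => not_not.1 (hn α)
    rw [this, Matrix.mulVec_zero]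

lemma Program.Converges.matmul_of_limitStd_eq_zero (H : P.Converges σ μ S)
    (Hc : P.CovSpec σ μ S) (hP : P.PolyBounded) (hh : h.PolyBounded)
    (hb : P.IsResidual A h (P.limitLaw σ μ S) b) (hc : P.limitStd σ μ S A h b = 0) :
    (P.matmul A h).Converges σ μ S := by
  set T : (ι ⊕ Fin m → ℝ) → ι ⊕ Fin (m + 1) → ℝ := fun z =>
    extend z (∑ l, b l * z (Sum.inr l)) with hT
  have hTm : Measurable T := by
    have : Measurable fun z : ι ⊕ Fin m → ℝ => ∑ l, b l * z (Sum.inr l) := by fun_prop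
    exact measurable_extend.comp (measurable_id.prodMk this)
  have hTp : PolyBd fun z => ‖T z‖ := PolyBd.norm_pi fun g => by
    rcases g with i | l
    · simp only [hT, extend_inl]; exact PolyBd.eval _
    · induction l using Fin.lastCases with
      | last =>
        simp only [hT, extend_last]
        exact PolyBd.sum _ fun l _ => (PolyBd.eval _).const_mul _
      | cast l => simp only [hT, extend_castSucc]; exact PolyBd.eval _
  have hlaw : (P.matmul A h).limitLaw σ μ S = (P.limitLaw σ μ S).map T := by
    have h1 : (fun p : (ι ⊕ Fin m → ℝ) × ℝ => extend p.1 (∑ l, b l * p.1 (Sum.inr l)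
        + P.limitStd σ μ S A h b * p.2)) = T ∘ Prod.fst := by
      funext p
      simp [hc, hT]
    rw [Hc.limitLaw_matmul hP hh hb, h1, ← Measure.map_map hTm measurable_fst,
      measurePreserving_fst.map_eq]
  have hgv : ∀ᵐ s ∂(jointLaw (κ := κ) σ μ S), ∀ᶠ n in atTop, ∀ α,
      (P.matmul A h).gvars (s n) α = T (P.gvars (s n) α) := by
    filter_upwards [H.mulVec_residualVec_eq_zero hP hh hc] with s hs
    refine hs.mono fun n hn α => ?_
    rw [gvars_matmul hb.eq_zero, hn, Pi.zero_apply, add_zero]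
  refine ⟨fun ψ hψm hψ => ?_, fun N hN hN0 => ?_⟩
  · filter_upwards [hgv, H.lln (fun z => ψ (T z)) (hψm.comp hTm) (hψ.comp hTp)] with s h1 h2 b'
    rw [hlaw, integral_map hTm.aemeasurable hψm.aestronglyMeasurable]
    refine (h2 b').congr' (h1.mono fun n hn => ?_)
    simp only [hn]
  · rw [hlaw, Measure.map_apply hTm hN] at hN0
    filter_upwards [hgv, H.null _ (hTm hN) hN0] with s h1 h2
    filter_upwards [h1, h2] with n h1 h2 α
    rw [h1]
    exact h2 α

lemma Program.converges {V : Set ι} (σ : κ → ℝ≥0) (hS : S.PosSemidef) (hμ : ∀ i ∈ V, μ i = 0)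
    (hSV : ∀ i ∈ V, ∀ j ∉ V, S i j = 0 ∧ S j i = 0) {m : ℕ} {P : Program ι κ m}
    (hP : P.PolyBounded) (hV : P.MatmulsBPLike V) : P.Converges σ μ S := by
  induction P with
  | inputs => exact converges_inputs hS
  | matmul P A h ih =>
    obtain ⟨hP, hh⟩ := hP
    have H := ih hP hV.of_matmul
    have Hc := P.covSpec σ μ hS hP
    obtain ⟨b, hb⟩ := P.exists_isResidual hP A hh (P.limitLaw σ μ S)
    rcases (zero_le : 0 ≤ P.limitStd σ μ S A h b).eq_or_lt with hc | hc
    · exact H.matmul_of_limitStd_eq_zero Hc hP hh hb hc.symm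
    · have horth := fun j => H.integral_residual_mul_eq_zero (j := j) hS hP hh hV hμ hSV hb.eq_zero
      exact ⟨fun ψ hψm hψ => H.lln_matmul Hc hP hh hb horth hc hψm hψ,
        fun N hN hN0 => H.null_matmul Hc hP hh hb horth hc hN hN0⟩

end

end NetsorT

end

theorem mainTheorem1 {ι κ : Type*} [Fintype ι] [DecidableEq ι] [Fintype κ] {m : ℕ}
    (P : NetsorT.Program ι κ m) (σ : κ → ℝ≥0)
    (μ : ι → ℝ) (S : Matrix ι ι ℝ) (hS : S.PosSemidef)
    (hpoly : P.PolyBounded) (hBP : P.BPLike μ S)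
    (ψ : (ι ⊕ Fin m → ℝ) → ℝ) (hψm : Measurable ψ) (hψ : NetsorT.PolyBounded ψ) :
    (P.limitCov σ μ S).PosSemidef ∧
    Integrable ψ (NetsorT.gaussianVec (NetsorT.limitMean μ m) (P.limitCov σ μ S)) ∧
    ∀ᵐ s ∂(NetsorT.jointLaw (κ := κ) σ μ S),
      Tendsto (fun n : ℕ => (1 / (n : ℝ)) * ∑ α : Fin n, ψ (P.gvars (s n) α)) atTop
        (𝓝 (∫ z, ψ z ∂(NetsorT.gaussianVec (NetsorT.limitMean μ m) (P.limitCov σ μ S)))) := by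
  obtain ⟨V, hV, hμ, hSV⟩ := hBP
  have H := NetsorT.Program.converges σ hS hμ hSV hpoly hV
  exact ⟨(P.covSpec σ μ hS hpoly).posSemidef, hψ.polyBd.integrable hψm _, H.mean hψm hψ.polyBd⟩
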